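/- Fix integers $K\ge 2$ and $W\ge 2$, a noise parameter $\theta\in[0,1/2)$, and $\gamma>0$ with $\gamma<\lfloor K^2/4\rfloor/\binom K2$ (the largest relative minimal distance that $K$ sign vectors can have asymptotically), all constant. **Model (symmetric setting).** There are $n$ users (with $K\mid n$) and $m$ items. The users are partitioned into $K$ clusters $\mathcal C_1,\dots,\mathcal C_K$ of size $n/K$ each. Cluster $\mathcal C_k$ has a nominal rating vector $v_k\in\{+1,-1\}^m$, and the nominal rating matrix $R\in\{+1,-1\}^{n\times m}$ has $i$-th row $v_k$ when $i\in\mathcal C_k$. Let $\mathcal R^{(\gamma)}$ be the set of such matrices for which the minimal Hamming distance between $v_i$ and $v_j$ over $i\ne j$ is exactly $\lceil\gamma m\rceil$. Given $R$, one observes, all mutually independent: (i) a matrix $U$ with $U_{ij}=R_{ij}$ with probability $p(1-\theta)$, $U_{ij}=-R_{ij}$ with probability $p\theta$, and $U_{ij}=*$ (erased) with probability $1-p$; (ii) for $2\le d\le W$, a random $d$-uniform hypergraph $HG_d$ on the users, in which a $d$-subset of users is a hyperedge with probability $\alpha_d$ if its users all lie in one cluster and with probability $\beta_d$ otherwise.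 An estimator $\psi$ maps $(U,\{HG_d\}_{d=2}^W)$ to a matrix in $\{+1,-1\}^{n\times m}$, and its worst-case error probability is $$P^{(\gamma)}_{\mathrm{err}}(\psi)=\max_{X\in\mathcal R^{(\gamma)}}\mathbb P\big(\psi(U,\{HG_d\}_{d=2}^W)\ne R\mid R=X\big).$$ Put $I_\theta=(\sqrt{1-\theta}-\sqrt\theta)^2$ and $I_d=(\sqrt{\alpha_d}-\sqrt{\beta_d})^2$. **Theorem.** Consider a sequence of such problems with $n\to\infty$, where $m$, $p\in[0,1]$ and $\alpha_d,\beta_d$ may vary along the sequence, with $m=\omega(\log n)$, $m=o(e^n)$, $p\to0$, and, for each $2\le d\le W$, $0\le\beta_d<\alpha_d\le1$ and $\alpha_d,\beta_d=\Theta\big(\log n/\binom{n-1}{d-1}\big)$. Let $\epsilon>0$ and suppose that, for all sufficiently large members of the sequence, $$p\le\max\left\{\frac{(1-\epsilon)\log n-\sum_{d=2}^W\frac{\binom{n-1}{d-1}}{K^{d-1}}I_d}{I_\theta\,\gamma\,m},\ \frac{(1-\epsilon)K\log m}{I_\theta\,n}\right\}.$$ Then for every sequence of estimators $\psi$, the worst-case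 error probability $P^{(\gamma)}_{\mathrm{err}}(\psi)$ does not tend to $0$. -/

import Mathlib

open Filter Asymptotics Topology

namespace MatrixCompletion

/-- Potential hyperedges: sets of `d` users with `2 ≤ d ≤ W` (ordinary edges are the case `d = 2`). -/
abbrev PotentialEdge (n W : ℕ) : Type :=
  {h : Finset (Fin n) // 2 ≤ h.card ∧ h.card ≤ W}

/-- The sub-sampled matrix `U`: `none` is the erasure symbol, ratings are `+1` or `-1`. -/
abbrev SampledMatrix (n m : ℕ) : Type := Fin n → Fin m → Option ℤˣ

/-- The collection `(HG_d)` for `2 ≤ d ≤ W`, as the set of all hyperedges that are present; the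
hyperedges of `HG_d` are those of cardinality `d`. -/
abbrev HypergraphCollection (n W : ℕ) : Type := Finset (PotentialEdge n W)

/-- An estimator maps the observed `U` and `(HG_d)` to a rating matrix. -/
abbrev Estimator (n m W : ℕ) : Type :=
  SampledMatrix n m → HypergraphCollection n W → Matrix (Fin n) (Fin m) ℤˣ

/-- A ground truth in the symmetric setting: an assignment of the `n` users to `K` clusters of size
exactly `n / K`, and nominal rating vectors in `{+1,-1}^m` whose minimal pairwise Hamming
distance is exactly `⌈γ m⌉`. -/
structure GroundTruth (n m K : ℕ) (γ : ℝ) where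
  /-- the cluster of each user -/
  cluster : Fin n → Fin K
  /-- the nominal rating vector of each cluster -/
  vec : Fin K → Fin m → ℤˣ
  card_cluster : ∀ k, K * (Finset.univ.filter fun i => cluster i = k).card = n
  minDist : IsLeast {D : ℕ | ∃ i j : Fin K, i ≠ j ∧ D = hammingDist (vec i) (vec j)} ⌈γ * m⌉₊

/-- The nominal rating matrix `R`: row `i` is the nominal rating vector of the cluster of `i`. -/
def GroundTruth.nominal {n m K : ℕ} {γ : ℝ} (g : GroundTruth n m K γ) :
    Matrix (Fin n) (Fin m) ℤˣ :=
  Matrix.of fun i j => g.vec (g.cluster i) j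

/-- Law of an entry of `U` whose nominal rating is `r`: `r` with probability `p (1 - θ)`, `-r` with
probability `p θ`, erased with probability `1 - p`. -/
noncomputable def entryProb (p θ : ℝ) (r : ℤˣ) : Option ℤˣ → ℝ
  | none => 1 - p
  | some x => if x = r then p * (1 - θ) else p * θ

/-- The probability that the potential hyperedge `h` appears: `α_d` if its `d` users all belong to
one cluster, and `β_d` otherwise. -/
noncomputable def edgeProb {n K W : ℕ} (α β : ℕ → ℝ) (c : Fin n → Fin K)
    (h : PotentialEdge n W) : ℝ :=
  if ∀ i ∈ h.1, ∀ j ∈ h.1, c i = c j then α h.1.card else β h.1.card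

/-- The probability of observing `(U, H)` under the ground truth `g`; entries and hyperedges are
mutually independent. -/
noncomputable def obsProb {n m K : ℕ} {γ : ℝ} (W : ℕ) (p θ : ℝ) (α β : ℕ → ℝ)
    (g : GroundTruth n m K γ) (U : SampledMatrix n m) (H : HypergraphCollection n W) : ℝ :=
  (∏ i, ∏ j, entryProb p θ (g.nominal i j) (U i j)) *
    ∏ h : PotentialEdge n W,
      if h ∈ H then edgeProb α β g.cluster h else 1 - edgeProb α β g.cluster h

/-- The probability that `ψ` does not output exactly the nominal rating matrix of `g`. -/
noncomputable def errProb {n m K : ℕ} {γ : ℝ} (W : ℕ) (p θ : ℝ) (α β : ℕ → ℝ)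
    (ψ : Estimator n m W) (g : GroundTruth n m K γ) : ℝ :=
  ∑ U : SampledMatrix n m, ∑ H : HypergraphCollection n W,
    if ψ U H ≠ g.nominal then obsProb W p θ α β g U H else 0

/-- Worst-case error probability of `ψ` (a maximum over the finitely many ground truths). -/
noncomputable def worstErr {n m : ℕ} (K W : ℕ) (γ p θ : ℝ) (α β : ℕ → ℝ)
    (ψ : Estimator n m W) : ℝ :=
  ⨆ g : GroundTruth n m K γ, errProb W p θ α β ψ g

/-- The quality `(√a - √b)²`: `I_d` is `quality α_d β_d`, and `I_θ` is `quality (1 - θ) θ`. -/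
noncomputable def quality (a b : ℝ) : ℝ := (√a - √b) ^ 2

/-- The bound on the sample probability. -/
noncomputable def sampleBound (n m K W : ℕ) (γ θ ε : ℝ) (α β : ℕ → ℝ) : ℝ :=
  max
    (((1 - ε) * Real.log n -
        ∑ d ∈ Finset.Icc 2 W,
          ((n - 1).choose (d - 1) : ℝ) / (K : ℝ) ^ (d - 1) * quality (α d) (β d)) /
      (quality (1 - θ) θ * γ * m))
    ((1 - ε) * K * Real.log m / (quality (1 - θ) θ * n))

end MatrixCompletion

-- For each of the two terms of the maximum there is a finite family of ground truths in which,
-- whichever member is true, some other member is at least half as likely given the data, with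
-- probability bounded below. Every decoder then errs with probability bounded below under some
-- member (`exists_error_ge`, `le_worstErr`).
--
-- Both families are indexed by the M-element subsets X of a set of 2M objects, and the rivals of X
-- arise by exchanging some s in X for some t outside X. Unlike a single move, an exchange respects
-- the constraints on cluster sizes and on the minimal distance. The likelihood ratio of an exchange
-- essentially factors into a contribution of s and one of t, and the contributions of different
-- objects are independent. Hence if each single move is favoured with probability q ≥ 1/M, suitable
-- s and t both exist with probability at least 1 - 2(1-q)^M ≥ 1/4 (`one_sub_pow_le_prodExp_exists`,
-- `prodExp_prodProb_and`, `quarter_le_one_sub_pow`).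
--
-- The bound on q is a reversed Chernoff bound (`chernoff_lower`). Tilt the two competing laws P, Q
-- to the law proportional to √(PQ). A bijection that exchanges P and Q preserves the tilted law and
-- negates the log-likelihood ratio, which is therefore symmetric; Chebyshev's inequality confines
-- it to the scale of its standard deviation. Undoing the tilt bounds q below by the product of the
-- Hellinger affinities times the exponential of minus that scale. The affinities cost I_θ in the
-- exponent per sampled rating and I_d/2 per affected hyperedge up to second order, while the scale
-- is of order the square root of the main exponent.
--
-- In the column family (`le_worstErr_of_columns`) the objects are items, and a move flips the n/K
-- ratings of an item in one cluster; M is linear in m, which yields the second term. In the user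
-- family (`le_worstErr_of_users`) the objects are users of two clusters, and a move changes ⌈γm⌉
-- ratings and the hyperedges at that user; M is about n^(1-ε/4), which yields the first term.
-- Hyperedges with two or more critical users spoil independence, so they are resampled: with
-- probability at least 1/2 those at s or t are all absent, at the price of a factor 1/2 in the
-- likelihood.
--
-- Both families start from rating vectors with exactly one pair at distance ⌈γm⌉ and all others
-- farther apart by a linear margin (`exists_ratingVectors`).

namespace MatrixCompletion

-- Expectations and independence under finite product laws

section ProductExpectation

variable {ι A κ : Type*} [Fintype ι] [DecidableEq ι] [Fintype A]

/-- Expectation of `F` under the product of the weights `w i`. -/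
noncomputable def prodExp (w : ι → A → ℝ) (F : (ι → A) → ℝ) : ℝ :=
  ∑ x : ι → A, (∏ i, w i (x i)) * F x

open scoped Classical in
/-- Probability of the event `E` under the product of the weights `w i`. -/
noncomputable def prodProb (w : ι → A → ℝ) (E : (ι → A) → Prop) : ℝ :=
  prodExp w fun x => if E x then 1 else 0

theorem prodProb_eq (w : ι → A → ℝ) (E : (ι → A) → Prop) [DecidablePred E] :
    prodProb w E = prodExp w fun x => if E x then 1 else 0 := by
  rw [prodProb]
  congr!

/-- Every `w i` is a probability vector. -/
structure IsLaw (w : ι → A → ℝ) : Prop where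
  nonneg : ∀ i a, 0 ≤ w i a
  sum_one : ∀ i, ∑ a, w i a = 1

omit [DecidableEq ι] in
theorem IsLaw.prod_nonneg {w : ι → A → ℝ} (hw : IsLaw w) (x : ι → A) : 0 ≤ ∏ i, w i (x i) :=
  Finset.prod_nonneg fun i _ => hw.nonneg i _

theorem prodExp_prod (w : ι → A → ℝ) (f : ι → A → ℝ) :
    prodExp w (fun x => ∏ i, f i (x i)) = ∏ i, ∑ a, w i a * f i a := by
  simp [prodExp, ← Finset.prod_mul_distrib, Finset.prod_univ_sum]

theorem sum_prod_eq_one {w : ι → A → ℝ} (hw : IsLaw w) : ∑ x : ι → A, ∏ i, w i (x i) = 1 := by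
  have := prodExp_prod w (fun _ _ => 1)
  simpa [prodExp, hw.sum_one] using this

theorem prodExp_const {w : ι → A → ℝ} (hw : IsLaw w) (c : ℝ) : prodExp w (fun _ => c) = c := by
  rw [prodExp, ← Finset.sum_mul, sum_prod_eq_one hw, one_mul]

theorem prodExp_mono_of_pos {w : ι → A → ℝ} (hw : IsLaw w) {F G : (ι → A) → ℝ}
    (h : ∀ x, 0 < ∏ i, w i (x i) → F x ≤ G x) : prodExp w F ≤ prodExp w G := by
  refine Finset.sum_le_sum fun x _ => ?_
  rcases (hw.prod_nonneg x).eq_or_lt with h0 | h0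
  · simp [← h0]
  · exact mul_le_mul_of_nonneg_left (h x h0) h0.le

theorem prodExp_mono {w : ι → A → ℝ} (hw : IsLaw w) {F G : (ι → A) → ℝ}
    (h : ∀ x, F x ≤ G x) : prodExp w F ≤ prodExp w G :=
  prodExp_mono_of_pos hw fun x _ => h x

theorem prodExp_add (w : ι → A → ℝ) (F G : (ι → A) → ℝ) :
    prodExp w (fun x => F x + G x) = prodExp w F + prodExp w G := by
  simp [prodExp, mul_add, Finset.sum_add_distrib]

theorem prodExp_sub (w : ι → A → ℝ) (F G : (ι → A) → ℝ) :
    prodExp w (fun x => F x - G x) = prodExp w F - prodExp w G := by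
  simp [prodExp, mul_sub, Finset.sum_sub_distrib]

theorem prodExp_const_mul (w : ι → A → ℝ) (c : ℝ) (F : (ι → A) → ℝ) :
    prodExp w (fun x => c * F x) = c * prodExp w F := by
  simp only [prodExp, Finset.mul_sum]
  exact Finset.sum_congr rfl fun _ _ => by ring

theorem prodExp_mul_const (w : ι → A → ℝ) (c : ℝ) (F : (ι → A) → ℝ) :
    prodExp w (fun x => F x * c) = prodExp w F * c := by
  simp only [prodExp, Finset.sum_mul]
  exact Finset.sum_congr rfl fun _ _ => by ring

theorem prodExp_sum {σ : Type*} (w : ι → A → ℝ) (s : Finset σ) (F : σ → (ι → A) → ℝ) :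
    prodExp w (fun x => ∑ k ∈ s, F k x) = ∑ k ∈ s, prodExp w (F k) := by
  simp only [prodExp, Finset.mul_sum]
  exact Finset.sum_comm

theorem prodProb_nonneg {w : ι → A → ℝ} (hw : IsLaw w) (E : (ι → A) → Prop) :
    0 ≤ prodProb w E := by
  rw [← prodExp_const hw 0]
  exact prodExp_mono hw fun x => by split_ifs <;> norm_num

theorem prodProb_le_one {w : ι → A → ℝ} (hw : IsLaw w) (E : (ι → A) → Prop) :
    prodProb w E ≤ 1 := by
  rw [← prodExp_const hw 1]
  exact prodExp_mono hw fun x => by split_ifs <;> norm_num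

theorem prodProb_mono_of_pos {w : ι → A → ℝ} (hw : IsLaw w) {E E' : (ι → A) → Prop}
    (h : ∀ x, 0 < ∏ i, w i (x i) → E x → E' x) : prodProb w E ≤ prodProb w E' := by
  refine prodExp_mono_of_pos hw fun x hx => ?_
  by_cases hE : E x
  · simp [hE, h x hx hE]
  · rw [if_neg hE]; split_ifs <;> norm_num

/-- Taking the coordinates in `p` from one sample and the others from an independent sample
yields a sample of the same law. -/
theorem prodExp_resample {w : ι → A → ℝ} (hw : IsLaw w) (p : ι → Prop) [DecidablePred p]
    (F : (ι → A) → ℝ) :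
    prodExp w F = prodExp w fun x => prodExp w fun y => F fun i => if p i then x i else y i := by
  -- This involution exchanges the coordinates outside `p` between the two samples; it preserves the
  -- weight of the pair.
  let e : (ι → A) × (ι → A) → (ι → A) × (ι → A) := fun z =>
    (fun i => if p i then z.1 i else z.2 i, fun i => if p i then z.2 i else z.1 i)
  have he : Function.Involutive e := by
    rintro ⟨x, y⟩
    simp only [e, Prod.mk.injEq]
    constructor <;> funext i <;> by_cases h : p i <;> simp [h]
  have hW : ∀ z, (∏ i, w i ((e z).1 i)) * ∏ i, w i ((e z).2 i)
      = (∏ i, w i (z.1 i)) * ∏ i, w i (z.2 i) := by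
    intro z
    simp only [← Finset.prod_mul_distrib]
    refine Finset.prod_congr rfl fun i _ => ?_
    by_cases h : p i <;> simp [e, h, mul_comm]
  have h1 : prodExp w F
      = ∑ z : (ι → A) × (ι → A), ((∏ i, w i (z.1 i)) * ∏ i, w i (z.2 i)) * F z.1 := by
    rw [Fintype.sum_prod_type]
    refine Finset.sum_congr rfl fun x _ => ?_
    simp only [← Finset.sum_mul, ← Finset.mul_sum, sum_prod_eq_one hw, mul_one]
  rw [h1, ← Equiv.sum_comp he.toPerm, Fintype.sum_prod_type]
  refine Finset.sum_congr rfl fun x _ => ?_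
  simp only [prodExp]
  rw [Finset.mul_sum]
  refine Finset.sum_congr rfl fun y _ => ?_
  have := hW (x, y)
  simp only [Function.Involutive.coe_toPerm]
  rw [this, mul_assoc]

/-- After resampling, `f` sees only the first sample and `g` only the second, so the double
expectation splits. -/
theorem prodExp_mul_of_dependsOn {w : ι → A → ℝ} (hw : IsLaw w) {s : Set ι}
    {f g : (ι → A) → ℝ} (hf : DependsOn f s) (hg : DependsOn g sᶜ) :
    prodExp w (fun x => f x * g x) = prodExp w f * prodExp w g := by
  classical
  rw [prodExp_resample hw (· ∈ s)]
  have : ∀ x y : ι → A, f (fun i => if i ∈ s then x i else y i) = f x := fun x y =>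
    hf fun i hi => by simp [hi]
  have h' : ∀ x y : ι → A, g (fun i => if i ∈ s then x i else y i) = g y := fun x y =>
    hg fun i hi => by simp [show i ∉ s from hi]
  simp only [this, h', prodExp_const_mul, prodExp_mul_const]

theorem prodExp_prod_blocks {w : ι → A → ℝ} (hw : IsLaw w) (B : κ → Set ι)
    (hB : ∀ i s s', i ∈ B s → i ∈ B s' → s = s') (S : Finset κ) (f : κ → (ι → A) → ℝ)
    (hf : ∀ s ∈ S, DependsOn (f s) (B s)) :
    prodExp w (fun x => ∏ s ∈ S, f s x) = ∏ s ∈ S, prodExp w (f s) := by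
  classical
  induction S using Finset.induction_on with
  | empty => simp [prodExp_const hw]
  | insert s S hs ih =>
    simp only [Finset.prod_insert hs]
    rw [prodExp_mul_of_dependsOn hw (hf s (Finset.mem_insert_self _ _)), ih]
    · exact fun k hk => hf k (Finset.mem_insert_of_mem hk)
    · intro x y hxy
      refine Finset.prod_congr rfl fun k hk => hf k (Finset.mem_insert_of_mem hk) fun i hi => ?_
      refine hxy i fun his => hs ?_
      rwa [hB i s k his hi]

/-- Among independent events `R s ∧ T s` of probability at least `q`, one occurs with probability
at least `1 - (1 - q) ^ #X`. -/
theorem one_sub_pow_le_prodExp_exists {ι' A' : Type*} [Fintype ι'] [DecidableEq ι'] [Fintype A']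
    {w : ι → A → ℝ} (hw : IsLaw w) {w' : ι' → A' → ℝ} (hw' : IsLaw w')
    (B : κ → Set ι) (hB : ∀ i s s', i ∈ B s → i ∈ B s' → s = s')
    (B' : κ → Set ι') (hB' : ∀ i s s', i ∈ B' s → i ∈ B' s' → s = s')
    (R : κ → (ι → A) → Prop) (T : κ → (ι' → A') → Prop) (X : Finset κ)
    (hR : ∀ s ∈ X, DependsOn (R s) (B s)) (hT : ∀ s ∈ X, DependsOn (T s) (B' s))
    {q : ℝ} (hq : ∀ s ∈ X, q ≤ prodProb w (R s) * prodProb w' (T s)) :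
    1 - (1 - q) ^ X.card ≤ prodExp w fun x => prodProb w' fun z => ∃ s ∈ X, R s x ∧ T s z := by
  classical
  -- Inclusion-exclusion in product form: the event fails exactly when every factor equals 1, and
  -- independence applies to the product.
  have key : ∀ x z, (if ∃ s ∈ X, R s x ∧ T s z then (1 : ℝ) else 0)
      = 1 - ∏ s ∈ X, (1 - (if R s x then 1 else 0) * (if T s z then 1 else 0)) := by
    intro x z
    split_ifs with h
    · obtain ⟨s, hs, h1, h2⟩ := h
      rw [Finset.prod_eq_zero hs] <;> simp [h1, h2]
    · push Not at h
      rw [Finset.prod_eq_one]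
      · simp
      · intro s hs
        by_cases h1 : R s x
        · simp [h1, h s hs h1]
        · simp [h1]
  have h1 : ∀ x, prodProb w' (fun z => ∃ s ∈ X, R s x ∧ T s z)
      = 1 - ∏ s ∈ X, (1 - (if R s x then 1 else 0) * prodProb w' (T s)) := by
    intro x
    simp only [prodProb_eq, key]
    rw [prodExp_sub, prodExp_const hw', prodExp_prod_blocks hw' B' hB']
    · congr 1
      refine Finset.prod_congr rfl fun s _ => ?_
      rw [prodExp_sub, prodExp_const hw', prodExp_const_mul]
    · intro s hs z z' hz
      simp only [hT s hs hz]
  simp only [h1]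
  rw [prodExp_sub, prodExp_const hw, prodExp_prod_blocks hw B hB]
  · gcongr
    calc ∏ s ∈ X, prodExp w (fun x => 1 - (if R s x then 1 else 0) * prodProb w' (T s))
        = ∏ s ∈ X, (1 - prodProb w (R s) * prodProb w' (T s)) := by
          refine Finset.prod_congr rfl fun s _ => ?_
          rw [prodExp_sub, prodExp_const hw, prodExp_mul_const, ← prodProb_eq]
      _ ≤ ∏ s ∈ X, (1 - q) := by
          refine Finset.prod_le_prod (fun s _ => ?_) fun s hs => ?_
          · have := mul_le_one₀ (prodProb_le_one hw (R s)) (prodProb_nonneg hw' (T s))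
              (prodProb_le_one hw' (T s))
            linarith
          · have := hq s hs
            linarith
      _ = _ := by simp
  · intro s hs z z' hz
    simp only [hR s hs hz]

end ProductExpectation

-- Reversed Chernoff bound by symmetric tilting

section Chernoff

variable {ι A : Type*} [Fintype ι] [DecidableEq ι] [Fintype A]

/-- The second moment of a sum of independent variables with total mean zero. -/
theorem prodExp_sq_sum_le {r : ι → A → ℝ} (hr : IsLaw r) (L : ι → A → ℝ)
    (h0 : prodExp r (fun x => ∑ i, L i (x i)) = 0) :
    prodExp r (fun x => (∑ i, L i (x i)) ^ 2) ≤ ∑ i, ∑ a, r i a * L i a ^ 2 := by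
  have single : ∀ (i : ι) (f : A → ℝ), prodExp r (fun x => f (x i)) = ∑ a, r i a * f a := by
    intro i f
    have := prodExp_prod r (fun k a => if k = i then f a else 1)
    simp only [Finset.prod_ite_eq', Finset.mem_univ, if_true] at this
    rw [this, Finset.prod_eq_single i]
    · simp
    · intro k _ hk
      simp [hk, hr.sum_one]
    · simp
  set μ : ι → ℝ := fun i => ∑ a, r i a * L i a with hμ
  have pair : ∀ i k, i ≠ k → prodExp r (fun x => L i (x i) * L k (x k)) = μ i * μ k := by
    intro i k hik
    rw [prodExp_mul_of_dependsOn hr (s := {i}), single, single]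
    · intro x y h
      simp [h i rfl]
    · intro x y h
      simp [h k (by simpa using hik.symm)]
  have hsum : ∑ i, μ i = 0 := by
    rw [← h0, prodExp_sum]
    exact Finset.sum_congr rfl fun i _ => (single i _).symm
  have hexp : prodExp r (fun x => (∑ i, L i (x i)) ^ 2)
      = ∑ i, (∑ k, μ i * μ k + (∑ a, r i a * L i a ^ 2 - μ i ^ 2)) := by
    simp only [sq (∑ i, L i _), Finset.sum_mul_sum]
    rw [prodExp_sum]
    refine Finset.sum_congr rfl fun i _ => ?_
    rw [prodExp_sum, ← Finset.add_sum_erase _ _ (Finset.mem_univ i),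
      ← Finset.add_sum_erase Finset.univ (fun k => μ i * μ k) (Finset.mem_univ i)]
    rw [Finset.sum_congr rfl fun k hk => pair i k (Finset.ne_of_mem_erase hk).symm]
    have := single i (fun a => L i a ^ 2)
    simp only [sq] at this ⊢
    rw [this]
    ring
  rw [hexp, Finset.sum_add_distrib, Finset.sum_sub_distrib]
  -- Individual means need not vanish; the double sum is the square of the total mean, and what
  -- remains is a sum of variances, at most the second moments.
  have : ∑ i, ∑ k, μ i * μ k = 0 := by
    rw [← Finset.sum_mul_sum, hsum, zero_mul]
  have h2 : 0 ≤ ∑ i, μ i ^ 2 := Finset.sum_nonneg fun i _ => sq_nonneg _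
  linarith

/-- Chernoff-type lower bound for the probability that the likelihood ratio of two product laws
favours the wrong one; the two laws are exchanged by a bijection `σ` of the sample space. -/
theorem chernoff_lower {P Q : ι → A → ℝ} (hP : IsLaw P) (hQ : IsLaw Q)
    (σ : Equiv.Perm (ι → A))
    (hσP : ∀ x, ∏ i, P i (σ x i) = ∏ i, Q i (x i))
    (hσQ : ∀ x, ∏ i, Q i (σ x i) = ∏ i, P i (x i))
    (b : ι → ℝ) (hb : ∀ i, b i = ∑ a, √(P i a * Q i a)) (hbpos : ∀ i, 0 < b i)
    {V : ℝ} (hV : 0 < V)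
    (hVle : ∑ i, (∑ a, √(P i a * Q i a) * (Real.log (Q i a) - Real.log (P i a)) ^ 2) / b i ≤ V) :
    1 / 4 * Real.exp (-(√(2 * V) / 2)) * ∏ i, b i
      ≤ prodProb P fun x => ∏ i, P i (x i) ≤ ∏ i, Q i (x i) := by
  classical
  set L : ι → A → ℝ := fun i a => Real.log (Q i a) - Real.log (P i a) with hL
  set r : ι → A → ℝ := fun i a => √(P i a * Q i a) / b i with hrdef
  have hr : IsLaw r := ⟨fun i a => div_nonneg (Real.sqrt_nonneg _) (hbpos i).le, fun i => by
    rw [hrdef, ← Finset.sum_div, ← hb, div_self (hbpos i).ne']⟩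
  set R : (ι → A) → ℝ := fun x => ∏ i, r i (x i) with hR
  set D : (ι → A) → ℝ := fun x => ∑ i, L i (x i) with hD
  set pB : ℝ := ∏ i, b i with hpB
  have hpBpos : 0 < pB := Finset.prod_pos fun i _ => hbpos i
  have hR0 : ∀ x, 0 ≤ R x := hr.prod_nonneg
  have hRsq : ∀ x, R x = √((∏ i, P i (x i)) * ∏ i, Q i (x i)) / pB := by
    intro x
    rw [hR, hpB]
    simp only [hrdef]
    rw [Finset.prod_div_distrib, ← Finset.prod_mul_distrib, Real.sqrt_eq_rpow,
      ← Real.finsetProd_rpow _ _ fun i _ => mul_nonneg (hP.nonneg _ _) (hQ.nonneg _ _)]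
    simp [Real.sqrt_eq_rpow]
  have hRσ : ∀ x, R (σ x) = R x := by
    intro x
    rw [hRsq, hRsq, hσP, hσQ, mul_comm]
  have hpos : ∀ x, 0 < R x → (∀ i, 0 < P i (x i)) ∧ ∀ i, 0 < Q i (x i) := by
    intro x hx
    have h : ∀ i, r i (x i) ≠ 0 := fun i => (Finset.prod_ne_zero_iff.1 hx.ne') i (Finset.mem_univ i)
    refine ⟨fun i => (hP.nonneg i _).lt_of_ne fun h0 => h i ?_,
      fun i => (hQ.nonneg i _).lt_of_ne fun h0 => h i ?_⟩ <;> simp [hrdef, ← h0]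
  have hDlog : ∀ x, 0 < R x → D x = Real.log (∏ i, Q i (x i)) - Real.log (∏ i, P i (x i)) := by
    intro x hx
    obtain ⟨h1, h2⟩ := hpos x hx
    rw [Real.log_prod fun i _ => (h2 i).ne', Real.log_prod fun i _ => (h1 i).ne',
      ← Finset.sum_sub_distrib]
  have hDσ : ∀ x, 0 < R x → D (σ x) = - D x := by
    intro x hx
    rw [hDlog x hx, hDlog (σ x) (by rwa [hRσ]), hσP, hσQ]
    ring
  have hmean : prodExp r D = 0 := by
    have h : prodExp r D = - prodExp r D := by
      conv_lhs => rw [prodExp, ← Equiv.sum_comp σ]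
      rw [prodExp, ← Finset.sum_neg_distrib]
      refine Finset.sum_congr rfl fun x _ => ?_
      change R (σ x) * D (σ x) = -(R x * D x)
      rw [hRσ]
      rcases (hR0 x).eq_or_lt with h0 | h0
      · simp [← h0]
      · rw [hDσ x h0]; ring
    linarith
  have hsecond : prodExp r (fun x => D x ^ 2) ≤ V := by
    refine (prodExp_sq_sum_le hr L hmean).trans (le_trans (le_of_eq ?_) hVle)
    refine Finset.sum_congr rfl fun i _ => ?_
    rw [Finset.sum_div]
    refine Finset.sum_congr rfl fun a _ => ?_
    simp only [hrdef, hL]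
    ring
  set y : ℝ := √(2 * V) with hy
  have hy2 : y ^ 2 = 2 * V := Real.sq_sqrt (by positivity)
  have hypos : 0 < y := Real.sqrt_pos.2 (by positivity)
  -- Chebyshev's inequality; the threshold `y` satisfies `y ^ 2 = 2 * V`, so half of the mass stays.
  have hmass : 1 / 2 ≤ prodProb r fun x => |D x| ≤ y := by
    have : prodExp r (fun x => 1 - D x ^ 2 / (2 * V)) ≤ prodProb r fun x => |D x| ≤ y := by
      refine prodExp_mono hr fun x => ?_
      split_ifs with h
      · have : 0 ≤ D x ^ 2 / (2 * V) := by positivity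
        linarith
      · push Not at h
        have : y ^ 2 ≤ D x ^ 2 := by
          rw [← sq_abs (D x)]
          exact pow_le_pow_left₀ hypos.le h.le 2
        rw [hy2] at this
        have : 1 ≤ D x ^ 2 / (2 * V) := (one_le_div (by positivity)).2 this
        linarith
    refine le_trans ?_ this
    have h3 : (fun x : ι → A => 1 - D x ^ 2 / (2 * V)) = fun x => 1 - (2 * V)⁻¹ * D x ^ 2 := by
      funext x; ring
    rw [h3, prodExp_sub, prodExp_const hr, prodExp_const_mul]
    have : (2 * V)⁻¹ * prodExp r (fun x => D x ^ 2) ≤ (2 * V)⁻¹ * V := by gcongr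
    have h4 : (2 * V)⁻¹ * V = 1 / 2 := by field_simp
    linarith
  -- `σ` preserves the tilted law and negates `D`, so each sign of `D` carries at least half of the
  -- mass of `|D| ≤ y`.
  have hhalf : 1 / 4 ≤ prodProb r fun x => 0 ≤ D x ∧ D x ≤ y := by
    have hsym : (prodProb r fun x => -y ≤ D x ∧ D x ≤ 0)
        = prodProb r fun x => 0 ≤ D x ∧ D x ≤ y := by
      rw [prodProb_eq, prodExp, ← Equiv.sum_comp σ, prodProb_eq, prodExp]
      refine Finset.sum_congr rfl fun x _ => ?_
      change R (σ x) * _ = R x * _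
      rw [hRσ]
      rcases (hR0 x).eq_or_lt with h0 | h0
      · simp [← h0]
      · rw [hDσ x h0]
        congr 1
        refine if_congr ⟨fun h => ⟨by linarith [h.2], by linarith [h.1]⟩,
          fun h => ⟨by linarith [h.2], by linarith [h.1]⟩⟩ rfl rfl
    have : (prodProb r fun x => |D x| ≤ y)
        ≤ (prodProb r fun x => 0 ≤ D x ∧ D x ≤ y) + prodProb r fun x => -y ≤ D x ∧ D x ≤ 0 := by
      rw [prodProb_eq, prodProb_eq, prodProb_eq, ← prodExp_add]
      refine prodExp_mono hr fun x => ?_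
      by_cases h : |D x| ≤ y
      · rw [abs_le] at h
        rcases le_total 0 (D x) with h1 | h1
        · simp only [h1, h.1, h.2, abs_le, and_self, if_true]
          split_ifs <;> norm_num
        · simp only [h1, h.1, h.2, abs_le, and_self, if_true]
          split_ifs <;> norm_num
      · rw [if_neg h]
        split_ifs <;> norm_num
    linarith
  have hfin : Real.exp (-(y / 2)) * pB * (prodProb r fun x => 0 ≤ D x ∧ D x ≤ y)
      ≤ prodProb P fun x => ∏ i, P i (x i) ≤ ∏ i, Q i (x i) := by
    rw [prodProb_eq, prodExp, Finset.mul_sum, prodProb_eq, prodExp]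
    refine Finset.sum_le_sum fun x _ => ?_
    change _ * (R x * _) ≤ _
    by_cases h : 0 ≤ D x ∧ D x ≤ y
    swap
    · rw [if_neg h, mul_zero, mul_zero]
      exact mul_nonneg (hP.prod_nonneg x) (by split_ifs <;> norm_num)
    rcases (hR0 x).eq_or_lt with h0 | h0
    · rw [← h0, zero_mul, mul_zero]
      exact mul_nonneg (hP.prod_nonneg x) (by split_ifs <;> norm_num)
    obtain ⟨h1, h2⟩ := hpos x h0
    have hp1 : 0 < ∏ i, P i (x i) := Finset.prod_pos fun i _ => h1 i
    have hq1 : 0 < ∏ i, Q i (x i) := Finset.prod_pos fun i _ => h2 i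
    have hDx := hDlog x h0
    rw [if_pos h, if_pos ((Real.log_le_log_iff hp1 hq1).1 (by linarith [h.1])), mul_one, mul_one,
      hRsq, mul_assoc, mul_div_cancel₀ _ hpBpos.ne']
    -- Undoing the tilt: √(PQ) = P·exp(D/2), and D ≤ y makes the factor exp(-y/2) sufficient.
    rw [show √((∏ i, P i (x i)) * ∏ i, Q i (x i)) = (∏ i, P i (x i)) * Real.exp (D x / 2) by
      rw [hDx, Real.sqrt_eq_iff_mul_self_eq (by positivity) (by positivity)]
      rw [mul_mul_mul_comm, ← Real.exp_add, add_halves, Real.exp_sub, Real.exp_log hp1,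
        Real.exp_log hq1]
      field_simp]
    rw [mul_left_comm, ← Real.exp_add]
    refine mul_le_of_le_one_right hp1.le (Real.exp_le_one_iff.2 ?_)
    linarith [h.2]
  refine le_trans ?_ hfin
  have : 0 ≤ Real.exp (-(y / 2)) * pB := by positivity
  nlinarith

end Chernoff

-- Competing laws of the observed ratings

theorem entryProb_nonneg {p θ : ℝ} (hp0 : 0 ≤ p) (hp1 : p ≤ 1) (hθ0 : 0 ≤ θ) (hθ1 : θ ≤ 1)
    (r : ℤˣ) (a : Option ℤˣ) : 0 ≤ entryProb p θ r a := by
  rcases a with _ | x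
  · simpa [entryProb] using hp1
  · simp only [entryProb]
    split_ifs
    · exact mul_nonneg hp0 (by linarith)
    · exact mul_nonneg hp0 hθ0

theorem isLaw_entryProb {ι : Type*} {p θ : ℝ} (hp0 : 0 ≤ p) (hp1 : p ≤ 1) (hθ0 : 0 ≤ θ)
    (hθ1 : θ ≤ 1) (ρ : ι → ℤˣ) : IsLaw fun i => entryProb p θ (ρ i) := by
  refine ⟨fun i a => entryProb_nonneg hp0 hp1 hθ0 hθ1 _ _, fun i => ?_⟩
  rw [Fintype.sum_option, UnitsInt.univ]
  rcases Int.units_eq_one_or (ρ i) with h | h <;> simp [entryProb, h, show (1 : ℤˣ) ≠ -1 by decide, show (-1 : ℤˣ) ≠ 1 by decide] <;> ring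

theorem entryProb_map_neg (p θ : ℝ) (r : ℤˣ) (a : Option ℤˣ) :
    entryProb p θ r (a.map fun x => -x) = entryProb p θ (-r) a := by
  rcases a with _ | x
  · rfl
  · simp only [Option.map_some, entryProb, neg_eq_iff_eq_neg]

theorem quality_one_sub {θ : ℝ} (hθ0 : 0 ≤ θ) (hθ1 : θ ≤ 1) :
    quality (1 - θ) θ = 1 - 2 * √(θ * (1 - θ)) := by
  rw [quality, sub_sq, Real.sq_sqrt (by linarith), Real.sq_sqrt hθ0, Real.sqrt_mul hθ0]
  ring

theorem quality_pos_of_lt_half {θ : ℝ} (hθ0 : 0 ≤ θ) (hθ1 : θ < 1 / 2) :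
    0 < quality (1 - θ) θ := by
  have : √θ < √(1 - θ) := Real.sqrt_lt_sqrt hθ0 (by linarith)
  exact pow_pos (by linarith) 2

theorem sqrt_scale {p a b : ℝ} (hp : 0 ≤ p) : √(p * a * (p * b)) = p * √(a * b) := by
  rw [mul_mul_mul_comm, Real.sqrt_mul (by positivity), Real.sqrt_mul_self hp]

/-- Variance proxy of the log-likelihood ratio of one rating. -/
noncomputable def ratingVar (θ : ℝ) : ℝ := √(θ * (1 - θ)) * (Real.log (1 - θ) - Real.log θ) ^ 2

theorem ratingVar_nonneg (θ : ℝ) : 0 ≤ ratingVar θ := by unfold ratingVar; positivity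

/-- Negating the observed symbols where `ρ` and `ρ'` differ exchanges the two laws. A differing
entry has affinity `1 - p * I`, at least 1/2, and hence adds at most `4 * ratingVar θ * p` to the
variance; the other entries contribute a factor 1 and nothing. The summand 1 in the variance proxy
only keeps it positive. -/
theorem entry_chernoff_lower {ι : Type*} [Fintype ι] [DecidableEq ι] {p θ : ℝ} (hp0 : 0 ≤ p)
    (hp1 : p ≤ 1) (hθ0 : 0 ≤ θ) (hθ1 : θ < 1 / 2) (hpI : p * quality (1 - θ) θ ≤ 1 / 2)
    (ρ ρ' : ι → ℤˣ) {N : ℕ} (hN : (Finset.univ.filter fun i => ρ i ≠ ρ' i).card = N) :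
    1 / 4 * Real.exp (-(√(2 * (1 + 4 * ratingVar θ * (N * p))) / 2))
        * (1 - p * quality (1 - θ) θ) ^ N
      ≤ prodProb (fun i => entryProb p θ (ρ i))
        fun x => ∏ i, entryProb p θ (ρ i) (x i) ≤ ∏ i, entryProb p θ (ρ' i) (x i) := by
  classical
  have hne : ∀ i, ρ i ≠ ρ' i → ρ' i = - ρ i := by
    intro i h
    rcases Int.units_eq_one_or (ρ i) with h1 | h1 <;> rcases Int.units_eq_one_or (ρ' i) with h2 | h2
      <;> simp_all
  let s : (ι → Option ℤˣ) → ι → Option ℤˣ := fun x i =>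
    if ρ i ≠ ρ' i then (x i).map (fun a => -a) else x i
  have hs : Function.Involutive s := by
    intro x
    funext i
    by_cases h : ρ i = ρ' i <;> simp [s, h]
  have hI := quality_one_sub hθ0 (by linarith)
  set I := quality (1 - θ) θ with hIdef
  have hc0 : 0 ≤ √(θ * (1 - θ)) := Real.sqrt_nonneg _
  have hu : ((1 : ℤˣ) = -1) = False := by simp
  have hu' : ((-1 : ℤˣ) = 1) = False := by simp
  have hself : ∀ i, ∑ a, entryProb p θ (ρ i) a = 1 :=
    (isLaw_entryProb hp0 hp1 hθ0 (by linarith) ρ).sum_one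
  have hb : ∀ i, (if ρ i ≠ ρ' i then 1 - p * I else 1)
      = ∑ a, √(entryProb p θ (ρ i) a * entryProb p θ (ρ' i) a) := by
    intro i
    by_cases h : ρ i ≠ ρ' i
    · rw [if_pos h, hne i h, Fintype.sum_option, UnitsInt.univ]
      rcases Int.units_eq_one_or (ρ i) with h1 | h1 <;>
        simp only [h1, entryProb, neg_neg, hu, hu', if_true, if_false, Finset.sum_insert,
          Finset.mem_singleton, Finset.sum_singleton, not_false_iff, sqrt_scale hp0,
          mul_comm (1 - θ) θ] <;>
        rw [Real.sqrt_mul_self (by linarith), hI] <;> ring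
    · rw [if_neg h]
      push Not at h
      rw [← h, ← hself i]
      exact Finset.sum_congr rfl fun a _ =>
        (Real.sqrt_mul_self (entryProb_nonneg hp0 hp1 hθ0 (by linarith) _ _)).symm
  have hmain := chernoff_lower (isLaw_entryProb hp0 hp1 hθ0 (by linarith) ρ)
    (isLaw_entryProb hp0 hp1 hθ0 (by linarith) ρ') hs.toPerm ?_ ?_ _ hb ?_
    (V := 1 + 4 * ratingVar θ * (N * p)) ?_ ?_
  · rw [Finset.prod_ite, Finset.prod_const, Finset.prod_const_one, mul_one, hN] at hmain
    exact hmain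
  · intro x
    refine Finset.prod_congr rfl fun i _ => ?_
    by_cases h : ρ i ≠ ρ' i
    · simp only [Function.Involutive.coe_toPerm, s, if_pos h]
      rw [entryProb_map_neg, hne i h]
    · simp only [Function.Involutive.coe_toPerm, s, if_neg h]
      push Not at h
      rw [h]
  · intro x
    refine Finset.prod_congr rfl fun i _ => ?_
    by_cases h : ρ i ≠ ρ' i
    · simp only [Function.Involutive.coe_toPerm, s, if_pos h]
      rw [entryProb_map_neg, hne i h, neg_neg]
    · simp only [Function.Involutive.coe_toPerm, s, if_neg h]
      push Not at h
      rw [h]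
  · intro i
    split_ifs <;> linarith
  · have := ratingVar_nonneg θ
    positivity
  · have hterm : ∀ i, (∑ a, √(entryProb p θ (ρ i) a * entryProb p θ (ρ' i) a) *
        (Real.log (entryProb p θ (ρ' i) a) - Real.log (entryProb p θ (ρ i) a)) ^ 2) /
          (if ρ i ≠ ρ' i then 1 - p * I else 1)
        ≤ if ρ i ≠ ρ' i then 4 * ratingVar θ * p else 0 := by
      intro i
      by_cases h : ρ i ≠ ρ' i
      · rw [if_pos h, if_pos h, hne i h]
        have h2 : ∑ a, √(entryProb p θ (ρ i) a * entryProb p θ (-ρ i) a) *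
            (Real.log (entryProb p θ (-ρ i) a) - Real.log (entryProb p θ (ρ i) a)) ^ 2
            = 2 * ratingVar θ * p := by
          -- For p = 0 or θ = 0 the prefactor vanishes, so the values of the logarithms at 0 do not
          -- matter.
          have hlog : p * √(θ * (1 - θ)) * (Real.log (p * (1 - θ)) - Real.log (p * θ)) ^ 2
              = ratingVar θ * p := by
            rcases hp0.eq_or_lt with h0 | h0
            · simp [← h0]
            rcases hθ0.eq_or_lt with h1 | h1
            · simp [← h1, ratingVar]
            rw [Real.log_mul h0.ne' (by linarith), Real.log_mul h0.ne' h1.ne', ratingVar]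
            ring
          rw [Fintype.sum_option, UnitsInt.univ]
          rcases Int.units_eq_one_or (ρ i) with h1 | h1 <;>
            simp only [h1, entryProb, neg_neg, hu, hu', if_true, if_false, Finset.sum_insert,
              Finset.mem_singleton, Finset.sum_singleton, not_false_iff, sqrt_scale hp0,
              mul_comm (1 - θ) θ] <;> linear_combination 2 * hlog
        rw [h2, div_le_iff₀ (by linarith)]
        have : 0 ≤ ratingVar θ * p := mul_nonneg (ratingVar_nonneg θ) hp0
        nlinarith
      · rw [if_neg h, if_neg h]
        push Not at h
        simp [h]
    refine (Finset.sum_le_sum fun i _ => hterm i).trans ?_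
    rw [Finset.sum_ite, Finset.sum_const, Finset.sum_const_zero, hN, nsmul_eq_mul]
    nlinarith

-- Competing laws of the hyperedges

/-- The law of a Bernoulli variable of mean `e`. -/
def bern (e : ℝ) (b : Bool) : ℝ := if b then e else 1 - e

theorem bern_nonneg {e : ℝ} (h0 : 0 ≤ e) (h1 : e ≤ 1) (b : Bool) : 0 ≤ bern e b := by
  cases b <;> simp [bern, h0, h1]

theorem isLaw_bern {ι : Type*} {e : ι → ℝ} (h0 : ∀ i, 0 ≤ e i) (h1 : ∀ i, e i ≤ 1) :
    IsLaw fun i => bern (e i) :=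
  ⟨fun i => bern_nonneg (h0 i) (h1 i), fun i => by simp [bern]⟩

theorem sqrt_mul_eq_sub_quality {a b : ℝ} (ha : 0 ≤ a) (hb : 0 ≤ b) :
    √(a * b) = (a + b) / 2 - quality a b / 2 := by
  rw [quality, sub_sq, Real.sq_sqrt ha, Real.sq_sqrt hb, Real.sqrt_mul ha]
  ring

theorem quality_le {a b : ℝ} (hb : 0 ≤ b) (hab : b ≤ a) : quality a b ≤ a := by
  have h := Real.sqrt_le_sqrt hab
  rw [quality]
  calc (√a - √b) ^ 2 ≤ √a ^ 2 := pow_le_pow_left₀ (by linarith) (by linarith [Real.sqrt_nonneg b]) 2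
    _ = a := Real.sq_sqrt (hb.trans hab)

theorem quality_comm (a b : ℝ) : quality a b = quality b a := by
  unfold quality; ring

/-- The difference of the square roots is (a - b) divided by their sum, which is at least 1. Thus
the absence of a hyperedge affects the affinity only to second order. -/
theorem quality_one_sub_one_sub_le {a b : ℝ} (hb : 0 ≤ b) (hab : b ≤ a) (ha : a ≤ 1 / 2) :
    quality (1 - a) (1 - b) ≤ a ^ 2 := by
  rw [quality]
  have h1 : 0 ≤ √(1 - b) - √(1 - a) := by
    have := Real.sqrt_le_sqrt (show 1 - a ≤ 1 - b by linarith)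
    linarith
  have hsa : 1 / 2 ≤ √(1 - a) := Real.le_sqrt_of_sq_le (by linarith)
  have hsb : 1 / 2 ≤ √(1 - b) := Real.le_sqrt_of_sq_le (by linarith)
  have h2 : (√(1 - b) - √(1 - a)) * (√(1 - b) + √(1 - a)) = a - b := by
    have e1 := Real.sq_sqrt (show 0 ≤ 1 - a by linarith)
    have e2 := Real.sq_sqrt (show 0 ≤ 1 - b by linarith)
    nlinarith
  have h3 : √(1 - b) - √(1 - a) ≤ a := by nlinarith
  nlinarith

/-- The first-order expansion of log(1 - x) has remainder at most x²/(1 - x), which is at most 2x²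
here. -/
theorem exp_le_one_sub {x : ℝ} (h0 : 0 ≤ x) (h1 : x ≤ 1 / 2) :
    Real.exp (-(x + 2 * x ^ 2)) ≤ 1 - x := by
  rw [← Real.le_log_iff_exp_le (by linarith)]
  have hx := Real.abs_log_sub_add_sum_range_le (x := x) (by rw [abs_of_nonneg h0]; linarith) 1
  simp only [Finset.sum_range_one, zero_add, pow_one, Nat.cast_zero, div_one] at hx
  rw [abs_of_nonneg h0] at hx
  have h5 := neg_le_of_abs_le hx
  have h6 : x ^ (1 + 1) / (1 - x) ≤ 2 * x ^ 2 := by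
    rw [div_le_iff₀ (by linarith), one_add_one_eq_two]
    nlinarith [mul_nonneg (sq_nonneg x) (show 0 ≤ 1 - 2 * x by linarith)]
  linarith

/-- Hellinger affinity of two Bernoulli laws. -/
theorem affinity_bern {a b : ℝ} (ha0 : 0 ≤ a) (ha1 : a ≤ 1) (hb0 : 0 ≤ b) (hb1 : b ≤ 1) :
    ∑ t, √(bern a t * bern b t) = 1 - (quality a b + quality (1 - a) (1 - b)) / 2 := by
  simp only [Fintype.univ_bool, bern, Finset.sum_insert, Finset.mem_singleton,
    Finset.sum_singleton, Bool.true_eq_false, not_false_iff, if_true, Bool.false_eq_true, if_false]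
  rw [sqrt_mul_eq_sub_quality ha0 hb0, sqrt_mul_eq_sub_quality (by linarith) (by linarith)]
  ring

/-- A present hyperedge contributes at most aℓ², an absent one at most (2a)² ≤ 2a. -/
theorem bern_logRatio_sq_le {a b ℓ : ℝ} (hb : 0 < b) (hab : b ≤ a) (ha : a ≤ 1 / 2)
    (hℓ : Real.log (a / b) ≤ ℓ) :
    ∑ t, √(bern a t * bern b t) * (Real.log (bern b t) - Real.log (bern a t)) ^ 2
      ≤ a * (ℓ ^ 2 + 2) := by
  simp only [Fintype.univ_bool, bern, Finset.sum_insert, Finset.mem_singleton,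
    Finset.sum_singleton, Bool.true_eq_false, not_false_iff, if_true, Bool.false_eq_true, if_false]
  have ha0 : 0 < a := hb.trans_le hab
  have h1 : √(a * b) ≤ a := by
    rw [Real.sqrt_le_left ha0.le]; nlinarith
  have h2 : √((1 - a) * (1 - b)) ≤ 1 := by
    rw [Real.sqrt_le_left zero_le_one]; nlinarith
  have h3 : (Real.log b - Real.log a) ^ 2 ≤ ℓ ^ 2 := by
    rw [Real.log_div ha0.ne' hb.ne'] at hℓ
    have : Real.log b ≤ Real.log a := Real.log_le_log hb hab
    nlinarith
  have h4 : (Real.log (1 - b) - Real.log (1 - a)) ^ 2 ≤ (2 * a) ^ 2 := by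
    have hlow : 0 ≤ Real.log (1 - b) - Real.log (1 - a) := by
      have : Real.log (1 - a) ≤ Real.log (1 - b) := Real.log_le_log (by linarith) (by linarith)
      linarith
    refine pow_le_pow_left₀ hlow ?_ 2
    rw [← Real.log_div (by linarith) (by linarith)]
    refine (Real.log_le_sub_one_of_pos (div_pos (by linarith) (by linarith))).trans ?_
    rw [div_sub_one (by linarith), div_le_iff₀ (by linarith)]
    nlinarith
  have h5 : √(a * b) * (Real.log b - Real.log a) ^ 2 ≤ a * ℓ ^ 2 :=
    mul_le_mul h1 h3 (sq_nonneg _) ha0.le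
  have h6 : √((1 - a) * (1 - b)) * (Real.log (1 - b) - Real.log (1 - a)) ^ 2 ≤ 1 * (2 * a) ^ 2 :=
    mul_le_mul h2 h4 (sq_nonneg _) zero_le_one
  nlinarith

theorem exp_le_affinity {a b : ℝ} (hb : 0 ≤ b) (hab : b ≤ a) (ha : a ≤ 1 / 2) :
    Real.exp (-(quality a b / 2 + 3 * a ^ 2)) ≤ 1 - (quality a b + quality (1 - a) (1 - b)) / 2 := by
  have h1 := quality_le hb hab
  have h2 := quality_one_sub_one_sub_le hb hab ha
  have h3 : 0 ≤ quality a b := sq_nonneg _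
  have h4 : 0 ≤ quality (1 - a) (1 - b) := sq_nonneg _
  set x := (quality a b + quality (1 - a) (1 - b)) / 2 with hx
  have hxa : x ≤ a := by nlinarith
  refine le_trans (Real.exp_le_exp.2 ?_) (exp_le_one_sub (x := x) (by positivity) (by linarith))
  have : x ^ 2 ≤ a ^ 2 := pow_le_pow_left₀ (by positivity) hxa 2
  nlinarith

/-- The bijection required by `chernoff_lower` is the relabelling of hyperedges by `π`, which
carries the probabilities `e` to `e'`. Hyperedges outside `S` have equal probabilities, hence
affinity 1 and log-likelihood ratio 0, so only `S` enters the exponents. -/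
theorem edge_chernoff_lower {ι : Type*} [Fintype ι] [DecidableEq ι] {a b e e' : ι → ℝ} {ℓ : ℝ}
    (hb : ∀ i, 0 < b i) (hab : ∀ i, b i ≤ a i) (ha : ∀ i, a i ≤ 1 / 2)
    (hℓ : ∀ i, Real.log (a i / b i) ≤ ℓ) (S : Finset ι)
    (he : ∀ i, e i = a i ∨ e i = b i) (he' : ∀ i, e' i = a i ∨ e' i = b i)
    (hS : ∀ i, e i ≠ e' i → i ∈ S)
    (π : ι → ι) (hπ : Function.Involutive π) (hπe : ∀ i, e (π i) = e' i) :
    1 / 4 * Real.exp (-(√(2 * (1 + ∑ i ∈ S, 2 * (a i * (ℓ ^ 2 + 2)))) / 2))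
        * Real.exp (-∑ i ∈ S, (quality (a i) (b i) / 2 + 3 * a i ^ 2))
      ≤ prodProb (fun i => bern (e i))
        fun x => ∏ i, bern (e i) (x i) ≤ ∏ i, bern (e' i) (x i) := by
  have ha0 : ∀ i, 0 < a i := fun i => (hb i).trans_le (hab i)
  have he0 : ∀ i, 0 ≤ e i := fun i => by
    rcases he i with h | h <;> rw [h]
    exacts [(ha0 i).le, (hb i).le]
  have he1 : ∀ i, e i ≤ 1 := fun i => by
    rcases he i with h | h <;> rw [h] <;> linarith [ha i, hab i]
  have he0' : ∀ i, 0 ≤ e' i := fun i => hπe i ▸ he0 _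
  have he1' : ∀ i, e' i ≤ 1 := fun i => hπe i ▸ he1 _
  have hπe' : ∀ i, e' (π i) = e i := fun i => by rw [← hπe, hπ]
  have hP := isLaw_bern he0 he1
  have hQ := isLaw_bern he0' he1'
  have hcases : ∀ i, e i ≠ e' i → e i = a i ∧ e' i = b i ∨ e i = b i ∧ e' i = a i := by
    intro i h
    rcases he i with h1 | h1 <;> rcases he' i with h2 | h2 <;> simp_all
  have hself : ∀ i, ∑ t, √(bern (e i) t * bern (e i) t) = 1 := by
    intro i
    rw [← hP.sum_one i]
    exact Finset.sum_congr rfl fun t _ => Real.sqrt_mul_self (hP.nonneg i t)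
  have hsym : ∀ i, e i ≠ e' i → ∑ t, √(bern (e i) t * bern (e' i) t)
      = 1 - (quality (a i) (b i) + quality (1 - a i) (1 - b i)) / 2 := by
    intro i h
    have h1 : a i ≤ 1 := by linarith [ha i]
    rcases hcases i h with ⟨h2, h3⟩ | ⟨h2, h3⟩
    · rw [h2, h3, affinity_bern (ha0 i).le h1 (hb i).le ((hab i).trans h1)]
    · rw [h2, h3, affinity_bern (hb i).le ((hab i).trans h1) (ha0 i).le h1, quality_comm,
        quality_comm (1 - b i)]
  have hhalf : ∀ i, 1 / 2 ≤ ∑ t, √(bern (e i) t * bern (e' i) t) := by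
    intro i
    by_cases h : e i = e' i
    · rw [← h, hself]; norm_num
    · rw [hsym i h]
      have h1 := quality_le (hb i).le (hab i)
      have h2 := quality_one_sub_one_sub_le (hb i).le (hab i) (ha i)
      nlinarith [ha i, ha0 i]
  have hmain := chernoff_lower hP hQ (Equiv.arrowCongr hπ.toPerm (Equiv.refl Bool)) ?_ ?_
    _ (fun _ => rfl) (fun i => lt_of_lt_of_le (by norm_num) (hhalf i))
    (V := 1 + ∑ i ∈ S, 2 * (a i * (ℓ ^ 2 + 2))) ?_ ?_
  · refine le_trans (mul_le_mul_of_nonneg_left ?_ (by positivity)) hmain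
    rw [← Finset.sum_neg_distrib, Real.exp_sum, ← Finset.prod_subset (Finset.subset_univ S)]
    · refine Finset.prod_le_prod (fun i _ => (Real.exp_pos _).le) fun i _ => ?_
      by_cases h : e i = e' i
      · rw [← h, hself, Real.exp_le_one_iff]
        have : 0 ≤ quality (a i) (b i) := sq_nonneg _
        nlinarith [sq_nonneg (a i)]
      · rw [hsym i h]
        exact exp_le_affinity (hb i).le (hab i) (ha i)
    · intro i _ hi
      have : e i = e' i := by
        by_contra h
        exact hi (hS i h)
      rw [← this, hself]
  · intro x
    rw [← Equiv.prod_comp hπ.toPerm]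
    refine Finset.prod_congr rfl fun i _ => ?_
    simp [Equiv.arrowCongr, hπe, hπ i, Function.Involutive.toPerm]
  · intro x
    rw [← Equiv.prod_comp hπ.toPerm]
    refine Finset.prod_congr rfl fun i _ => ?_
    simp [Equiv.arrowCongr, hπe', hπ i, Function.Involutive.toPerm]
  · have : 0 ≤ ∑ i ∈ S, 2 * (a i * (ℓ ^ 2 + 2)) := Finset.sum_nonneg fun i _ => by
      have := ha0 i
      positivity
    linarith
  · rw [← Finset.sum_subset (Finset.subset_univ S)]
    · refine (Finset.sum_le_sum fun i _ => ?_).trans (le_add_of_nonneg_left zero_le_one)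
      have h0 : 0 ≤ a i * (ℓ ^ 2 + 2) := mul_nonneg (ha0 i).le (by positivity)
      rw [div_le_iff₀ (lt_of_lt_of_le (by norm_num) (hhalf i))]
      refine le_trans ?_ (show a i * (ℓ ^ 2 + 2) ≤ _ by nlinarith [hhalf i])
      by_cases h : e i = e' i
      · simpa [h] using h0
      · rcases hcases i h with ⟨h2, h3⟩ | ⟨h2, h3⟩
        · rw [h2, h3]
          exact bern_logRatio_sq_le (hb i) (hab i) (ha i) (hℓ i)
        · rw [h2, h3]
          refine le_trans (le_of_eq ?_) (bern_logRatio_sq_le (hb i) (hab i) (ha i) (hℓ i))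
          refine Finset.sum_congr rfl fun t _ => ?_
          rw [mul_comm (bern (b i) t)]
          ring
    · intro i _ hi
      have : e i = e' i := by
        by_contra h
        exact hi (hS i h)
      simp [this]

-- From confusable hypotheses to decoding errors

open scoped Classical in
/-- If under each hypothesis of a finite family some other hypothesis is, with probability at
least `c`, at least half as likely as the true one, then every decoder errs with probability at
least `c / 3` under some hypothesis. -/
theorem exists_error_ge {β Ω γ' : Type*} [Fintype Ω] (X : Finset β) (hX : X.Nonempty)
    (P : β → Ω → ℝ) (hP : ∀ b y, 0 ≤ P b y) (nom : β → γ') (hnom : Set.InjOn nom X)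
    (ψ : Ω → γ') {c : ℝ}
    (hc : ∀ b ∈ X, c ≤ ∑ y, if ∃ b' ∈ X, b' ≠ b ∧ 1 / 2 * P b y ≤ P b' y then P b y else 0) :
    ∃ b ∈ X, c / 3 ≤ ∑ y, if ψ y ≠ nom b then P b y else 0 := by
  by_contra! hcon
  -- Pointwise in the observation: if the output is correct for `b`, the term of `b` is at most
  -- twice the likelihood of its rival, which counts as an error; the other terms are errors
  -- themselves. This gives the factor 2 + 1 = 3.
  have key : ∀ y, ∑ b ∈ X, (if ∃ b' ∈ X, b' ≠ b ∧ 1 / 2 * P b y ≤ P b' y then P b y else 0)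
      ≤ 3 * ∑ b ∈ X, if ψ y ≠ nom b then P b y else 0 := by
    intro y
    have hle : ∀ b, (if ∃ b' ∈ X, b' ≠ b ∧ 1 / 2 * P b y ≤ P b' y then P b y else 0) ≤ P b y := by
      intro b
      split_ifs
      exacts [le_rfl, hP b y]
    by_cases h : ∃ b ∈ X, ψ y = nom b
    · obtain ⟨b, hb, hψ⟩ := h
      have herr : ∀ b' ∈ X.erase b, (if ψ y ≠ nom b' then P b' y else 0) = P b' y := by
        intro b' hb'
        rw [Finset.mem_erase] at hb'
        rw [if_pos]
        intro h
        exact hb'.1 (hnom hb'.2 hb (h.symm.trans hψ))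
      rw [← Finset.add_sum_erase _ _ hb, ← Finset.add_sum_erase X (fun b => ite _ _ _) hb,
        Finset.sum_congr rfl herr, if_neg (not_not.2 hψ), zero_add]
      have h1 := Finset.sum_le_sum fun b' (_ : b' ∈ X.erase b) => hle b'
      have h0 : 0 ≤ ∑ b' ∈ X.erase b, P b' y := Finset.sum_nonneg fun b' _ => hP b' y
      have h2 : (if ∃ b' ∈ X, b' ≠ b ∧ 1 / 2 * P b y ≤ P b' y then P b y else 0)
          ≤ 2 * ∑ b' ∈ X.erase b, P b' y := by
        split_ifs with hbad
        · obtain ⟨b', hb', hne, hh⟩ := hbad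
          have := Finset.single_le_sum (f := fun b' => P b' y) (fun b' _ => hP b' y)
            (Finset.mem_erase.2 ⟨hne, hb'⟩)
          linarith
        · linarith
      linarith
    · push Not at h
      have h1 : ∑ b ∈ X, (if ψ y ≠ nom b then P b y else 0) = ∑ b ∈ X, P b y :=
        Finset.sum_congr rfl fun b hb => if_pos (h b hb)
      have h0 : 0 ≤ ∑ b' ∈ X, P b' y := Finset.sum_nonneg fun b' _ => hP b' y
      have h2 := Finset.sum_le_sum fun b' (_ : b' ∈ X) => hle b'
      rw [h1]
      linarith
  have h1 := Finset.sum_le_sum fun y (_ : y ∈ (Finset.univ : Finset Ω)) => key y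
  rw [← Finset.mul_sum, Finset.sum_comm, Finset.sum_comm (s := Finset.univ)] at h1
  have h2 := Finset.sum_le_sum hc
  have h3 := Finset.sum_lt_sum_of_nonempty hX hcon
  rw [← Finset.sum_div] at h3
  linarith

theorem edgeProb_mem {n K W : ℕ} {α β : ℕ → ℝ} (hαβ : ∀ d ∈ Finset.Icc 2 W,
    0 ≤ β d ∧ β d < α d ∧ α d ≤ 1) (c : Fin n → Fin K) (h : PotentialEdge n W) :
    0 ≤ edgeProb α β c h ∧ edgeProb α β c h ≤ 1 := by
  obtain ⟨h1, h2, h3⟩ := hαβ h.1.card (Finset.mem_Icc.2 h.2)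
  unfold edgeProb
  split_ifs <;> constructor <;> linarith

/-- A set of hyperedges as a Boolean function. -/
def hyperEquiv (n W : ℕ) : HypergraphCollection n W ≃ (PotentialEdge n W → Bool) where
  toFun H h := decide (h ∈ H)
  invFun x := Finset.univ.filter fun h => x h = true
  left_inv H := by ext; simp
  right_inv x := by ext; simp

-- Likelihood of an observation and the worst-case error

section Observation

variable {n m K W : ℕ} {γ : ℝ}

/-- The likelihood of the sub-sampled matrix. -/
noncomputable def ratingProb (p θ : ℝ) (R : Fin n × Fin m → ℤˣ)
    (x : Fin n × Fin m → Option ℤˣ) : ℝ := ∏ i, entryProb p θ (R i) (x i)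

/-- The likelihood of the hypergraphs. -/
noncomputable def hyperProb (α β : ℕ → ℝ) (c : Fin n → Fin K)
    (z : PotentialEdge n W → Bool) : ℝ := ∏ h, bern (edgeProb α β c h) (z h)

/-- The nominal rating matrix as a function on pairs. -/
def GroundTruth.rating (g : GroundTruth n m K γ) (i : Fin n × Fin m) : ℤˣ :=
  g.vec (g.cluster i.1) i.2

theorem obsProb_eq (p θ : ℝ) (α β : ℕ → ℝ) (g : GroundTruth n m K γ)
    (x : Fin n × Fin m → Option ℤˣ) (z : PotentialEdge n W → Bool) :
    obsProb W p θ α β g (Equiv.curry _ _ _ x) ((hyperEquiv n W).symm z)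
      = ratingProb p θ g.rating x * hyperProb α β g.cluster z := by
  rw [obsProb, ratingProb, hyperProb, Fintype.prod_prod_type]
  congr 1
  refine Finset.prod_congr rfl fun h _ => ?_
  simp [hyperEquiv, bern]

theorem errProb_eq (p θ : ℝ) (α β : ℕ → ℝ) (ψ : Estimator n m W) (g : GroundTruth n m K γ) :
    errProb W p θ α β ψ g
      = ∑ y : (Fin n × Fin m → Option ℤˣ) × (PotentialEdge n W → Bool),
        if ψ (Equiv.curry _ _ _ y.1) ((hyperEquiv n W).symm y.2) ≠ g.nominal
        then ratingProb p θ g.rating y.1 * hyperProb α β g.cluster y.2 else 0 := by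
  rw [errProb, Fintype.sum_prod_type, ← Equiv.sum_comp (Equiv.curry (Fin n) (Fin m) (Option ℤˣ))]
  refine Finset.sum_congr rfl fun x _ => ?_
  rw [← Equiv.sum_comp (hyperEquiv n W).symm]
  refine Finset.sum_congr rfl fun z _ => ?_
  simp only [obsProb_eq]

/-- Finiteness bounds the family of errors, so that the supremum in `worstErr` dominates each of
them. -/
instance : Finite (GroundTruth n m K γ) :=
  Finite.of_injective (fun g : GroundTruth n m K γ => (g.cluster, g.vec)) fun g g' h => by
    cases g; cases g'; simp_all

theorem errProb_le_worstErr (p θ : ℝ) (α β : ℕ → ℝ) (ψ : Estimator n m W)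
    (g : GroundTruth n m K γ) : errProb W p θ α β ψ g ≤ worstErr K W γ p θ α β ψ :=
  le_ciSup (f := fun g => errProb W p θ α β ψ g) (Set.finite_range _).bddAbove g

theorem le_worstErr {β' : Type*} {p θ : ℝ} (hp0 : 0 ≤ p) (hp1 : p ≤ 1) (hθ0 : 0 ≤ θ)
    (hθ1 : θ ≤ 1) {α β : ℕ → ℝ} (hαβ : ∀ d ∈ Finset.Icc 2 W, 0 ≤ β d ∧ β d < α d ∧ α d ≤ 1)
    (X : Finset β') (hX : X.Nonempty) (G : β' → GroundTruth n m K γ)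
    (hG : Set.InjOn (fun b => (G b).rating) X) {c : ℝ}
    (hc : ∀ b ∈ X, c ≤ prodExp (fun i => entryProb p θ ((G b).rating i)) fun x =>
      prodProb (fun h : PotentialEdge n W => bern (edgeProb α β (G b).cluster h)) fun z =>
        ∃ b' ∈ X, b' ≠ b ∧ 1 / 2 * (ratingProb p θ (G b).rating x * hyperProb α β (G b).cluster z)
          ≤ ratingProb p θ (G b').rating x * hyperProb α β (G b').cluster z)
    (ψ : Estimator n m W) : c / 3 ≤ worstErr K W γ p θ α β ψ := by
  classical
  obtain ⟨b, _, hb⟩ := exists_error_ge X hX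
    (fun b (y : (Fin n × Fin m → Option ℤˣ) × (PotentialEdge n W → Bool)) =>
      ratingProb p θ (G b).rating y.1 * hyperProb α β (G b).cluster y.2)
    (fun b y => mul_nonneg
      (Finset.prod_nonneg fun _ _ => entryProb_nonneg hp0 hp1 hθ0 hθ1 _ _)
      (Finset.prod_nonneg fun h _ => bern_nonneg (edgeProb_mem hαβ _ h).1 (edgeProb_mem hαβ _ h).2 _))
    (fun b => (G b).nominal)
    (fun b hb b' hb' h => hG hb hb' (by
      funext i
      exact congrFun (congrFun h i.1) i.2))
    (fun y => ψ (Equiv.curry _ _ _ y.1) ((hyperEquiv n W).symm y.2)) (c := c)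
    (fun b hb => by
      refine (hc b hb).trans (le_of_eq ?_)
      rw [prodExp, Fintype.sum_prod_type]
      refine Finset.sum_congr rfl fun x _ => ?_
      rw [prodProb_eq, prodExp, Finset.mul_sum]
      refine Finset.sum_congr rfl fun z _ => ?_
      rw [mul_ite, mul_one, mul_zero, mul_ite, mul_zero]
      rfl)
  refine hb.trans (le_trans (le_of_eq ?_) (errProb_le_worstErr p θ α β ψ (G b)))
  rw [errProb_eq]
  exact Finset.sum_congr rfl fun y _ => by congr!

end Observation

-- Rating vectors with a unique closest pair

section RatingVectors

/-- The sign of `σ k`: positive for the lower half of the values. -/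
def halfSign {K : ℕ} (σ : Equiv.Perm (Fin K)) (k : Fin K) : ℤˣ :=
  if (σ k).val < K / 2 then 1 else -1

/-- The number of permutations that separate `a` from `b`. -/
def separating {K : ℕ} (a b : Fin K) : ℕ :=
  (Finset.univ.filter fun σ : Equiv.Perm (Fin K) => halfSign σ a ≠ halfSign σ b).card

/-- Right multiplication by a permutation that carries (a, b) to (c, d) matches the separating
permutations. -/
theorem separating_eq {K : ℕ} {a b c d : Fin K} (hab : a ≠ b) (hcd : c ≠ d) :
    separating a b = separating c d := by
  let τ : Equiv.Perm (Fin K) := Equiv.swap (Equiv.swap a c b) d * Equiv.swap a c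
  have h1 : τ a = c := by
    simp only [τ, Equiv.Perm.mul_apply, Equiv.swap_apply_left]
    refine Equiv.swap_apply_of_ne_of_ne ?_ hcd
    intro h
    apply hab
    apply (Equiv.swap a c).injective
    rw [← h, Equiv.swap_apply_left]
  have h2 : τ b = d := by simp [τ]
  refine (Finset.card_bij (fun σ _ => σ * τ) ?_ ?_ ?_).symm
  · intro σ hσ
    rw [Finset.mem_filter] at hσ ⊢
    refine ⟨Finset.mem_univ _, ?_⟩
    simpa only [halfSign, Equiv.Perm.mul_apply, h1, h2] using hσ.2
  · intro σ _ σ' _ h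
    exact mul_right_cancel h
  · intro σ hσ
    refine ⟨σ * τ⁻¹, ?_, by simp⟩
    have h3 : τ⁻¹ c = a := by rw [← h1]; simp
    have h4 : τ⁻¹ d = b := by rw [← h2]; simp
    rw [Finset.mem_filter] at hσ ⊢
    refine ⟨Finset.mem_univ _, ?_⟩
    simpa only [halfSign, Equiv.Perm.mul_apply, h3, h4] using hσ.2

theorem half_mul_half (K : ℕ) : K / 2 * (K - K / 2) = K ^ 2 / 4 := by
  obtain ⟨k, rfl | rfl⟩ := Nat.even_or_odd' K
  · rw [show 2 * k / 2 = k by omega, show 2 * k - k = k by omega,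
      show (2 * k) ^ 2 = 4 * (k * k) by ring]
    omega
  · rw [show (2 * k + 1) / 2 = k by omega, show 2 * k + 1 - k = k + 1 by omega,
      show (2 * k + 1) ^ 2 = 4 * (k * (k + 1)) + 1 by ring]
    omega

theorem sum_halfSign_ne {K : ℕ} (σ : Equiv.Perm (Fin K)) :
    ∑ a, ∑ b, (if halfSign σ a ≠ halfSign σ b then 1 else 0) = 2 * (K ^ 2 / 4) := by
  have hne : ∀ a b, (halfSign σ a ≠ halfSign σ b) ↔ ¬((σ a).val < K / 2 ↔ (σ b).val < K / 2) := by
    intro a b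
    unfold halfSign
    by_cases h1 : (σ a).val < K / 2 <;> by_cases h2 : (σ b).val < K / 2 <;>
      simp only [h1, h2, if_true, if_false] <;> decide
  simp only [hne]
  rw [Equiv.sum_comp σ (fun a => ∑ b, if ¬(a.val < K / 2 ↔ (σ b).val < K / 2) then 1 else 0)]
  have : ∀ a : Fin K, (∑ b, if ¬(a.val < K / 2 ↔ (σ b).val < K / 2) then 1 else 0)
      = ∑ b : Fin K, if ¬(a.val < K / 2 ↔ b.val < K / 2) then 1 else 0 := fun a =>
    Equiv.sum_comp σ (fun b => if ¬(a.val < K / 2 ↔ b.val < K / 2) then 1 else 0)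
  simp only [this]
  have hlow : (Finset.univ.filter fun b : Fin K => b.val < K / 2).card = K / 2 := by
    rw [Fin.card_filter_val_lt]; omega
  have hhigh : (Finset.univ.filter fun b : Fin K => ¬ b.val < K / 2).card = K - K / 2 := by
    have := Finset.card_filter_add_card_filter_not (s := (Finset.univ : Finset (Fin K)))
      (fun b => b.val < K / 2)
    rw [hlow, Finset.card_univ, Fintype.card_fin] at this
    omega
  have hinner : ∀ a : Fin K, (∑ b : Fin K, if ¬(a.val < K / 2 ↔ b.val < K / 2) then 1 else 0)
      = if a.val < K / 2 then K - K / 2 else K / 2 := by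
    intro a
    split_ifs with h
    · simp only [h, true_iff, Finset.sum_boole, hhigh, Nat.cast_id]
    · simp only [h, false_iff, not_not, Finset.sum_boole, hlow, Nat.cast_id]
  simp only [hinner]
  rw [Finset.sum_ite, Finset.sum_const, Finset.sum_const, hlow, hhigh, smul_eq_mul, smul_eq_mul,
    ← half_mul_half]
  ring

/-- Double counting of the triples (σ, c, d) with c and d separated by σ. It identifies `separating
a b` divided by K! with ⌊K²/4⌋ / (K choose 2), the threshold for γ. -/
theorem separating_mul {K : ℕ} {a b : Fin K} (hab : a ≠ b) :
    K * (K - 1) * separating a b = K.factorial * (2 * (K ^ 2 / 4)) := by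
  have h1 : ∑ σ : Equiv.Perm (Fin K), ∑ c, ∑ d,
      (if halfSign σ c ≠ halfSign σ d then 1 else 0) = K.factorial * (2 * (K ^ 2 / 4)) := by
    simp only [sum_halfSign_ne]
    simp [Fintype.card_perm]
  rw [← h1, Finset.sum_comm]
  have : ∀ c : Fin K, ∑ σ : Equiv.Perm (Fin K), ∑ d,
      (if halfSign σ c ≠ halfSign σ d then 1 else 0) = (K - 1) * separating a b := by
    intro c
    rw [Finset.sum_comm, ← Finset.add_sum_erase _ _ (Finset.mem_univ c)]
    have : ∀ d ∈ Finset.univ.erase c, ∑ σ : Equiv.Perm (Fin K),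
        (if halfSign σ c ≠ halfSign σ d then 1 else 0) = separating a b := by
      intro d hd
      rw [separating_eq hab (Finset.ne_of_mem_erase hd).symm]
      rw [separating, Finset.card_filter]
    rw [Finset.sum_congr rfl this]
    simp
  rw [Finset.sum_congr rfl fun c _ => this c]
  simp [mul_assoc]

/-- A discrete intermediate value argument: at the first `t` with `g t ≤ D` the drop by at most one
rules out an overshoot. -/
theorem exists_eq_of_slow_decrease {g : ℕ → ℕ} {D m : ℕ} (h0 : D ≤ g 0) (hm : g m ≤ D)
    (hstep : ∀ t, g t ≤ g (t + 1) + 1) : ∃ t, g t = D := by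
  classical
  have hex : ∃ t, g t ≤ D := ⟨m, hm⟩
  refine ⟨Nat.find hex, le_antisymm (Nat.find_spec hex) ?_⟩
  rcases h : Nat.find hex with _ | t
  · exact h0
  · have := Nat.find_min hex (m := t) (by omega)
    have := hstep t
    omega

/-- The exceptional block `r₀`, given up in the bound, is meant for the one in which two column
patterns are mixed. -/
theorem mul_le_sum_range_of_blocks {f : ℕ → ℕ} {M Δ ℓ m : ℕ} (r₀ : ℕ) (hm : M * ℓ ≤ m)
    (h : ∀ r, r ≠ r₀ → Δ ≤ ∑ i ∈ Finset.range M, f (M * r + i)) :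
    (ℓ - 1) * Δ ≤ ∑ j ∈ Finset.range m, f j := by
  have hsum : ∀ ℓ, ∑ j ∈ Finset.range (M * ℓ), f j
      = ∑ r ∈ Finset.range ℓ, ∑ i ∈ Finset.range M, f (M * r + i) := by
    intro ℓ
    induction ℓ with
    | zero => simp
    | succ ℓ ih => rw [mul_add, mul_one, Finset.sum_range_add, ih, Finset.sum_range_succ]
  calc (ℓ - 1) * Δ ≤ ((Finset.range ℓ).erase r₀).card * Δ := by
        gcongr
        have := Finset.pred_card_le_card_erase (s := Finset.range ℓ) (a := r₀)
        simpa using this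
    _ = ∑ _r ∈ (Finset.range ℓ).erase r₀, Δ := by simp
    _ ≤ ∑ r ∈ (Finset.range ℓ).erase r₀, ∑ i ∈ Finset.range M, f (M * r + i) :=
        Finset.sum_le_sum fun r hr => h r (Finset.ne_of_mem_erase hr)
    _ ≤ ∑ r ∈ Finset.range ℓ, ∑ i ∈ Finset.range M, f (M * r + i) :=
        Finset.sum_le_sum_of_subset (Finset.erase_subset _ _)
    _ = ∑ j ∈ Finset.range (M * ℓ), f j := (hsum ℓ).symm
    _ ≤ ∑ j ∈ Finset.range m, f j :=
        Finset.sum_le_sum_of_subset (Finset.range_subset_range.2 hm)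

/-- A periodic sequence of columns that runs through all balanced sign patterns. -/
noncomputable def column {K : ℕ} (j : ℕ) (k : Fin K) : ℤˣ :=
  halfSign ((Fintype.equivFinOfCardEq (α := Equiv.Perm (Fin K)) (n := K.factorial)
    (by simp [Fintype.card_perm])).symm ⟨j % K.factorial, Nat.mod_lt _ K.factorial_pos⟩) k

theorem sum_column_block {K : ℕ} (a b : Fin K) (r : ℕ) :
    ∑ i ∈ Finset.range K.factorial,
      (if column (K.factorial * r + i) a ≠ column (K.factorial * r + i) b then 1 else 0)
      = separating a b := by
  have hmod : ∀ i : Fin K.factorial, (K.factorial * r + i.val) % K.factorial = i := fun i => by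
    rw [Nat.mul_add_mod, Nat.mod_eq_of_lt i.2]
  rw [Finset.sum_range]
  simp only [column, hmod]
  rw [Equiv.sum_comp (Fintype.equivFinOfCardEq _).symm
    (fun σ : Equiv.Perm (Fin K) => if halfSign σ a ≠ halfSign σ b then 1 else 0)]
  rw [separating, Finset.card_filter]

theorem hammingDist_eq_sum_range {m : ℕ} (x y : ℕ → ℤˣ) :
    hammingDist (fun j : Fin m => x j) (fun j : Fin m => y j)
      = ∑ j ∈ Finset.range m, if x j ≠ y j then 1 else 0 := by
  rw [Finset.sum_range, hammingDist, Finset.card_filter]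

/-- Rating vectors in which exactly one pair attains the prescribed minimal distance, all other
pairs being farther apart by a linear margin. -/
theorem exists_ratingVectors {K : ℕ} (hK : 2 ≤ K) {γ : ℝ} (hγ : 0 < γ)
    (hγ_lt : γ * (K.choose 2 : ℝ) < ((K ^ 2 / 4 : ℕ) : ℝ)) :
    ∃ η : ℝ, 0 < η ∧ ∀ᶠ m : ℕ in atTop, ∃ v : Fin K → Fin m → ℤˣ, ∃ a b : Fin K, a ≠ b ∧
      hammingDist (v a) (v b) = ⌈γ * m⌉₊ ∧
      (∀ i j, i ≠ j → ¬(i = a ∧ j = b) → ¬(i = b ∧ j = a) →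
        ⌈γ * m⌉₊ + η * m ≤ hammingDist (v i) (v j)) ∧
      η * m ≤ ⌈γ * m⌉₊ ∧ ⌈γ * m⌉₊ + η * m ≤ (m : ℝ) := by
  have hKpos : 0 < K := by omega
  let a : Fin K := ⟨0, by omega⟩
  let b : Fin K := ⟨1, by omega⟩
  have hab : a ≠ b := by simp [a, b]
  set Δ := separating a b with hΔ
  set F := K.factorial with hF
  have hFpos : 0 < F := K.factorial_pos
  have hFpos' : (0 : ℝ) < F := by exact_mod_cast hFpos
  have hsep : ∀ i j : Fin K, i ≠ j → separating i j = Δ := fun i j h => separating_eq h hab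
  -- the asymptotic relative distance
  set δ : ℝ := Δ / F with hδ
  have hδ1 : δ ≤ 1 := by
    rw [hδ, div_le_one hFpos']
    have : Δ ≤ F := by
      refine (Finset.card_filter_le _ _).trans (le_of_eq ?_)
      simp [Fintype.card_perm, hF]
    exact_mod_cast this
  have hγδ : γ < δ := by
    rw [hδ, lt_div_iff₀ hFpos']
    have h1 : ((K * (K - 1) * Δ : ℕ) : ℝ) = ((F * (2 * (K ^ 2 / 4)) : ℕ) : ℝ) := by
      exact_mod_cast separating_mul hab
    rw [Nat.cast_choose_two] at hγ_lt
    push_cast [Nat.cast_sub (show 1 ≤ K by omega)] at h1 hγ_lt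
    have hKK : (0 : ℝ) < K * (K - 1) := by
      have : (2 : ℝ) ≤ K := by exact_mod_cast hK
      nlinarith
    have h2 := mul_lt_mul_of_pos_left hγ_lt hFpos'
    refine lt_of_mul_lt_mul_left (a := (K * (K - 1) : ℝ)) ?_ hKK.le
    linarith
  -- Half of the gap δ - γ serves as margin, the other half absorbs rounding; the bound by γ gives
  -- `η * m ≤ ⌈γ * m⌉₊`.
  refine ⟨min ((δ - γ) / 2) γ, lt_min (by linarith) hγ, ?_⟩
  have hη1 : min ((δ - γ) / 2) γ ≤ (δ - γ) / 2 := min_le_left _ _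
  have hη2 : min ((δ - γ) / 2) γ ≤ γ := min_le_right _ _
  -- One Δ pays for the incomplete last block, one for the mixed block, and 1 for the ceiling.
  have hlarge : ∀ᶠ m : ℕ in atTop, (2 * Δ + 1) / ((δ - γ) / 2) ≤ (m : ℝ) :=
    tendsto_natCast_atTop_atTop.eventually_ge_atTop _
  filter_upwards [hlarge] with m hm
  rw [div_le_iff₀ (by linarith)] at hm
  have hm0 : (0 : ℝ) ≤ m := Nat.cast_nonneg m
  set D := ⌈γ * m⌉₊ with hD
  have hDlt : (D : ℝ) < γ * m + 1 := Nat.ceil_lt_add_one (by positivity)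
  have hDge : γ * m ≤ D := Nat.le_ceil _
  have hηm1 : min ((δ - γ) / 2) γ * m ≤ (δ - γ) / 2 * m := by gcongr
  have hηm2 : min ((δ - γ) / 2) γ * m ≤ γ * m := by gcongr
  have hη0 : 0 ≤ min ((δ - γ) / 2) γ * m :=
    mul_nonneg (le_min (by linarith) hγ.le) hm0
  -- distances of the block construction
  have hbase : D + min ((δ - γ) / 2) γ * m ≤ ((m / F - 1) * Δ : ℕ) := by
    have h1 : (m : ℝ) / F - 2 ≤ ((m / F - 1 : ℕ) : ℝ) := by
      have h2 : (m : ℝ) / F < (m / F : ℕ) + 1 := by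
        rw [← Nat.floor_div_eq_div (K := ℝ)]
        exact Nat.lt_floor_add_one _
      have h3 : ((m / F : ℕ) : ℝ) ≤ (m / F - 1 : ℕ) + 1 := by
        exact_mod_cast (show m / F ≤ m / F - 1 + 1 by omega)
      linarith
    have h4 : ((m : ℝ) / F - 2) * Δ = δ * m - 2 * Δ := by
      rw [hδ]; field_simp
    push_cast
    have h5 : ((m : ℝ) / F - 2) * Δ ≤ ((m / F - 1 : ℕ) : ℝ) * Δ := by gcongr
    linarith
  have hFm : F * (m / F) ≤ m := Nat.mul_div_le m F
  -- The vector of `a` is moved towards that of `b` by overwriting its first `t` columns; its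
  -- distance to `b` falls from at least `D` to 0 in steps of at most one.
  let u : ℕ → ℕ → ℤˣ := fun t j => if j < t then column j b else column j a
  have hub : ∀ t, (∑ j ∈ Finset.range m, if u t j ≠ column j b then 1 else 0)
      = ∑ j ∈ Finset.range m, if t ≤ j ∧ column j a ≠ column j b then 1 else 0 := by
    intro t
    refine Finset.sum_congr rfl fun j _ => ?_
    by_cases h : j < t
    · simp [u, h]
    · simp [u, h, not_lt.1 h]
  obtain ⟨t, ht⟩ : ∃ t, (∑ j ∈ Finset.range m, if u t j ≠ column j b then 1 else 0) = D := by
    refine exists_eq_of_slow_decrease (m := m) ?_ ?_ ?_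
    · have h1 := mul_le_sum_range_of_blocks (f := fun j => if u 0 j ≠ column j b then 1 else 0)
        (Δ := Δ) 0 hFm (fun r _ => by simpa [u] using (sum_column_block a b r).ge)
      have h2 : (D : ℝ) ≤ ((m / F - 1) * Δ : ℕ) := by linarith
      exact le_trans (by exact_mod_cast h2) h1
    · rw [hub, Finset.sum_eq_zero]
      · exact Nat.zero_le _
      · intro j hj
        rw [if_neg]
        have := Finset.mem_range.1 hj
        omega
    · intro t
      rw [hub, hub]
      have : ∀ j ∈ Finset.range m, (if t ≤ j ∧ column j a ≠ column j b then 1 else 0)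
          ≤ (if t + 1 ≤ j ∧ column j a ≠ column j b then 1 else 0) + if j = t then 1 else 0 := by
        intro j _
        by_cases h : j = t
        · simp only [h, if_true]
          split_ifs <;> simp
        · have : t ≤ j ↔ t + 1 ≤ j := by omega
          simp [h, this]
      refine (Finset.sum_le_sum this).trans ?_
      rw [Finset.sum_add_distrib]
      gcongr
      rw [Finset.sum_ite_eq']
      split_ifs <;> simp
  have hother : ∀ k, k ≠ a → k ≠ b →
      (m / F - 1) * Δ ≤ ∑ j ∈ Finset.range m, if u t j ≠ column j k then 1 else 0 := by
    intro k hka hkb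
    -- Only block `t / F` can mix the two patterns. Earlier blocks copy `b`, later ones copy `a`,
    -- and either is at distance Δ from `k` on a full block.
    refine mul_le_sum_range_of_blocks (t / F) hFm fun r hr => ?_
    rcases lt_or_gt_of_ne hr with h | h
    · have : ∀ i ∈ Finset.range F, (if u t (F * r + i) ≠ column (F * r + i) k then 1 else 0)
          = if column (F * r + i) b ≠ column (F * r + i) k then 1 else 0 := by
        intro i hi
        have hi := Finset.mem_range.1 hi
        have : F * r + i < t := by
          have h1 : F * (t / F) ≤ t := Nat.mul_div_le t F
          have h2 : F * (r + 1) ≤ F * (t / F) := Nat.mul_le_mul_left F h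
          rw [mul_add, mul_one] at h2
          omega
        simp only [u, this, if_true]
      rw [Finset.sum_congr rfl this, sum_column_block, hsep _ _ (Ne.symm hkb)]
    · have : ∀ i ∈ Finset.range F, (if u t (F * r + i) ≠ column (F * r + i) k then 1 else 0)
          = if column (F * r + i) a ≠ column (F * r + i) k then 1 else 0 := by
        intro i hi
        have : ¬ F * r + i < t := by
          have h1 : t < F * (t / F + 1) := by
            rw [mul_add, mul_one]
            have h3 := Nat.div_add_mod t F
            have h4 := Nat.mod_lt t hFpos
            omega
          have h2 : F * (t / F + 1) ≤ F * r := Nat.mul_le_mul_left F h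
          omega
        simp only [u, this, if_false]
      rw [Finset.sum_congr rfl this, sum_column_block, hsep _ _ (Ne.symm hka)]
  have hplain : ∀ k l : Fin K, k ≠ l →
      (m / F - 1) * Δ ≤ ∑ j ∈ Finset.range m, if column j k ≠ column j l then 1 else 0 := by
    intro k l hkl
    refine mul_le_sum_range_of_blocks 0 hFm fun r _ => ?_
    rw [sum_column_block, hsep _ _ hkl]
  let v : Fin K → Fin m → ℤˣ := fun k j => if k = a then u t j else column j k
  have hva : v a = fun j : Fin m => u t j := by funext j; simp [v]
  have hvk : ∀ k, k ≠ a → v k = fun j : Fin m => column (j : ℕ) k := by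
    intro k hk; funext j; simp [v, hk]
  have key : ∀ i j, i ≠ j → ¬(i = a ∧ j = b) → ¬(i = b ∧ j = a) →
      (m / F - 1) * Δ ≤ hammingDist (v i) (v j) := by
    intro i j hij h1 h2
    by_cases hi : i = a
    · subst hi
      have hjb : j ≠ b := fun h => h1 ⟨rfl, h⟩
      rw [hva, hvk j hij.symm, hammingDist_eq_sum_range (fun j => u t j) (fun l => column l j)]
      exact hother j hij.symm hjb
    · by_cases hj : j = a
      · subst hj
        have hib : i ≠ b := fun h => h2 ⟨h, rfl⟩
        rw [hammingDist_comm, hva, hvk i hi,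
          hammingDist_eq_sum_range (fun j => u t j) (fun l => column l i)]
        exact hother i hi hib
      · rw [hvk i hi, hvk j hj,
          hammingDist_eq_sum_range (fun l => column l i) (fun l => column l j)]
        exact hplain i j hij
  refine ⟨v, a, b, hab, ?_, ?_, by linarith, ?_⟩
  · rw [hva, hvk b hab.symm, hammingDist_eq_sum_range (fun j => u t j) (fun l => column l b), ht]
  · intro i j hij h1 h2
    exact hbase.trans (Nat.cast_le.2 (key i j hij h1 h2))
  · have : δ * m ≤ 1 * m := by gcongr
    have h0 : (0 : ℝ) ≤ Δ := Nat.cast_nonneg Δ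
    linarith

end RatingVectors

-- Likelihood comparison block by block

section LikelihoodBlocks

variable {ι A : Type*} [Fintype ι] [DecidableEq ι] [Fintype A]

omit [Fintype ι] [DecidableEq ι] [Fintype A] in
theorem dependsOn_block_le (w q : ι → A → ℝ) (B : Finset ι) :
    DependsOn (fun x : ι → A => ∏ i ∈ B, w i (x i) ≤ ∏ i ∈ B, q i (x i)) (B : Set ι) := by
  intro x y h
  have h1 : ∏ i ∈ B, w i (x i) = ∏ i ∈ B, w i (y i) :=
    Finset.prod_congr rfl fun i hi => by rw [h i hi]
  have h2 : ∏ i ∈ B, q i (x i) = ∏ i ∈ B, q i (y i) :=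
    Finset.prod_congr rfl fun i hi => by rw [h i hi]
  simp only [h1, h2]

/-- On samples of positive weight the common factors outside `B` are positive and cancel. -/
theorem prodProb_le_block {w q : ι → A → ℝ} (hw : IsLaw w) {B : Finset ι}
    (h : ∀ i, i ∉ B → w i = q i) :
    (prodProb w fun x => ∏ i, w i (x i) ≤ ∏ i, q i (x i))
      ≤ prodProb w fun x => ∏ i ∈ B, w i (x i) ≤ ∏ i ∈ B, q i (x i) := by
  refine prodProb_mono_of_pos hw fun x hx hle => ?_
  rw [← Finset.prod_mul_prod_compl B] at hx
  rw [← Finset.prod_mul_prod_compl B, ← Finset.prod_mul_prod_compl B (fun i => q i (x i)),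
    ← Finset.prod_congr rfl fun i hi =>
      congrFun (h i (Finset.mem_compl.1 hi)) (x i)] at hle
  have h0 : 0 ≤ ∏ i ∈ B, w i (x i) := Finset.prod_nonneg fun i _ => hw.nonneg i _
  exact le_of_mul_le_mul_right hle (pos_of_mul_pos_right hx h0)

omit [Fintype A] in
theorem mul_prod_le_prod_of_blocks {w w' : ι → A → ℝ} (hw : ∀ i a, 0 ≤ w i a)
    (hw' : ∀ i a, 0 ≤ w' i a) {B C : Finset ι} (hBC : Disjoint B C) {c : ℝ} (x : ι → A)
    (hB : ∏ i ∈ B, w i (x i) ≤ ∏ i ∈ B, w' i (x i))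
    (hC : ∏ i ∈ C, w i (x i) ≤ ∏ i ∈ C, w' i (x i))
    (hc : c * ∏ i ∈ (B ∪ C)ᶜ, w i (x i) ≤ ∏ i ∈ (B ∪ C)ᶜ, w' i (x i)) :
    c * ∏ i, w i (x i) ≤ ∏ i, w' i (x i) := by
  have h0 : ∀ s : Finset ι, 0 ≤ ∏ i ∈ s, w i (x i) := fun s =>
    Finset.prod_nonneg fun i _ => hw i _
  have h0' : ∀ s : Finset ι, 0 ≤ ∏ i ∈ s, w' i (x i) := fun s =>
    Finset.prod_nonneg fun i _ => hw' i _
  rw [← Finset.prod_mul_prod_compl (B ∪ C), ← Finset.prod_mul_prod_compl (B ∪ C) fun i => w' i (x i),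
    Finset.prod_union hBC, Finset.prod_union hBC, mul_left_comm]
  calc (∏ i ∈ B, w i (x i)) * (∏ i ∈ C, w i (x i)) * (c * ∏ i ∈ (B ∪ C)ᶜ, w i (x i))
      ≤ (∏ i ∈ B, w i (x i)) * (∏ i ∈ C, w i (x i)) * ∏ i ∈ (B ∪ C)ᶜ, w' i (x i) :=
        mul_le_mul_of_nonneg_left hc (mul_nonneg (h0 _) (h0 _))
    _ ≤ _ := mul_le_mul_of_nonneg_right (mul_le_mul hB hC (h0 _) (h0' _)) (h0' _)

/-- A union bound on the complements, needed because the two events of an exchange come from the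
same sample. -/
theorem prodExp_prodProb_and {ι' A' : Type*} [Fintype ι'] [DecidableEq ι'] [Fintype A']
    {w : ι → A → ℝ} (hw : IsLaw w) {w' : ι' → A' → ℝ} (hw' : IsLaw w')
    (E E' : (ι → A) → (ι' → A') → Prop) :
    (prodExp w fun x => prodProb w' (E x)) + (prodExp w fun x => prodProb w' (E' x)) - 1
      ≤ prodExp w fun x => prodProb w' fun z => E x z ∧ E' x z := by
  classical
  rw [← prodExp_add, ← prodExp_const hw 1, ← prodExp_sub]
  refine prodExp_mono hw fun x => ?_
  rw [prodProb_eq, prodProb_eq, prodProb_eq, ← prodExp_add, ← prodExp_const hw' 1, ← prodExp_sub]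
  refine prodExp_mono hw' fun z => ?_
  by_cases h : E x z <;> by_cases h' : E' x z <;> simp [h, h', prodExp_const hw']

end LikelihoodBlocks

-- Confusable families: ambiguous items of one cluster

section Columns

variable {n m K W : ℕ} {γ : ℝ}

/-- The rating vectors `v` with `v a` on `T` replaced by `v b` on `X` and by `-v b` off `X`. -/
def twistVec (v : Fin K → Fin m → ℤˣ) (a b : Fin K) (T X : Finset (Fin m)) :
    Fin K → Fin m → ℤˣ :=
  fun k j => if k = a ∧ j ∈ T then (if j ∈ X then v b j else -v b j) else v k j

theorem units_ne_neg (r : ℤˣ) : r ≠ -r := by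
  rcases Int.units_eq_one_or r with h | h <;> subst h <;> decide

theorem twistVec_apply_b {v : Fin K → Fin m → ℤˣ} {a b : Fin K} (hab : a ≠ b)
    (T X : Finset (Fin m)) : twistVec v a b T X b = v b := by
  funext j
  simp [twistVec, hab.symm]

/-- Inside `T` the twisted vector of `a` disagrees with that of `b` exactly on `T \ X`; outside `T`
nothing changes. -/
theorem hammingDist_twistVec {v : Fin K → Fin m → ℤˣ} {a b : Fin K} (hab : a ≠ b)
    {T X : Finset (Fin m)} (hX : X ⊆ T) :
    hammingDist (twistVec v a b T X a) (twistVec v a b T X b) + (T.filter fun j => v a j ≠ v b j).card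
      = hammingDist (v a) (v b) + (T.card - X.card) := by
  rw [twistVec_apply_b hab]
  have h1 : (Finset.univ.filter fun j => twistVec v a b T X a j ≠ v b j)
      = (Finset.univ.filter fun j => j ∉ T ∧ v a j ≠ v b j) ∪ (T \ X) := by
    ext j
    by_cases hT : j ∈ T <;> by_cases hjX : j ∈ X <;>
      simp [twistVec, hT, hjX, (units_ne_neg (v b j)).symm]
  have h2 : (Finset.univ.filter fun j => v a j ≠ v b j)
      = (Finset.univ.filter fun j => j ∉ T ∧ v a j ≠ v b j) ∪ (T.filter fun j => v a j ≠ v b j) := by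
    ext j
    by_cases hT : j ∈ T <;> simp [hT]
  rw [hammingDist, hammingDist, h1, h2, Finset.card_union_of_disjoint, Finset.card_union_of_disjoint,
    Finset.card_sdiff_of_subset hX]
  · ring
  · rw [Finset.disjoint_left]
    intro j hj hj'
    simp only [Finset.mem_filter] at hj hj'
    exact hj.2.1 hj'.1
  · rw [Finset.disjoint_left]
    intro j hj hj'
    simp only [Finset.mem_filter, Finset.mem_sdiff] at hj hj'
    exact hj.2.1 hj'.1

theorem hammingDist_twistVec_self_le (v : Fin K → Fin m → ℤˣ) (a b : Fin K)
    (T X : Finset (Fin m)) (k : Fin K) :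
    hammingDist (v k) (twistVec v a b T X k) ≤ if k = a then T.card else 0 := by
  rw [hammingDist]
  by_cases hk : k = a
  · rw [if_pos hk]
    refine Finset.card_le_card fun j hj => ?_
    by_contra hT
    simp [twistVec, hT] at hj
  · simp [twistVec, hk]

/-- The twist trades M disagreements inside `T` for M others, so the closest pair keeps its
distance. Any other distance falls by at most `2 * M`, the size of `T`, since only the vector of `a`
moves; the margin absorbs this. -/
theorem isLeast_twistVec {v : Fin K → Fin m → ℤˣ} {a b : Fin K} (hab : a ≠ b) {M D : ℕ}
    (hD : hammingDist (v a) (v b) = D)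
    (hfar : ∀ i j, i ≠ j → ¬(i = a ∧ j = b) → ¬(i = b ∧ j = a) →
      D + 2 * M ≤ hammingDist (v i) (v j))
    {T X : Finset (Fin m)} (hX : X ⊆ T) (hTM : T.card = 2 * M) (hXM : X.card = M)
    (hdis : (T.filter fun j => v a j ≠ v b j).card = M) :
    IsLeast {d : ℕ | ∃ i j : Fin K, i ≠ j ∧
      d = hammingDist (twistVec v a b T X i) (twistVec v a b T X j)} D := by
  have hDab : hammingDist (twistVec v a b T X a) (twistVec v a b T X b) = D := by
    have := hammingDist_twistVec (v := v) hab hX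
    omega
  refine ⟨⟨a, b, hab, hDab.symm⟩, ?_⟩
  rintro d ⟨i, j, hij, rfl⟩
  by_cases h1 : i = a ∧ j = b
  · rw [h1.1, h1.2, hDab]
  by_cases h2 : i = b ∧ j = a
  · rw [h2.1, h2.2, hammingDist_comm, hDab]
  have h3 := hfar i j hij h1 h2
  have h4 := hammingDist_triangle (v i) (twistVec v a b T X i) (v j)
  have h5 := hammingDist_triangle (twistVec v a b T X i) (twistVec v a b T X j) (v j)
  have h6 := hammingDist_twistVec_self_le v a b T X i
  have h7 := hammingDist_twistVec_self_le v a b T X j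
  rw [hammingDist_comm (v j)] at h7
  have h8 : (if i = a then T.card else 0) + (if j = a then T.card else 0) ≤ 2 * M := by
    split_ifs with hi hj
    · exact absurd (hi.trans hj.symm) hij
    all_goals omega
  omega

/-- Lower bound on the probability that the likelihood favours the wrong one of two rating
patterns that differ in `N` entries. -/
noncomputable def ratingTail (p θ : ℝ) (N : ℕ) : ℝ :=
  1 / 4 * Real.exp (-(√(2 * (1 + 4 * ratingVar θ * (N * p))) / 2)) *
    (1 - p * quality (1 - θ) θ) ^ N

/-- Worst-case error lower bound from the uncertainty of one rating vector. -/
theorem le_worstErr_of_columns {p θ : ℝ} (hp0 : 0 ≤ p) (hp1 : p ≤ 1) (hθ0 : 0 ≤ θ)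
    (hθ1 : θ < 1 / 2) (hpI : p * quality (1 - θ) θ ≤ 1 / 2)
    {α β : ℕ → ℝ} (hαβ : ∀ d ∈ Finset.Icc 2 W, 0 ≤ β d ∧ β d < α d ∧ α d ≤ 1)
    (c : Fin n → Fin K) {N : ℕ} (hN : 0 < N) (hKN : K * N = n)
    (hc : ∀ k, (Finset.univ.filter fun i => c i = k).card = N)
    {v : Fin K → Fin m → ℤˣ} {a b : Fin K} (hab : a ≠ b) {M : ℕ}
    (hD : hammingDist (v a) (v b) = ⌈γ * m⌉₊)
    (hfar : ∀ i j, i ≠ j → ¬(i = a ∧ j = b) → ¬(i = b ∧ j = a) →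
      ⌈γ * m⌉₊ + 2 * M ≤ hammingDist (v i) (v j))
    (hM1 : M ≤ ⌈γ * m⌉₊) (hM2 : ⌈γ * m⌉₊ + M ≤ m) (ψ : Estimator n m W) :
    (1 - 2 * (1 - ratingTail p θ N) ^ M) / 3 ≤ worstErr K W γ p θ α β ψ := by
  classical
  -- `T` takes M items on which `a` and `b` disagree and M on which they agree, so that an M-element
  -- `X` restores the original number of disagreements.
  obtain ⟨T₁, hT₁, hT₁M⟩ := Finset.exists_subset_card_eq
    (s := Finset.univ.filter fun j => v a j ≠ v b j) (n := M) (by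
      change M ≤ hammingDist (v a) (v b)
      omega)
  obtain ⟨T₂, hT₂, hT₂M⟩ := Finset.exists_subset_card_eq
    (s := Finset.univ.filter fun j => ¬ v a j ≠ v b j) (n := M) (by
      have := Finset.card_filter_add_card_filter_not (s := (Finset.univ : Finset (Fin m)))
        (fun j => v a j ≠ v b j)
      have h' : (Finset.univ.filter fun j => v a j ≠ v b j).card = ⌈γ * m⌉₊ := hD
      rw [Finset.card_univ, Fintype.card_fin] at this
      omega)
  have hdisj : Disjoint T₁ T₂ := by
    rw [Finset.disjoint_left]
    intro j h1 h2
    have h1 := hT₁ h1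
    have h2 := hT₂ h2
    simp only [Finset.mem_filter] at h1 h2
    exact h2.2 h1.2
  set T := T₁ ∪ T₂ with hT
  have hTM : T.card = 2 * M := by rw [hT, Finset.card_union_of_disjoint hdisj]; omega
  have hTdis : (T.filter fun j => v a j ≠ v b j).card = M := by
    rw [← hT₁M]
    congr 1
    ext j
    simp only [hT, Finset.mem_filter, Finset.mem_union]
    constructor
    · rintro ⟨h | h, h'⟩
      · exact h
      · exact absurd h' (Finset.mem_filter.1 (hT₂ h)).2
    · exact fun h => ⟨Or.inl h, (Finset.mem_filter.1 (hT₁ h)).2⟩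
  let β' := {X : Finset (Fin m) // X ⊆ T ∧ X.card = M}
  let G : β' → GroundTruth n m K γ := fun X =>
    { cluster := c
      vec := twistVec v a b T X.1
      card_cluster := fun k => by rw [hc, hKN]
      minDist := isLeast_twistVec hab hD hfar X.2.1 hTM X.2.2 hTdis }
  obtain ⟨i₀, hi₀⟩ : ∃ i, c i = a := by
    have : 0 < (Finset.univ.filter fun i => c i = a).card := by rw [hc]; exact hN
    obtain ⟨i, hi⟩ := Finset.card_pos.1 this
    exact ⟨i, (Finset.mem_filter.1 hi).2⟩
  refine le_worstErr hp0 hp1 hθ0 (by linarith) hαβ Finset.univ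
    ⟨⟨T₁, Finset.subset_union_left, hT₁M⟩, Finset.mem_univ _⟩ G ?_ ?_ ψ
  · intro X _ X' _ h
    refine Subtype.ext (Finset.ext fun j => ?_)
    have hj := congrFun h (i₀, j)
    simp only [GroundTruth.rating, G, hi₀, twistVec, true_and] at hj
    by_cases hjT : j ∈ T
    · simp only [hjT, if_true] at hj
      by_cases h1 : j ∈ X.1 <;> by_cases h2 : j ∈ X'.1 <;>
        simp only [h1, h2, if_true, if_false] at hj ⊢
      · exact absurd hj (units_ne_neg _)
      · exact absurd hj.symm (units_ne_neg _)
    · exact ⟨fun h => absurd (X.2.1 h) hjT, fun h => absurd (X'.2.1 h) hjT⟩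
  · intro X _
    set ρ := (G X).rating with hρ
    have hw : IsLaw fun i => entryProb p θ (ρ i) :=
      isLaw_entryProb hp0 hp1 hθ0 (by linarith) ρ
    have hw' : IsLaw fun h : PotentialEdge n W => bern (edgeProb α β (G X).cluster h) :=
      isLaw_bern (fun h => (edgeProb_mem hαβ _ h).1) (fun h => (edgeProb_mem hαβ _ h).2)
    let flip : Fin m → Fin n × Fin m → ℤˣ := fun j i => if i.2 = j ∧ c i.1 = a then -ρ i else ρ i
    let B : Fin m → Finset (Fin n × Fin m) := fun j => Finset.univ.filter fun i => i.2 = j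
    let R : Fin m → (Fin n × Fin m → Option ℤˣ) → Prop := fun j x =>
      ∏ i ∈ B j, entryProb p θ (ρ i) (x i) ≤ ∏ i ∈ B j, entryProb p θ (flip j i) (x i)
    have hq : ∀ j, ratingTail p θ N ≤ prodProb (fun i => entryProb p θ (ρ i)) (R j) := by
      intro j
      refine (entry_chernoff_lower hp0 hp1 hθ0 hθ1 hpI ρ (flip j) (N := N) ?_).trans
        (prodProb_le_block hw ?_)
      · rw [← hc a]
        refine Finset.card_bij' (fun i _ => i.1) (fun i _ => (i, j)) ?_ ?_ ?_ ?_
        · intro i hi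
          simp only [flip, Finset.mem_filter, Finset.mem_univ, true_and] at hi ⊢
          by_contra h
          simp [h] at hi
        · intro i hi
          have := (units_ne_neg (ρ (i, j)))
          simp_all [flip]
        · intro i hi
          simp only [flip, Finset.mem_filter, Finset.mem_univ, true_and] at hi
          by_contra h
          have : i.2 ≠ j := fun h' => h (by rw [← h'])
          simp [this] at hi
        · intro i _; rfl
      · intro i hi
        have : i.2 ≠ j := by simpa [B] using hi
        simp [flip, this]
    have hR : ∀ j, DependsOn (R j) (B j : Set (Fin n × Fin m)) := fun j => dependsOn_block_le _ _ _
    have hBd : ∀ i s s', i ∈ (B s : Set (Fin n × Fin m)) → i ∈ (B s' : Set (Fin n × Fin m)) →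
        s = s' := by
      intro i s s' h h'
      simp only [B, Finset.coe_filter, Finset.mem_univ, true_and, Set.mem_ofPred_eq] at h h'
      exact h.symm.trans h'
    have hex : ∀ Y : Finset (Fin m), Y.card = M → 1 - (1 - ratingTail p θ N) ^ M
        ≤ prodExp (fun i => entryProb p θ (ρ i)) fun x =>
          prodProb (fun h : PotentialEdge n W => bern (edgeProb α β (G X).cluster h))
            fun _ => ∃ s ∈ Y, R s x ∧ True := by
      intro Y hY
      rw [← hY]
      -- All members share the clusters, so the hypergraphs carry no information here: the second
      -- event is trivial and its blocks are empty.
      refine one_sub_pow_le_prodExp_exists hw hw' (fun s => (B s : Set (Fin n × Fin m))) hBd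
        (fun _ => ∅) (by simp) R (fun _ _ => True) Y (fun s _ => hR s)
        (fun s _ => dependsOn_const _) fun s _ => ?_
      have h1 : prodProb (fun h : PotentialEdge n W => bern (edgeProb α β (G X).cluster h))
          (fun _ => True) = 1 := by
        rw [prodProb_eq]
        simpa using prodExp_const hw' 1
      rw [h1, mul_one]
      exact hq s
    have h2 := prodExp_prodProb_and hw hw' (fun x _ => ∃ s ∈ X.1, R s x ∧ True)
      (fun x _ => ∃ s ∈ T \ X.1, R s x ∧ True)
    have h3 := hex X.1 X.2.2
    have h4 := hex (T \ X.1) (by rw [Finset.card_sdiff_of_subset X.2.1, hTM, X.2.2]; omega)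
    refine le_trans (by linarith) (h2.trans ?_)
    refine prodExp_mono hw fun x => prodProb_mono_of_pos hw' fun z _ => ?_
    rintro ⟨⟨s, hs, hRs, -⟩, ⟨t, ht, hRt, -⟩⟩
    rw [Finset.mem_sdiff] at ht
    have hst : s ≠ t := fun h => ht.2 (h ▸ hs)
    have hts : t ∉ X.1.erase s := fun h => ht.2 (Finset.mem_of_mem_erase h)
    -- The rival flips both columns `s` and `t`; flipping one alone would change the minimal
    -- distance.
    let X' : β' := ⟨insert t (X.1.erase s), by
      constructor
      · intro j hj
        rcases Finset.mem_insert.1 hj with rfl | hj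
        · exact ht.1
        · exact X.2.1 (Finset.mem_of_mem_erase hj)
      · rw [Finset.card_insert_of_notMem hts, Finset.card_erase_of_mem hs, X.2.2]
        have : 0 < X.1.card := Finset.card_pos.2 ⟨s, hs⟩
        have := X.2.2
        omega⟩
    refine ⟨X', Finset.mem_univ _, ?_, ?_⟩
    · intro h
      have : t ∈ X'.1 := Finset.mem_insert_self _ _
      rw [h] at this
      exact ht.2 this
    · have hrat : ∀ i, (G X').rating i
          = if i.2 = s then flip s i else if i.2 = t then flip t i else ρ i := by
        intro i
        simp only [hρ, GroundTruth.rating, G, flip, twistVec, X']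
        by_cases hia : c i.1 = a
        · by_cases h1 : i.2 = s
          · simp [hia, h1, hst, X.2.1 hs, hs]
          · by_cases h2 : i.2 = t
            · simp [hia, h2, hst.symm, ht.1, ht.2]
            · simp [hia, h1, h2]
        · simp [hia]
      have hle : ratingProb p θ ρ x ≤ ratingProb p θ (G X').rating x := by
        rw [← one_mul (ratingProb p θ ρ x)]
        refine mul_prod_le_prod_of_blocks (B := B s) (C := B t)
          (w := fun i => entryProb p θ (ρ i)) (w' := fun i => entryProb p θ ((G X').rating i))
          hw.nonneg (fun i a => entryProb_nonneg hp0 hp1 hθ0 (by linarith) _ _) ?_ x ?_ ?_ ?_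
        · rw [Finset.disjoint_left]
          intro i h h'
          exact hst (hBd i s t h h')
        · refine hRs.trans (le_of_eq (Finset.prod_congr rfl fun i hi => ?_))
          have : i.2 = s := by simpa [B] using hi
          rw [hrat, if_pos this]
        · refine hRt.trans (le_of_eq (Finset.prod_congr rfl fun i hi => ?_))
          have : i.2 = t := by simpa [B] using hi
          rw [hrat, if_neg (by rw [this]; exact hst.symm), if_pos this]
        · rw [one_mul]
          refine le_of_eq (Finset.prod_congr rfl fun i hi => ?_)
          have : i.2 ≠ s ∧ i.2 ≠ t := by simpa [B] using hi
          rw [hrat, if_neg this.1, if_neg this.2]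
      have h0 : 0 ≤ hyperProb α β c z := hw'.prod_nonneg z
      have h0' : 0 ≤ ratingProb p θ ρ x := hw.prod_nonneg x
      change 1 / 2 * (ratingProb p θ ρ x * hyperProb α β c z)
        ≤ ratingProb p θ (G X').rating x * hyperProb α β c z
      nlinarith [mul_nonneg h0' h0, mul_le_mul_of_nonneg_right hle h0]

end Columns

theorem one_sub_sum_le_prod_one_sub {ι : Type*} (s : Finset ι) {f : ι → ℝ}
    (h0 : ∀ i ∈ s, 0 ≤ f i) (h1 : ∀ i ∈ s, f i ≤ 1) : 1 - ∑ i ∈ s, f i ≤ ∏ i ∈ s, (1 - f i) := by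
  classical
  induction s using Finset.induction_on with
  | empty => simp
  | insert a s ha ih =>
    rw [Finset.sum_insert ha, Finset.prod_insert ha]
    have hih := ih (fun i hi => h0 i (Finset.mem_insert_of_mem hi))
      (fun i hi => h1 i (Finset.mem_insert_of_mem hi))
    have ha0 := h0 a (Finset.mem_insert_self _ _)
    have ha1 := h1 a (Finset.mem_insert_self _ _)
    have hs : 0 ≤ ∑ i ∈ s, f i :=
      Finset.sum_nonneg fun i hi => h0 i (Finset.mem_insert_of_mem hi)
    nlinarith [mul_le_mul_of_nonneg_left hih (sub_nonneg.2 ha1)]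

-- Hyperedges around the critical users

section Edges

variable {n K W : ℕ}

/-- All users of `h` have the same label under `c`. -/
def Homogeneous (c : Fin n → Fin K) (h : PotentialEdge n W) : Prop :=
  ∀ i ∈ h.1, ∀ j ∈ h.1, c i = c j

instance (c : Fin n → Fin K) (h : PotentialEdge n W) : Decidable (Homogeneous c h) := by
  unfold Homogeneous; infer_instance

theorem edgeProb_of_homogeneous {c : Fin n → Fin K} {h : PotentialEdge n W} (α β : ℕ → ℝ)
    (hc : Homogeneous c h) : edgeProb α β c h = α h.1.card := if_pos hc

theorem edgeProb_of_not_homogeneous {c : Fin n → Fin K} {h : PotentialEdge n W} (α β : ℕ → ℝ)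
    (hc : ¬ Homogeneous c h) : edgeProb α β c h = β h.1.card := if_neg hc

theorem edgeProb_congr {c c' : Fin n → Fin K} {h : PotentialEdge n W} (α β : ℕ → ℝ)
    (hc : ∀ i ∈ h.1, c i = c' i) : edgeProb α β c h = edgeProb α β c' h := by
  unfold edgeProb
  refine if_congr ?_ rfl rfl
  exact forall₂_congr fun i hi => forall₂_congr fun j hj => by rw [hc i hi, hc j hj]

theorem sum_edges_eq (A : Finset (PotentialEdge n W)) (f : ℕ → ℝ) :
    ∑ h ∈ A, f h.1.card
      = ∑ d ∈ Finset.Icc 2 W, ((A.filter fun h => h.1.card = d).card : ℝ) * f d := by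
  rw [← Finset.sum_fiberwise_of_maps_to (g := fun h : PotentialEdge n W => h.1.card)
    (t := Finset.Icc 2 W) (fun h _ => Finset.mem_Icc.2 h.2)]
  refine Finset.sum_congr rfl fun d _ => ?_
  rw [Finset.sum_congr rfl fun h hh => by rw [(Finset.mem_filter.1 hh).2], Finset.sum_const,
    nsmul_eq_mul]

/-- Such a hyperedge is determined by its other `d - 1` users, which are non-critical and share the
label of `s`. -/
theorem card_homogeneous_le (c : Fin n → Fin K) (S : Finset (Fin n)) (s : Fin n) (d : ℕ) :
    (Finset.univ.filter fun h : PotentialEdge n W =>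
      h.1 ∩ S = {s} ∧ Homogeneous c h ∧ h.1.card = d).card
      ≤ (Finset.univ.filter fun i => i ∉ S ∧ c i = c s).card.choose (d - 1) := by
  rw [← Finset.card_powersetCard]
  have hs : ∀ h : PotentialEdge n W, h.1 ∩ S = {s} → s ∈ h.1 := fun h hh =>
    (Finset.mem_inter.1 (hh ▸ Finset.mem_singleton_self s)).1
  refine Finset.card_le_card_of_injOn (fun h => h.1.erase s) ?_ ?_
  · intro h hh
    obtain ⟨-, h1, h2, h3⟩ := Finset.mem_filter.1 hh
    refine Finset.mem_coe.2 (Finset.mem_powersetCard.2 ⟨?_, ?_⟩)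
    · intro i hi
      rw [Finset.mem_erase] at hi
      refine Finset.mem_filter.2 ⟨Finset.mem_univ _, fun hiS => hi.1 ?_, h2 i hi.2 s (hs h h1)⟩
      rw [← Finset.mem_singleton, ← h1]
      exact Finset.mem_inter.2 ⟨hi.2, hiS⟩
    · rw [Finset.card_erase_of_mem (hs h h1), h3]
  · intro h hh h' hh' heq
    obtain ⟨-, h1, -⟩ := Finset.mem_filter.1 hh
    obtain ⟨-, h1', -⟩ := Finset.mem_filter.1 hh'
    refine Subtype.ext ?_
    rw [← Finset.insert_erase (hs h h1), ← Finset.insert_erase (hs h' h1')]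
    exact congrArg _ heq

theorem card_pair_le (s t : Fin n) (hst : s ≠ t) (d : ℕ) :
    (Finset.univ.filter fun h : PotentialEdge n W => s ∈ h.1 ∧ t ∈ h.1 ∧ h.1.card = d).card
      ≤ (n - 2).choose (d - 2) := by
  have hcard : ((Finset.univ.erase s).erase t : Finset (Fin n)).card = n - 2 := by
    rw [Finset.card_erase_of_mem (by simp [hst.symm]), Finset.card_erase_of_mem (by simp),
      Finset.card_univ, Fintype.card_fin]
    omega
  rw [← hcard, ← Finset.card_powersetCard]
  refine Finset.card_le_card_of_injOn (fun h => (h.1.erase s).erase t) ?_ ?_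
  · intro h hh
    obtain ⟨-, h1, h2, h3⟩ := Finset.mem_filter.1 hh
    refine Finset.mem_coe.2 (Finset.mem_powersetCard.2 ⟨?_, ?_⟩)
    · exact Finset.erase_subset_erase _ (Finset.erase_subset_erase _ (Finset.subset_univ _))
    · rw [Finset.card_erase_of_mem (Finset.mem_erase.2 ⟨hst.symm, h2⟩),
        Finset.card_erase_of_mem h1, h3]
      omega
  · intro h hh h' hh' heq
    obtain ⟨-, h1, h2, -⟩ := Finset.mem_filter.1 hh
    obtain ⟨-, h1', h2', -⟩ := Finset.mem_filter.1 hh'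
    refine Subtype.ext ?_
    rw [← Finset.insert_erase h1, ← Finset.insert_erase h1',
      ← Finset.insert_erase (Finset.mem_erase.2 ⟨hst.symm, h2⟩),
      ← Finset.insert_erase (Finset.mem_erase.2 ⟨hst.symm, h2'⟩)]
    exact congrArg _ (congrArg _ heq)

/-- A union over the choice of a second critical user `t`. -/
theorem card_multi_le (S : Finset (Fin n)) (s : Fin n) (d : ℕ) :
    (Finset.univ.filter fun h : PotentialEdge n W =>
      s ∈ h.1 ∧ 2 ≤ (h.1 ∩ S).card ∧ h.1.card = d).card ≤ S.card * (n - 2).choose (d - 2) := by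
  classical
  calc _ ≤ ((S.erase s).biUnion fun t => Finset.univ.filter fun h : PotentialEdge n W =>
        s ∈ h.1 ∧ t ∈ h.1 ∧ h.1.card = d).card := by
        refine Finset.card_le_card fun h hh => ?_
        obtain ⟨-, h1, h2, h3⟩ := Finset.mem_filter.1 hh
        obtain ⟨t, ht, hts⟩ := Finset.exists_mem_ne (show 1 < (h.1 ∩ S).card by omega) s
        rw [Finset.mem_inter] at ht
        exact Finset.mem_biUnion.2 ⟨t, Finset.mem_erase.2 ⟨hts, ht.2⟩,
          Finset.mem_filter.2 ⟨Finset.mem_univ _, h1, ht.1, h3⟩⟩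
    _ ≤ ∑ t ∈ S.erase s, _ := Finset.card_biUnion_le
    _ ≤ ∑ t ∈ S.erase s, (n - 2).choose (d - 2) :=
        Finset.sum_le_sum fun t ht => card_pair_le s t (Finset.ne_of_mem_erase ht).symm d
    _ = (S.erase s).card * (n - 2).choose (d - 2) := by simp
    _ ≤ _ := Nat.mul_le_mul_right _ (Finset.card_le_card (Finset.erase_subset _ _))

theorem sum_multi_le (S : Finset (Fin n)) (s t : Fin n) {f : ℕ → ℝ}
    (hf : ∀ d ∈ Finset.Icc 2 W, 0 ≤ f d) :
    ∑ h ∈ Finset.univ.filter (fun h : PotentialEdge n W =>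
      (s ∈ h.1 ∨ t ∈ h.1) ∧ 2 ≤ (h.1 ∩ S).card), f h.1.card
      ≤ ∑ d ∈ Finset.Icc 2 W, 2 * S.card * ((n - 2).choose (d - 2) : ℝ) * f d := by
  classical
  rw [sum_edges_eq]
  refine Finset.sum_le_sum fun d hd => mul_le_mul_of_nonneg_right ?_ (hf d hd)
  have : ((Finset.univ.filter (fun h : PotentialEdge n W =>
      (s ∈ h.1 ∨ t ∈ h.1) ∧ 2 ≤ (h.1 ∩ S).card)).filter fun h => h.1.card = d).card
      ≤ S.card * (n - 2).choose (d - 2) + S.card * (n - 2).choose (d - 2) := by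
    refine le_trans (le_trans (Finset.card_le_card ?_) (Finset.card_union_le _ _))
      (add_le_add (card_multi_le (W := W) S s d) (card_multi_le (W := W) S t d))
    intro h hh
    simp only [Finset.mem_filter, Finset.mem_union, Finset.mem_univ, true_and] at hh ⊢
    tauto
  calc _ ≤ ((S.card * (n - 2).choose (d - 2) + S.card * (n - 2).choose (d - 2) : ℕ) : ℝ) := by
        exact_mod_cast this
    _ = _ := by push_cast; ring

/-- The image of a potential hyperedge under a permutation of the users. -/
def mapEdge (τ : Equiv.Perm (Fin n)) (h : PotentialEdge n W) : PotentialEdge n W :=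
  ⟨h.1.map τ.toEmbedding, by rw [Finset.card_map]; exact h.2⟩

/-- Lower bound on the probability that the hyperedges at one user favour moving this user to
another cluster; `N` is the number of candidate neighbours in either cluster. -/
noncomputable def edgeTail (W : ℕ) (α β : ℕ → ℝ) (ℓ : ℝ) (N : ℕ) : ℝ :=
  1 / 4 * Real.exp (-(√(2 * (1 + ∑ d ∈ Finset.Icc 2 W,
      2 * (N.choose (d - 1) : ℝ) * (2 * (α d * (ℓ ^ 2 + 2))))) / 2)) *
    Real.exp (-∑ d ∈ Finset.Icc 2 W,
      2 * (N.choose (d - 1) : ℝ) * (quality (α d) (β d) / 2 + 3 * α d ^ 2))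

/-- Exchanging the non-critical users of `a` and `b` has the same effect on a hyperedge whose only
critical user is `s` as moving `s` to the other cluster. This symmetry is the involution required by
`edge_chernoff_lower`. Only hyperedges homogeneous before or after the move change probability, at
most `2 * N.choose (d - 1)` of size `d`. -/
theorem edgeTail_le {α β : ℕ → ℝ} {ℓ : ℝ}
    (hαβ : ∀ d ∈ Finset.Icc 2 W, 0 < β d ∧ β d < α d ∧ α d ≤ 1 / 2)
    (hℓ : ∀ d ∈ Finset.Icc 2 W, Real.log (α d / β d) ≤ ℓ)
    (c : Fin n → Fin K) {S : Finset (Fin n)} {a b : Fin K} {τ : Equiv.Perm (Fin n)}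
    (hτ : Function.Involutive τ) (hτS : ∀ i ∈ S, τ i = i)
    (hτc : ∀ i, i ∉ S → c (τ i) = Equiv.swap a b (c i)) {s : Fin n} (hs : s ∈ S) {N : ℕ}
    (hN : (Finset.univ.filter fun i => i ∉ S ∧ c i = c s).card ≤ N)
    (hN' : (Finset.univ.filter fun i => i ∉ S ∧ c i = Equiv.swap a b (c s)).card ≤ N) :
    edgeTail W α β ℓ N ≤ prodProb (fun h : PotentialEdge n W => bern (edgeProb α β c h)) fun z =>
      ∏ h ∈ Finset.univ.filter (fun h : PotentialEdge n W => h.1 ∩ S = {s}),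
          bern (edgeProb α β c h) (z h)
        ≤ ∏ h ∈ Finset.univ.filter (fun h : PotentialEdge n W => h.1 ∩ S = {s}),
          bern (edgeProb α β (Function.update c s (Equiv.swap a b (c s))) h) (z h) := by
  classical
  set c' := Function.update c s (Equiv.swap a b (c s)) with hc'
  -- `c'` moves the single user `s`, so it need not have balanced clusters; it only serves to
  -- compare likelihoods, and balance returns once a second user moves back.
  have hc's : c' s = Equiv.swap a b (c s) := by simp [hc']
  have hc'i : ∀ i, i ≠ s → c' i = c i := fun i hi => by simp [hc', hi]
  have hmem : ∀ h : PotentialEdge n W, h.1.card ∈ Finset.Icc 2 W := fun h => Finset.mem_Icc.2 h.2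
  let B : Finset (PotentialEdge n W) := Finset.univ.filter fun h => h.1 ∩ S = {s}
  have hB : ∀ h, h ∈ B ↔ h.1 ∩ S = {s} := fun h => by simp [B]
  let e : PotentialEdge n W → ℝ := edgeProb α β c
  let e' : PotentialEdge n W → ℝ := fun h => if h ∈ B then edgeProb α β c' h else e h
  let π : PotentialEdge n W → PotentialEdge n W := fun h => if h ∈ B then mapEdge τ h else h
  have hmap_mem : ∀ (h : PotentialEdge n W) i, i ∈ (mapEdge τ h).1 ↔ τ i ∈ h.1 := by
    intro h i
    simp only [mapEdge, Finset.mem_map_equiv]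
    rw [show τ.symm i = τ i from by rw [Equiv.symm_apply_eq, hτ]]
  have hmapB : ∀ h, h ∈ B → mapEdge τ h ∈ B := by
    intro h hh
    rw [hB] at hh ⊢
    rw [← hh]
    ext i
    simp only [Finset.mem_inter, hmap_mem]
    constructor
    · rintro ⟨h1, h2⟩
      rw [hτS i h2] at h1
      exact ⟨h1, h2⟩
    · rintro ⟨h1, h2⟩
      rw [hτS i h2]
      exact ⟨h1, h2⟩
  have hπ : Function.Involutive π := by
    intro h
    by_cases hh : h ∈ B
    · simp only [π, hh, hmapB h hh, if_true]
      refine Subtype.ext (Finset.ext fun i => ?_)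
      rw [hmap_mem, hmap_mem, hτ]
    · simp only [π, hh, if_false]
  have hnotS : ∀ h ∈ B, ∀ i ∈ h.1, i ≠ s → i ∉ S := by
    intro h hh i hi his hiS
    rw [hB] at hh
    exact his (Finset.mem_singleton.1 (hh ▸ Finset.mem_inter.2 ⟨hi, hiS⟩))
  have hcτ : ∀ h ∈ B, ∀ i ∈ h.1, c (τ i) = Equiv.swap a b (c' i) := by
    intro h hh i hi
    by_cases his : i = s
    · rw [his, hτS s hs, hc's, ← Equiv.trans_apply, Equiv.swap_swap, Equiv.refl_apply]
    · rw [hτc i (hnotS h hh i hi his), hc'i i his]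
  have hπe : ∀ h, e (π h) = e' h := by
    intro h
    by_cases hh : h ∈ B
    · have hiff : Homogeneous c (mapEdge τ h) ↔ Homogeneous c' h := by
        constructor
        · intro hom i hi j hj
          have := hom (τ i) ((hmap_mem h _).2 (by rwa [hτ])) (τ j)
            ((hmap_mem h _).2 (by rwa [hτ]))
          rw [hcτ h hh i hi, hcτ h hh j hj] at this
          exact (Equiv.swap a b).injective this
        · intro hom i hi j hj
          rw [hmap_mem] at hi hj
          have := hom _ hi _ hj
          have h1 := hcτ h hh _ hi
          have h2 := hcτ h hh _ hj
          rw [hτ] at h1 h2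
          rw [h1, h2, this]
      have hcard : (mapEdge τ h).1.card = h.1.card := by simp [mapEdge]
      simp only [π, e, e', hh, if_true]
      by_cases hom : Homogeneous c' h
      · rw [edgeProb_of_homogeneous _ _ hom, edgeProb_of_homogeneous _ _ (hiff.2 hom), hcard]
      · rw [edgeProb_of_not_homogeneous _ _ hom,
          edgeProb_of_not_homogeneous _ _ (fun h => hom (hiff.1 h)), hcard]
    · simp only [π, e', hh, if_false]
  have hor : ∀ (c : Fin n → Fin K) (h : PotentialEdge n W),
      edgeProb α β c h = α h.1.card ∨ edgeProb α β c h = β h.1.card := by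
    intro c h
    unfold edgeProb
    split_ifs <;> simp
  let Act : Finset (PotentialEdge n W) :=
    Finset.univ.filter fun h => h.1 ∩ S = {s} ∧ (Homogeneous c h ∨ Homogeneous c' h)
  have hsum : ∀ f : ℕ → ℝ, (∀ d ∈ Finset.Icc 2 W, 0 ≤ f d) → ∑ h ∈ Act, f h.1.card
      ≤ ∑ d ∈ Finset.Icc 2 W, 2 * (N.choose (d - 1) : ℝ) * f d := by
    intro f hf
    rw [sum_edges_eq]
    refine Finset.sum_le_sum fun d hd => mul_le_mul_of_nonneg_right ?_ (hf d hd)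
    have h1 := card_homogeneous_le (W := W) c S s d
    have h2 := card_homogeneous_le (W := W) c' S s d
    have h3 : (Finset.univ.filter fun i => i ∉ S ∧ c' i = c' s)
        = Finset.univ.filter fun i => i ∉ S ∧ c i = Equiv.swap a b (c s) := by
      refine Finset.filter_congr fun i _ => and_congr_right fun hi => ?_
      rw [hc's, hc'i i fun h => hi (h ▸ hs)]
    rw [h3] at h2
    have h4 : (Act.filter fun h => h.1.card = d).card ≤ N.choose (d - 1) + N.choose (d - 1) := by
      refine le_trans (le_trans (Finset.card_le_card ?_) (Finset.card_union_le _ _))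
        (add_le_add (h1.trans (Nat.choose_le_choose _ hN)) (h2.trans (Nat.choose_le_choose _ hN')))
      intro h hh
      simp only [Act, Finset.mem_filter, Finset.mem_union, Finset.mem_univ, true_and] at hh ⊢
      tauto
    calc _ ≤ ((N.choose (d - 1) + N.choose (d - 1) : ℕ) : ℝ) := by exact_mod_cast h4
      _ = _ := by push_cast; ring
  have hmain := edge_chernoff_lower (a := fun h : PotentialEdge n W => α h.1.card)
    (b := fun h => β h.1.card) (e := e) (e' := e') (ℓ := ℓ)
    (fun h => (hαβ _ (hmem h)).1) (fun h => (hαβ _ (hmem h)).2.1.le)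
    (fun h => (hαβ _ (hmem h)).2.2) (fun h => hℓ _ (hmem h)) Act (fun h => hor c h)
    (fun h => by
      by_cases hh : h ∈ B
      · simp only [e', hh, if_true]; exact hor c' h
      · simp only [e', hh, if_false]; exact hor c h)
    (fun h hne => by
      by_cases hh : h ∈ B
      · refine Finset.mem_filter.2 ⟨Finset.mem_univ _, (hB h).1 hh, ?_⟩
        by_contra hcon
        push Not at hcon
        apply hne
        simp only [e, e', hh, if_true]
        rw [edgeProb_of_not_homogeneous _ _ hcon.1, edgeProb_of_not_homogeneous _ _ hcon.2]
      · exact absurd (by simp only [e', hh, if_false]) hne)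
    π hπ hπe
  have hw : IsLaw fun h : PotentialEdge n W => bern (e h) := by
    refine isLaw_bern (fun h => ?_) (fun h => ?_) <;>
      rcases hor c h with h1 | h1 <;> obtain ⟨h2, h3, h4⟩ := hαβ _ (hmem h) <;>
      simp only [e, h1] <;> linarith
  have h1 := hsum (fun d => 2 * (α d * (ℓ ^ 2 + 2))) fun d hd => by
    obtain ⟨h2, h3, h4⟩ := hαβ _ hd
    have : 0 < α d := h2.trans h3
    positivity
  have h2 := hsum (fun d => quality (α d) (β d) / 2 + 3 * α d ^ 2) fun d hd => by
    have : 0 ≤ quality (α d) (β d) := sq_nonneg _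
    positivity
  refine le_trans (le_trans ?_ hmain) ((prodProb_le_block hw (B := B) ?_).trans (le_of_eq ?_))
  · rw [edgeTail]
    gcongr
  · intro h hh
    simp only [e', hh, if_false]
  · congr 1
    funext z
    have : ∏ h ∈ B, bern (e' h) (z h) = ∏ h ∈ B, bern (edgeProb α β c' h) (z h) :=
      Finset.prod_congr rfl fun h hh => by simp only [e', hh, if_true]
    rw [this]

end Edges

/-- Conditioning on the coordinates in `p`: given a sample satisfying `E`, fresh values of the
remaining coordinates produce `F` with probability at least `η`. -/
theorem mul_prodProb_le_of_resample {ι A : Type*} [Fintype ι] [DecidableEq ι] [Fintype A]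
    {w : ι → A → ℝ} (hw : IsLaw w) (p : ι → Prop) [DecidablePred p] {E F : (ι → A) → Prop} {η : ℝ}
    (h : ∀ x, E x → η ≤ prodProb w fun y => F fun i => if p i then x i else y i) :
    η * prodProb w E ≤ prodProb w F := by
  classical
  rw [prodProb_eq w F, prodExp_resample hw p, prodProb_eq, ← prodExp_const_mul]
  refine prodExp_mono hw fun x => ?_
  rw [← prodProb_eq]
  split_ifs with hE
  · rw [mul_one]; exact h x hE
  · rw [mul_zero]; exact prodProb_nonneg hw _

theorem one_sub_sum_le_prodProb_absent {ι : Type*} [Fintype ι] [DecidableEq ι] {e : ι → ℝ}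
    (h0 : ∀ i, 0 ≤ e i) (h1 : ∀ i, e i ≤ 1) (s : Finset ι) :
    1 - ∑ i ∈ s, e i ≤ prodProb (fun i => bern (e i)) fun z => ∀ i ∈ s, z i = false := by
  have h2 : ∀ z : ι → Bool, (if ∀ i ∈ s, z i = false then (1 : ℝ) else 0)
      = ∏ i, if i ∈ s then (if z i = false then 1 else 0) else 1 := by
    intro z
    rw [Finset.prod_ite_mem, Finset.univ_inter]
    split_ifs with h
    · exact (Finset.prod_eq_one fun i hi => if_pos (h i hi)).symm
    · push Not at h
      obtain ⟨i, hi, hz⟩ := h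
      exact (Finset.prod_eq_zero hi (if_neg hz)).symm
  rw [prodProb_eq]
  simp only [h2]
  rw [prodExp_prod (fun i => bern (e i))
    (fun i t => if i ∈ s then (if t = false then 1 else 0) else 1)]
  refine (one_sub_sum_le_prod_one_sub s (fun i _ => h0 i) fun i _ => h1 i).trans (le_of_eq ?_)
  rw [← Finset.prod_subset (Finset.subset_univ s)]
  · exact Finset.prod_congr rfl fun i hi => by simp [hi, bern]
  · intro i _ hi
    simp [hi, bern]

-- Confusable families: critical users of two clusters

section Users

variable {n m K W N : ℕ} {γ : ℝ}

/-- The first `M` users of each of the clusters `a` and `b`. -/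
def criticalUsers (φ : Fin n ≃ Fin K × Fin N) (a b : Fin K) (M : ℕ) : Finset (Fin n) :=
  Finset.univ.filter fun i => ((φ i).1 = a ∨ (φ i).1 = b) ∧ (φ i).2.val < M

/-- The cluster assignment that puts the critical users in `X` into `a`, the others into `b`. -/
def assign (φ : Fin n ≃ Fin K × Fin N) (a b : Fin K) (M : ℕ) (X : Finset (Fin n)) (i : Fin n) :
    Fin K :=
  if i ∈ criticalUsers φ a b M then (if i ∈ X then a else b) else (φ i).1

theorem card_cluster_filter (φ : Fin n ≃ Fin K × Fin N) (k : Fin K) (P : Fin N → Prop)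
    [DecidablePred P] :
    (Finset.univ.filter fun i => (φ i).1 = k ∧ P (φ i).2).card = (Finset.univ.filter P).card := by
  refine Finset.card_bij' (fun i _ => (φ i).2) (fun r _ => φ.symm (k, r)) ?_ ?_ ?_ ?_
  · intro i hi
    simp_all
  · intro r hr
    simp_all
  · intro i hi
    simp only [Finset.mem_filter, Finset.mem_univ, true_and] at hi
    rw [Equiv.symm_apply_eq, ← hi.1]
  · intro r _
    simp

theorem card_fin_lt {M : ℕ} (hM : M ≤ N) :
    (Finset.univ.filter fun r : Fin N => r.val < M).card = M := by
  rw [Fin.card_filter_val_lt]; omega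

theorem card_fin_not_lt {M : ℕ} (hM : M ≤ N) :
    (Finset.univ.filter fun r : Fin N => ¬ r.val < M).card = N - M := by
  have := Finset.card_filter_add_card_filter_not (s := (Finset.univ : Finset (Fin N)))
    (fun r => r.val < M)
  rw [card_fin_lt hM, Finset.card_univ, Fintype.card_fin] at this
  omega

variable (φ : Fin n ≃ Fin K × Fin N) {a b : Fin K} (hab : a ≠ b) {M : ℕ} (hM : M ≤ N)
include hM

include hab in
theorem card_criticalUsers : (criticalUsers φ a b M).card = 2 * M := by
  have : criticalUsers φ a b M = (Finset.univ.filter fun i => (φ i).1 = a ∧ (φ i).2.val < M)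
      ∪ (Finset.univ.filter fun i => (φ i).1 = b ∧ (φ i).2.val < M) := by
    ext i
    simp only [criticalUsers, Finset.mem_filter, Finset.mem_union, Finset.mem_univ, true_and]
    tauto
  rw [this, Finset.card_union_of_disjoint, card_cluster_filter φ a (fun r => r.val < M),
    card_cluster_filter φ b (fun r => r.val < M), card_fin_lt hM]
  · ring
  · rw [Finset.disjoint_left]
    intro i h h'
    simp only [Finset.mem_filter, Finset.mem_univ, true_and] at h h'
    exact hab (h.1.symm.trans h'.1)

theorem card_remaining {k : Fin K} (hk : k = a ∨ k = b) :
    (Finset.univ.filter fun i => i ∉ criticalUsers φ a b M ∧ (φ i).1 = k).card = N - M := by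
  rw [← card_fin_not_lt hM, ← card_cluster_filter φ k (fun r => ¬ r.val < M)]
  congr 1
  ext i
  simp only [criticalUsers, Finset.mem_filter, Finset.mem_univ, true_and]
  constructor
  · rintro ⟨h1, rfl⟩
    exact ⟨rfl, fun h => h1 ⟨hk, h⟩⟩
  · rintro ⟨rfl, h⟩
    exact ⟨fun h' => h h'.2, rfl⟩

include hab in
-- Every M-element choice puts M critical users into each of `a` and `b`, next to the `N - M` that
-- stay fixed there.
theorem card_assign {X : Finset (Fin n)} (hX : X ⊆ criticalUsers φ a b M) (hXM : X.card = M)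
    (k : Fin K) : (Finset.univ.filter fun i => assign φ a b M X i = k).card = N := by
  set S := criticalUsers φ a b M with hS
  have hS2 := card_criticalUsers φ hab hM
  by_cases hka : k = a
  · have : (Finset.univ.filter fun i => assign φ a b M X i = k)
        = (Finset.univ.filter fun i => i ∉ S ∧ (φ i).1 = k) ∪ X := by
      ext i
      by_cases hi : i ∈ S
      · by_cases hiX : i ∈ X <;> simp [assign, ← hS, hi, hiX, hka, hab.symm]
      · have hiX : i ∉ X := fun h => hi (hX h)
        simp [assign, ← hS, hi, hiX]
    rw [this, Finset.card_union_of_disjoint, card_remaining φ hM (Or.inl hka), hXM]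
    · omega
    · rw [Finset.disjoint_left]
      intro i h h'
      exact (Finset.mem_filter.1 h).2.1 (hX h')
  by_cases hkb : k = b
  · have : (Finset.univ.filter fun i => assign φ a b M X i = k)
        = (Finset.univ.filter fun i => i ∉ S ∧ (φ i).1 = k) ∪ (S \ X) := by
      ext i
      by_cases hi : i ∈ S
      · by_cases hiX : i ∈ X <;> simp [assign, ← hS, hi, hiX, hkb, hab]
      · simp [assign, ← hS, hi]
    rw [this, Finset.card_union_of_disjoint, card_remaining φ hM (Or.inr hkb),
      Finset.card_sdiff_of_subset hX, hS2, hXM]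
    · omega
    · rw [Finset.disjoint_left]
      intro i h h'
      exact (Finset.mem_filter.1 h).2.1 (Finset.mem_sdiff.1 h').1
  · have h1 : (Finset.univ.filter fun i => assign φ a b M X i = k)
        = Finset.univ.filter fun i => (φ i).1 = k ∧ True := by
      refine Finset.filter_congr fun i _ => ?_
      by_cases hi : i ∈ S
      · have : (φ i).1 = a ∨ (φ i).1 = b := (Finset.mem_filter.1 hi).2.1
        have h2 : (φ i).1 ≠ k := by rintro rfl; tauto
        by_cases hiX : i ∈ X <;> simp [assign, ← hS, hi, hiX, Ne.symm hka, Ne.symm hkb, h2]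
      · simp [assign, ← hS, hi]
    rw [h1, card_cluster_filter φ k (fun _ => True)]
    simp

omit hM

/-- The permutation of the users that exchanges the non-critical users of `a` and `b`. -/
def swapUser (φ : Fin n ≃ Fin K × Fin N) (a b : Fin K) (M : ℕ) (i : Fin n) : Fin n :=
  if i ∈ criticalUsers φ a b M then i else φ.symm (Equiv.swap a b (φ i).1, (φ i).2)

theorem swap_eq_or (a b k : Fin K) :
    (Equiv.swap a b k = a ∨ Equiv.swap a b k = b) ↔ (k = a ∨ k = b) := by
  rw [Equiv.swap_apply_eq_iff, Equiv.swap_apply_eq_iff, Equiv.swap_apply_left,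
    Equiv.swap_apply_right, or_comm]

theorem swapUser_mem (i : Fin n) :
    swapUser φ a b M i ∈ criticalUsers φ a b M ↔ i ∈ criticalUsers φ a b M := by
  by_cases hi : i ∈ criticalUsers φ a b M
  · simp [swapUser, hi]
  · rw [swapUser, if_neg hi]
    simp only [criticalUsers, Finset.mem_filter, Finset.mem_univ, true_and,
      Equiv.apply_symm_apply, swap_eq_or]

theorem swapUser_involutive (a b : Fin K) (M : ℕ) : Function.Involutive (swapUser φ a b M) := by
  intro i
  by_cases hi : i ∈ criticalUsers φ a b M
  · simp [swapUser, hi]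
  · have h1 : swapUser φ a b M i ∉ criticalUsers φ a b M := by rwa [swapUser_mem]
    rw [swapUser, if_neg h1, swapUser, if_neg hi, Equiv.apply_symm_apply, Equiv.symm_apply_eq]
    simp only [← Equiv.trans_apply, Equiv.swap_swap, Equiv.refl_apply]

/-- Worst-case error lower bound from the uncertainty of the clusters of some users. -/
theorem le_worstErr_of_users {p θ : ℝ} (hp0 : 0 ≤ p) (hp1 : p ≤ 1) (hθ0 : 0 ≤ θ)
    (hθ1 : θ < 1 / 2) (hpI : p * quality (1 - θ) θ ≤ 1 / 2)
    {α β : ℕ → ℝ} {ℓ : ℝ}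
    (hαβ : ∀ d ∈ Finset.Icc 2 W, 0 < β d ∧ β d < α d ∧ α d ≤ 1 / 2)
    (hℓ : ∀ d ∈ Finset.Icc 2 W, Real.log (α d / β d) ≤ ℓ)
    (φ : Fin n ≃ Fin K × Fin N) {a b : Fin K} (hab : a ≠ b) {M : ℕ} (hM : M ≤ N)
    {v : Fin K → Fin m → ℤˣ} (hm : 0 < ⌈γ * m⌉₊) (hD : hammingDist (v a) (v b) = ⌈γ * m⌉₊)
    (hfar : ∀ i j, i ≠ j → ⌈γ * m⌉₊ ≤ hammingDist (v i) (v j))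
    (hmulti : ∑ d ∈ Finset.Icc 2 W,
      2 * ((2 * M : ℕ) : ℝ) * ((n - 2).choose (d - 2) : ℝ) * α d ≤ 1 / 2)
    (ψ : Estimator n m W) :
    1 / 2 * (1 - 2 * (1 - ratingTail p θ ⌈γ * m⌉₊ * edgeTail W α β ℓ (N - M)) ^ M) / 3
      ≤ worstErr K W γ p θ α β ψ := by
  classical
  have hαβ' : ∀ d ∈ Finset.Icc 2 W, 0 ≤ β d ∧ β d < α d ∧ α d ≤ 1 := fun d hd => by
    obtain ⟨h1, h2, h3⟩ := hαβ d hd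
    exact ⟨h1.le, h2, by linarith⟩
  set S := criticalUsers φ a b M with hS
  have hSM : S.card = 2 * M := card_criticalUsers φ hab hM
  have hn : K * N = n := by
    have := Fintype.card_congr φ
    simpa using this.symm
  have hvab : v a ≠ v b := by
    intro h
    rw [h, hammingDist_self] at hD
    omega
  let β' := {X : Finset (Fin n) // X ⊆ S ∧ X.card = M}
  let G : β' → GroundTruth n m K γ := fun X =>
    { cluster := assign φ a b M X.1
      vec := v
      card_cluster := fun k => by rw [card_assign φ hab hM X.2.1 X.2.2, hn]
      minDist := by
        refine ⟨⟨a, b, hab, hD.symm⟩, ?_⟩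
        rintro d ⟨i, j, hij, rfl⟩
        exact hfar i j hij }
  obtain ⟨X₀, hX₀, hX₀M⟩ := Finset.exists_subset_card_eq (s := S) (n := M) (by omega)
  refine le_worstErr hp0 hp1 hθ0 (by linarith) hαβ' Finset.univ
    ⟨⟨X₀, hX₀, hX₀M⟩, Finset.mem_univ _⟩ G ?_ ?_ ψ
  · intro X _ X' _ h
    refine Subtype.ext (Finset.ext fun i => ?_)
    by_cases hiS : i ∈ S
    · have hj : v (assign φ a b M X.1 i) = v (assign φ a b M X'.1 i) :=
        funext fun j => congrFun h (i, j)
      simp only [assign, ← hS, hiS, if_true] at hj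
      by_cases h1 : i ∈ X.1 <;> by_cases h2 : i ∈ X'.1 <;>
        simp only [h1, h2, if_true, if_false] at hj ⊢
      · exact absurd hj hvab
      · exact absurd hj.symm hvab
    · exact ⟨fun h => absurd (X.2.1 h) hiS, fun h => absurd (X'.2.1 h) hiS⟩
  intro X _
  set c := assign φ a b M X.1 with hcdef
  set ρ := (G X).rating with hρ
  have hρi : ∀ i, ρ i = v (c i.1) i.2 := fun _ => rfl
  have hcS : ∀ s ∈ S, c s = if s ∈ X.1 then a else b := fun s hs => by
    simp only [hcdef, assign, ← hS, hs, if_true]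
  have hcnS : ∀ i, i ∉ S → c i = (φ i).1 := fun i hi => by
    simp only [hcdef, assign, ← hS, hi, if_false]
  have hcab : ∀ s ∈ S, c s = a ∨ c s = b := fun s hs => by
    rw [hcS s hs]; split_ifs <;> simp
  let tgt : Fin n → Fin K := fun s => Equiv.swap a b (c s)
  have hw : IsLaw fun i => entryProb p θ (ρ i) :=
    isLaw_entryProb hp0 hp1 hθ0 (by linarith) ρ
  have hw' : IsLaw fun h : PotentialEdge n W => bern (edgeProb α β c h) :=
    isLaw_bern (fun h => (edgeProb_mem hαβ' _ h).1) (fun h => (edgeProb_mem hαβ' _ h).2)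
  -- rows
  let moved : Fin n → Fin n × Fin m → ℤˣ := fun s i => if i.1 = s then v (tgt s) i.2 else ρ i
  let B : Fin n → Finset (Fin n × Fin m) := fun s => Finset.univ.filter fun i => i.1 = s
  let R : Fin n → (Fin n × Fin m → Option ℤˣ) → Prop := fun s x =>
    ∏ i ∈ B s, entryProb p θ (ρ i) (x i) ≤ ∏ i ∈ B s, entryProb p θ (moved s i) (x i)
  have hqR : ∀ s ∈ S, ratingTail p θ ⌈γ * m⌉₊
      ≤ prodProb (fun i => entryProb p θ (ρ i)) (R s) := by
    intro s hs
    refine (entry_chernoff_lower hp0 hp1 hθ0 hθ1 hpI ρ (moved s) ?_).trans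
      (prodProb_le_block hw ?_)
    · have hdist : hammingDist (v (c s)) (v (tgt s)) = ⌈γ * m⌉₊ := by
        rcases hcab s hs with h | h
        · simp only [tgt, h, Equiv.swap_apply_left, hD]
        · simp only [tgt, h, Equiv.swap_apply_right]
          rw [hammingDist_comm, hD]
      rw [← hdist, hammingDist]
      refine Finset.card_bij' (fun i _ => i.2) (fun j _ => (s, j)) ?_ ?_ ?_ ?_
      · intro i hi
        simp only [moved, Finset.mem_filter, Finset.mem_univ, true_and] at hi ⊢
        by_cases h : i.1 = s
        · simpa [h, hρi] using hi
        · simp [h] at hi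
      · intro j hj
        simpa [moved, hρi] using hj
      · intro i hi
        simp only [moved, Finset.mem_filter, Finset.mem_univ, true_and] at hi
        by_cases h : i.1 = s
        · rw [← h]
        · simp [h] at hi
      · intro j _; rfl
    · intro i hi
      have : i.1 ≠ s := by simpa [B] using hi
      simp [moved, this]
  have hR : ∀ s, DependsOn (R s) (B s : Set (Fin n × Fin m)) := fun s => dependsOn_block_le _ _ _
  have hBd : ∀ i s s', i ∈ (B s : Set (Fin n × Fin m)) → i ∈ (B s' : Set (Fin n × Fin m)) →
      s = s' := by
    intro i s s' h h'
    simp only [B, Finset.coe_filter, Finset.mem_univ, true_and, Set.mem_ofPred_eq] at h h'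
    exact h.symm.trans h'
  -- hyperedges
  let E : Fin n → Finset (PotentialEdge n W) := fun s => Finset.univ.filter fun h => h.1 ∩ S = {s}
  have hE : ∀ s h, h ∈ E s ↔ h.1 ∩ S = {s} := fun s h => by simp [E]
  let T : Fin n → (PotentialEdge n W → Bool) → Prop := fun s z =>
    ∏ h ∈ E s, bern (edgeProb α β c h) (z h)
      ≤ ∏ h ∈ E s, bern (edgeProb α β (Function.update c s (tgt s)) h) (z h)
  have hqT : ∀ s ∈ S, edgeTail W α β ℓ (N - M)
      ≤ prodProb (fun h : PotentialEdge n W => bern (edgeProb α β c h)) (T s) := by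
    intro s hs
    have hrem : ∀ k, k = a ∨ k = b →
        (Finset.univ.filter fun i => i ∉ S ∧ c i = k).card ≤ N - M := by
      intro k hk
      rw [← card_remaining φ hM hk]
      refine le_of_eq (congrArg _ (Finset.filter_congr fun i _ => and_congr_right fun hi => ?_))
      rw [hcnS i hi]
    refine edgeTail_le hαβ hℓ c (τ := (swapUser_involutive φ a b M).toPerm)
      (swapUser_involutive φ a b M) ?_ ?_ hs (hrem _ (hcab s hs))
      (hrem _ ((swap_eq_or a b _).2 (hcab s hs)))
    · intro i hi
      simp only [Function.Involutive.coe_toPerm, swapUser, ← hS, hi, if_true]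
    · intro i hi
      have h1 : swapUser φ a b M i ∉ S := by rwa [hS, swapUser_mem]
      rw [Function.Involutive.coe_toPerm, hcnS _ h1, hcnS i hi]
      simp only [swapUser, ← hS, hi, if_false, Equiv.apply_symm_apply]
  have hT : ∀ s, DependsOn (T s) (E s : Set (PotentialEdge n W)) :=
    fun s => dependsOn_block_le _ _ _
  have hEd : ∀ h s s', h ∈ (E s : Set (PotentialEdge n W)) →
      h ∈ (E s' : Set (PotentialEdge n W)) → s = s' := by
    intro h s s' h1 h2
    rw [Finset.mem_coe, hE] at h1 h2
    exact Finset.singleton_injective (h1.symm.trans h2)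
  set q := ratingTail p θ ⌈γ * m⌉₊ * edgeTail W α β ℓ (N - M) with hq
  -- Moving one user is favoured with probability at least `q`, since ratings and hyperedges are
  -- independent; different users have disjoint rows and disjoint sets of hyperedges with a single
  -- critical user.
  have hedge0 : 0 ≤ edgeTail W α β ℓ (N - M) := by unfold edgeTail; positivity
  have hex : ∀ Y : Finset (Fin n), Y ⊆ S → Y.card = M → 1 - (1 - q) ^ M
      ≤ prodExp (fun i => entryProb p θ (ρ i)) fun x =>
        prodProb (fun h : PotentialEdge n W => bern (edgeProb α β c h))
          fun z => ∃ s ∈ Y, R s x ∧ T s z := by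
    intro Y hYS hY
    rw [← hY]
    refine one_sub_pow_le_prodExp_exists hw hw' (fun s => (B s : Set (Fin n × Fin m))) hBd
      (fun s => (E s : Set (PotentialEdge n W))) hEd R T Y (fun s _ => hR s)
      (fun s _ => hT s) fun s hs => ?_
    exact mul_le_mul (hqR s (hYS hs)) (hqT s (hYS hs)) hedge0 (prodProb_nonneg hw _)
  have h2 := prodExp_prodProb_and hw hw' (fun x z => ∃ s ∈ X.1, R s x ∧ T s z)
    (fun x z => ∃ s ∈ S \ X.1, R s x ∧ T s z)
  have h3 := hex X.1 X.2.1 X.2.2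
  have h4 := hex (S \ X.1) Finset.sdiff_subset
    (by rw [Finset.card_sdiff_of_subset X.2.1, hSM, X.2.2]; omega)
  have hlow : 1 / 2 * (1 - 2 * (1 - q) ^ M) ≤ 1 / 2 * _ :=
    mul_le_mul_of_nonneg_left (le_trans (by linarith) h2) (by norm_num)
  refine hlow.trans ?_
  rw [← prodExp_const_mul]
  refine prodExp_mono hw fun x =>
    -- The events `T` read only hyperedges with exactly one critical user; all the others may be
    -- resampled without affecting the choice of `s` and `t`.
    mul_prodProb_le_of_resample hw' (fun h => (h.1 ∩ S).card = 1) fun z₁ hz₁ => ?_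
  obtain ⟨⟨s, hs, hRs, hTs⟩, ⟨t, ht, hRt, hTt⟩⟩ := hz₁
  rw [Finset.mem_sdiff] at ht
  have hsS : s ∈ S := X.2.1 hs
  have hst : s ≠ t := fun h => ht.2 (h ▸ hs)
  have hts : t ∉ X.1.erase s := fun h => ht.2 (Finset.mem_of_mem_erase h)
  let X' : β' := ⟨insert t (X.1.erase s), by
    constructor
    · intro j hj
      rcases Finset.mem_insert.1 hj with rfl | hj
      · exact ht.1
      · exact X.2.1 (Finset.mem_of_mem_erase hj)
    · rw [Finset.card_insert_of_notMem hts, Finset.card_erase_of_mem hs, X.2.2]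
      have : 0 < X.1.card := Finset.card_pos.2 ⟨s, hs⟩
      have := X.2.2
      omega⟩
  set c' := assign φ a b M X'.1 with hc'def
  have hc's : c' s = tgt s := by
    have h1 : c s = a := by rw [hcS s hsS, if_pos hs]
    simp only [tgt, h1, Equiv.swap_apply_left]
    simp [hc'def, assign, ← hS, hsS, X', hst]
  have hc't : c' t = tgt t := by
    have h1 : c t = b := by rw [hcS t ht.1, if_neg ht.2]
    simp only [tgt, h1, Equiv.swap_apply_right]
    simp [hc'def, assign, ← hS, ht.1, X']
  have hc'i : ∀ i, i ≠ s → i ≠ t → c' i = c i := by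
    intro i h1 h2
    simp [hc'def, hcdef, assign, X', h1, h2]
  -- Of the hyperedges outside `E s` and `E t`, only these can change probability when `s` and `t`
  -- are exchanged.
  let A : Finset (PotentialEdge n W) := Finset.univ.filter fun h =>
    (s ∈ h.1 ∨ t ∈ h.1) ∧ 2 ≤ (h.1 ∩ S).card
  have hA : ∑ h ∈ A, α h.1.card ≤ 1 / 2 := by
    refine le_trans (sum_multi_le S s t fun d hd => ?_) (le_trans (le_of_eq ?_) hmulti)
    · obtain ⟨h1, h2, -⟩ := hαβ d hd
      linarith
    · rw [hSM]
  have hmem : ∀ h : PotentialEdge n W, h.1.card ∈ Finset.Icc 2 W := fun h => Finset.mem_Icc.2 h.2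
  have heα : ∀ (c : Fin n → Fin K) (h : PotentialEdge n W), edgeProb α β c h ≤ α h.1.card := by
    intro c h
    obtain ⟨h1, h2, -⟩ := hαβ _ (hmem h)
    unfold edgeProb
    split_ifs <;> linarith
  have he0 : ∀ (c : Fin n → Fin K) (h : PotentialEdge n W), 0 ≤ edgeProb α β c h :=
    fun c h => (edgeProb_mem hαβ' c h).1
  have he1 : ∀ (c : Fin n → Fin K) (h : PotentialEdge n W), edgeProb α β c h ≤ 1 :=
    fun c h => (edgeProb_mem hαβ' c h).2
  have hhalf : 1 / 2 ≤ prodProb (fun h : PotentialEdge n W => bern (edgeProb α β c h))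
      fun z => ∀ h ∈ A, z h = false := by
    refine le_trans ?_ (one_sub_sum_le_prodProb_absent (he0 c) (he1 c) A)
    have := Finset.sum_le_sum fun h (_ : h ∈ A) => heα c h
    linarith
  refine hhalf.trans (prodProb_mono_of_pos hw' fun z₂ _ hz₂ => ?_)
  set z : PotentialEdge n W → Bool := fun h => if (h.1 ∩ S).card = 1 then z₁ h else z₂ h with hz
  have hzE : ∀ s, ∀ h ∈ (E s : Set (PotentialEdge n W)), z₁ h = z h := by
    intro s h hh
    rw [Finset.mem_coe, hE] at hh
    simp [hz, hh]
  have hzA : ∀ h ∈ A, z h = false := by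
    intro h hh
    have h1 : (h.1 ∩ S).card ≠ 1 := by
      have := (Finset.mem_filter.1 hh).2.2
      omega
    simp only [hz, h1, if_false]
    exact hz₂ h hh
  have hTs' : T s z := (hT s (hzE s)).mp hTs
  have hTt' : T t z := (hT t (hzE t)).mp hTt
  refine ⟨X', Finset.mem_univ _, ?_, ?_⟩
  · intro h
    have : t ∈ X'.1 := Finset.mem_insert_self _ _
    rw [h] at this
    exact ht.2 this
  have hrat : ∀ i, (G X').rating i = v (c' i.1) i.2 := fun _ => rfl
  have hle : ratingProb p θ ρ x ≤ ratingProb p θ (G X').rating x := by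
    rw [← one_mul (ratingProb p θ ρ x)]
    refine mul_prod_le_prod_of_blocks (B := B s) (C := B t)
      (w := fun i => entryProb p θ (ρ i)) (w' := fun i => entryProb p θ ((G X').rating i))
      hw.nonneg (fun i a => entryProb_nonneg hp0 hp1 hθ0 (by linarith) _ _) ?_ x ?_ ?_ ?_
    · rw [Finset.disjoint_left]
      intro i h h'
      exact hst (hBd i s t h h')
    · refine hRs.trans (le_of_eq (Finset.prod_congr rfl fun i hi => ?_))
      have : i.1 = s := by simpa [B] using hi
      simp only [moved, hrat, this, if_true, hc's]
    · refine hRt.trans (le_of_eq (Finset.prod_congr rfl fun i hi => ?_))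
      have : i.1 = t := by simpa [B] using hi
      simp only [moved, hrat, this, if_true, hc't]
    · rw [one_mul]
      refine le_of_eq (Finset.prod_congr rfl fun i hi => ?_)
      have : i.1 ≠ s ∧ i.1 ≠ t := by simpa [B] using hi
      rw [hrat, hρi, hc'i _ this.1 this.2]
  have hedge : 1 / 2 * hyperProb α β c z ≤ hyperProb α β c' z := by
    refine mul_prod_le_prod_of_blocks (B := E s) (C := E t)
      (w := fun h => bern (edgeProb α β c h)) (w' := fun h => bern (edgeProb α β c' h))
      hw'.nonneg (fun h => bern_nonneg (he0 c' h) (he1 c' h)) ?_ z ?_ ?_ ?_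
    · rw [Finset.disjoint_left]
      intro h h1 h2
      exact hst (hEd h s t h1 h2)
    · refine hTs'.trans (le_of_eq (Finset.prod_congr rfl fun h hh => ?_))
      rw [hE] at hh
      congr 1
      refine edgeProb_congr α β fun i hi => ?_
      by_cases h1 : i = s
      · rw [h1, hc's, Function.update_self]
      · have h2 : i ≠ t := by
          rintro rfl
          exact h1 (Finset.mem_singleton.1 (hh ▸ Finset.mem_inter.2 ⟨hi, ht.1⟩))
        rw [hc'i i h1 h2, Function.update_of_ne h1]
    · refine hTt'.trans (le_of_eq (Finset.prod_congr rfl fun h hh => ?_))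
      rw [hE] at hh
      congr 1
      refine edgeProb_congr α β fun i hi => ?_
      by_cases h1 : i = t
      · rw [h1, hc't, Function.update_self]
      · have h2 : i ≠ s := by
          rintro rfl
          exact h1 (Finset.mem_singleton.1 (hh ▸ Finset.mem_inter.2 ⟨hi, hsS⟩))
        rw [hc'i i h2 h1, Function.update_of_ne h1]
    -- Outside `A` the factors agree. On `A` every hyperedge is absent: the true factors are at most
    -- 1, and the rival product is at least one minus the sum of the `α`, hence at least 1/2.
    · rw [← Finset.prod_filter_mul_prod_filter_not (E s ∪ E t)ᶜ (· ∈ A),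
        ← Finset.prod_filter_mul_prod_filter_not (E s ∪ E t)ᶜ (· ∈ A)
          (fun h => bern (edgeProb α β c' h) (z h)), ← mul_assoc]
      have heq : ∏ h ∈ (E s ∪ E t)ᶜ.filter (¬ · ∈ A), bern (edgeProb α β c h) (z h)
          = ∏ h ∈ (E s ∪ E t)ᶜ.filter (¬ · ∈ A), bern (edgeProb α β c' h) (z h) := by
        refine Finset.prod_congr rfl fun h hh => ?_
        rw [Finset.mem_filter, Finset.mem_compl, Finset.mem_union, hE, hE] at hh
        obtain ⟨h1, h2⟩ := hh
        have hno : ∀ u, (u = s ∨ u = t) → u ∈ S → u ∉ h.1 := by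
          intro u hu huS huh
          have hmemu : u ∈ h.1 ∩ S := Finset.mem_inter.2 ⟨huh, huS⟩
          have hpos := Finset.card_pos.2 ⟨u, hmemu⟩
          have hlt : (h.1 ∩ S).card < 2 := by
            by_contra hge
            refine h2 (Finset.mem_filter.2 ⟨Finset.mem_univ _, ?_, not_lt.1 hge⟩)
            rcases hu with rfl | rfl
            exacts [Or.inl huh, Or.inr huh]
          have heq := (Finset.card_eq_one.1 (show (h.1 ∩ S).card = 1 by omega))
          obtain ⟨u', hu'⟩ := heq
          rw [hu', Finset.mem_singleton] at hmemu
          rw [← hmemu] at hu'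
          rcases hu with rfl | rfl
          exacts [h1 (Or.inl hu'), h1 (Or.inr hu')]
        congr 1
        refine edgeProb_congr α β fun i hi => (hc'i i ?_ ?_).symm
        · rintro rfl; exact hno i (Or.inl rfl) hsS hi
        · rintro rfl; exact hno i (Or.inr rfl) ht.1 hi
      rw [heq]
      refine mul_le_mul_of_nonneg_right ?_
        (Finset.prod_nonneg fun h _ => bern_nonneg (he0 c' h) (he1 c' h) _)
      have hle1 : ∏ h ∈ (E s ∪ E t)ᶜ.filter (· ∈ A), bern (edgeProb α β c h) (z h) ≤ 1 := by
        refine Finset.prod_le_one (fun h _ => bern_nonneg (he0 c h) (he1 c h) _) fun h hh => ?_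
        rw [hzA h (Finset.mem_filter.1 hh).2]
        simpa [bern] using he0 c h
      have hge : 1 / 2 ≤ ∏ h ∈ (E s ∪ E t)ᶜ.filter (· ∈ A), bern (edgeProb α β c' h) (z h) := by
        have h1 : ∏ h ∈ (E s ∪ E t)ᶜ.filter (· ∈ A), bern (edgeProb α β c' h) (z h)
            = ∏ h ∈ (E s ∪ E t)ᶜ.filter (· ∈ A), (1 - edgeProb α β c' h) :=
          Finset.prod_congr rfl fun h hh => by
            rw [hzA h (Finset.mem_filter.1 hh).2]; simp [bern]
        rw [h1]
        refine le_trans ?_ (one_sub_sum_le_prod_one_sub _ (fun h _ => he0 c' h)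
          fun h _ => he1 c' h)
        have h2 : ∑ h ∈ (E s ∪ E t)ᶜ.filter (· ∈ A), edgeProb α β c' h
            ≤ ∑ h ∈ A, α h.1.card :=
          (Finset.sum_le_sum fun h _ => heα c' h).trans
            (Finset.sum_le_sum_of_subset_of_nonneg (fun h hh => (Finset.mem_filter.1 hh).2)
              fun h _ _ => (he0 c h).trans (heα c h))
        linarith
      linarith
  have h0 : 0 ≤ hyperProb α β c z := hw'.prod_nonneg z
  have h0' : 0 ≤ ratingProb p θ ρ x := hw.prod_nonneg x
  calc 1 / 2 * (ratingProb p θ ρ x * hyperProb α β c z)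
      = ratingProb p θ ρ x * (1 / 2 * hyperProb α β c z) := by ring
    _ ≤ ratingProb p θ (G X').rating x * hyperProb α β c' z :=
        mul_le_mul hle hedge (by positivity) (h0'.trans hle)

end Users

-- Counting and growth estimates

/-- Compare falling factorials factor by factor, `(N - k) * K ≤ n - k`. This produces the weight
K^(d-1) in the denominators of the bound. -/
theorem choose_mul_pow_le {K N n : ℕ} (h : K * N ≤ n) (k : ℕ) :
    N.choose k * K ^ k ≤ n.choose k := by
  have key : ∀ k, N.descFactorial k * K ^ k ≤ n.descFactorial k := by
    intro k
    induction k with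
    | zero => simp
    | succ k ih =>
      rw [Nat.descFactorial_succ, Nat.descFactorial_succ, pow_succ]
      have h1 : (N - k) * K ≤ n - k := by
        rcases Nat.eq_zero_or_pos K with rfl | hK
        · simp
        · rw [Nat.sub_mul, mul_comm N]
          have : k ≤ k * K := Nat.le_mul_of_pos_right k hK
          omega
      calc (N - k) * N.descFactorial k * (K ^ k * K)
          = ((N - k) * K) * (N.descFactorial k * K ^ k) := by ring
        _ ≤ _ := Nat.mul_le_mul h1 ih
  have h2 := key k
  rw [Nat.descFactorial_eq_factorial_mul_choose, Nat.descFactorial_eq_factorial_mul_choose,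
    mul_assoc] at h2
  exact Nat.le_of_mul_le_mul_left h2 k.factorial_pos

/-- (1 - q)^M ≤ exp(-qM) ≤ exp(-1), and exp(-1) < 3/8. -/
theorem quarter_le_one_sub_pow {q : ℝ} {M : ℕ} (hq1 : q ≤ 1) (hqM : 1 ≤ q * M) :
    1 / 4 ≤ 1 - 2 * (1 - q) ^ M := by
  have h1 : (1 - q) ^ M ≤ Real.exp (-q) ^ M :=
    pow_le_pow_left₀ (by linarith) (by linarith [Real.add_one_le_exp (-q)]) M
  rw [← Real.exp_nat_mul] at h1
  have h2 : Real.exp (M * -q) ≤ Real.exp (-1) := Real.exp_le_exp.2 (by linarith)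
  have h3 := Real.exp_neg_one_lt_d9
  norm_num at h3
  linarith

theorem ratingTail_nonneg {p θ : ℝ} (hpI : p * quality (1 - θ) θ ≤ 1 / 2) (N : ℕ) :
    0 ≤ ratingTail p θ N := by
  have : 0 ≤ 1 - p * quality (1 - θ) θ := by linarith
  unfold ratingTail
  positivity

theorem ratingTail_le_one {p θ : ℝ} (hp0 : 0 ≤ p) (hpI : p * quality (1 - θ) θ ≤ 1 / 2) (N : ℕ) :
    ratingTail p θ N ≤ 1 := by
  have h0 : 0 ≤ p * quality (1 - θ) θ := mul_nonneg hp0 (sq_nonneg _)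
  have h1 : (1 - p * quality (1 - θ) θ) ^ N ≤ 1 := pow_le_one₀ (by linarith) (by linarith)
  have h2 : Real.exp (-(√(2 * (1 + 4 * ratingVar θ * (N * p))) / 2)) ≤ 1 := by
    rw [Real.exp_le_one_iff, neg_nonpos]; positivity
  have h3 : 0 ≤ (1 - p * quality (1 - θ) θ) ^ N := pow_nonneg (by linarith) _
  unfold ratingTail
  have := mul_le_one₀ h2 h3 h1
  linarith

theorem edgeTail_nonneg (W : ℕ) (α β : ℕ → ℝ) (ℓ : ℝ) (N : ℕ) : 0 ≤ edgeTail W α β ℓ N := by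
  unfold edgeTail; positivity

theorem edgeTail_le_one {W : ℕ} {α β : ℕ → ℝ} {ℓ : ℝ} (N : ℕ) : edgeTail W α β ℓ N ≤ 1 := by
  unfold edgeTail
  have h1 : Real.exp (-(√(2 * (1 + ∑ d ∈ Finset.Icc 2 W,
      2 * (N.choose (d - 1) : ℝ) * (2 * (α d * (ℓ ^ 2 + 2))))) / 2)) ≤ 1 := by
    rw [Real.exp_le_one_iff, neg_nonpos]; positivity
  have h2 : Real.exp (-∑ d ∈ Finset.Icc 2 W,
      2 * (N.choose (d - 1) : ℝ) * (quality (α d) (β d) / 2 + 3 * α d ^ 2)) ≤ 1 := by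
    rw [Real.exp_le_one_iff, neg_nonpos]
    refine Finset.sum_nonneg fun d _ => ?_
    have : 0 ≤ quality (α d) (β d) := sq_nonneg _
    positivity
  have := mul_le_one₀ h1 (Real.exp_pos _).le h2
  linarith

theorem exp_neg_log_four : Real.exp (-Real.log 4) = 1 / 4 := by
  rw [Real.exp_neg, Real.exp_log (by norm_num)]; norm_num

theorem exp_le_ratingTail {p θ B : ℝ} {N : ℕ} (hp0 : 0 ≤ p)
    (hpI : p * quality (1 - θ) θ ≤ 1 / 2) (hB : N * p ≤ B) :
    Real.exp (-(Real.log 4 + √(2 * (1 + 4 * ratingVar θ * B)) / 2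
        + N * (p * quality (1 - θ) θ) * (1 + 2 * (p * quality (1 - θ) θ))))
      ≤ ratingTail p θ N := by
  have h0 : 0 ≤ p * quality (1 - θ) θ := mul_nonneg hp0 (sq_nonneg _)
  have hV := ratingVar_nonneg θ
  set x := p * quality (1 - θ) θ with hx
  have h1 : Real.exp (-(N * x * (1 + 2 * x))) ≤ (1 - x) ^ N := by
    calc Real.exp (-(N * x * (1 + 2 * x))) = Real.exp (-(x + 2 * x ^ 2)) ^ N := by
          rw [← Real.exp_nat_mul]; congr 1; ring
      _ ≤ _ := pow_le_pow_left₀ (Real.exp_pos _).le (exp_le_one_sub h0 hpI) N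
  have h2 : Real.exp (-(√(2 * (1 + 4 * ratingVar θ * B)) / 2))
      ≤ Real.exp (-(√(2 * (1 + 4 * ratingVar θ * (N * p))) / 2)) := by gcongr
  rw [ratingTail, neg_add, neg_add, Real.exp_add, Real.exp_add, exp_neg_log_four]
  exact mul_le_mul (by linarith) h1 (Real.exp_pos _).le (by positivity)

theorem exp_le_edgeTail {W : ℕ} {α β : ℕ → ℝ} {ℓ B E : ℝ} {N : ℕ}
    (hB : ∑ d ∈ Finset.Icc 2 W, (N.choose (d - 1) : ℝ) * α d ≤ B)
    (hE : ∑ d ∈ Finset.Icc 2 W,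
      2 * (N.choose (d - 1) : ℝ) * (quality (α d) (β d) / 2 + 3 * α d ^ 2) ≤ E) :
    Real.exp (-(Real.log 4 + √(2 * (1 + 4 * (ℓ ^ 2 + 2) * B)) / 2 + E))
      ≤ edgeTail W α β ℓ N := by
  have h1 : ∑ d ∈ Finset.Icc 2 W, 2 * (N.choose (d - 1) : ℝ) * (2 * (α d * (ℓ ^ 2 + 2)))
      ≤ 4 * (ℓ ^ 2 + 2) * B := by
    refine le_trans (le_of_eq ?_) (mul_le_mul_of_nonneg_left hB (by positivity))
    rw [Finset.mul_sum]
    exact Finset.sum_congr rfl fun d _ => by ring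
  rw [edgeTail, neg_add, neg_add, Real.exp_add, Real.exp_add, exp_neg_log_four]
  gcongr

/-- √u ≤ su + 1/(4s) for every s > 0; the choice of `s` makes the linear coefficient `s * b` at most
`c`, and the halving leaves room for the constants. -/
theorem eventually_sqrt_add_le {a b c C : ℝ} (hb : 0 ≤ b) (hc : 0 < c) :
    ∀ᶠ L : ℝ in atTop, √(a + b * L) / 2 + C ≤ c * L := by
  set s := c / (b + 1) with hs
  have hs0 : 0 < s := by positivity
  have hsb : s * b ≤ c := by
    rw [hs, div_mul_eq_mul_div, div_le_iff₀ (by positivity)]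
    nlinarith
  filter_upwards [eventually_ge_atTop ((s * |a| + (4 * s)⁻¹ + 2 * C) / c), eventually_ge_atTop 0]
    with L hL hL0
  rw [div_le_iff₀ hc] at hL
  have h1 : √(a + b * L) ≤ √(|a| + b * L) := Real.sqrt_le_sqrt (by linarith [le_abs_self a])
  have h2 : √(|a| + b * L) ≤ s * (|a| + b * L) + (4 * s)⁻¹ := by
    have hy := Real.sq_sqrt (show 0 ≤ |a| + b * L by positivity)
    set r := √(|a| + b * L)
    rw [← hy]
    have h3 : (4 * s)⁻¹ * (4 * s) = 1 := inv_mul_cancel₀ (by positivity)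
    have h4 : 0 ≤ (4 * s)⁻¹ * (2 * s * r - 1) ^ 2 := by positivity
    have h5 : (4 * s)⁻¹ * (2 * s * r - 1) ^ 2 = s * r ^ 2 - r + (4 * s)⁻¹ := by
      field_simp
      ring
    linarith
  have h3 : s * (b * L) ≤ c * L := by
    rw [← mul_assoc]; gcongr
  nlinarith

theorem sampleBound_anti {n m K W : ℕ} {γ θ ε ε' : ℝ} (hγ : 0 ≤ γ) {α β : ℕ → ℝ}
    (h : ε' ≤ ε) : sampleBound n m K W γ θ ε α β ≤ sampleBound n m K W γ θ ε' α β := by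
  have hq : 0 ≤ quality (1 - θ) θ := sq_nonneg _
  have hn : 0 ≤ Real.log n := Real.log_natCast_nonneg n
  have hm : 0 ≤ Real.log m := Real.log_natCast_nonneg m
  unfold sampleBound
  gcongr

theorem exists_uniform_bound {D : Finset ℕ} {f g : ℕ → ℕ → ℝ}
    (h : ∀ d ∈ D, (fun t => f t d) =O[atTop] (fun t => g t d)) :
    ∃ A : ℝ, 1 ≤ A ∧ ∀ᶠ t in atTop, ∀ d ∈ D, ‖f t d‖ ≤ A * ‖g t d‖ := by
  have h' : ∀ d, ∃ c : ℝ, 0 < c ∧ (d ∈ D → ∀ᶠ t in atTop, ‖f t d‖ ≤ c * ‖g t d‖) := by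
    intro d
    by_cases hd : d ∈ D
    · obtain ⟨c, hc, hb⟩ := (h d hd).exists_pos
      exact ⟨c, hc, fun _ => hb.bound⟩
    · exact ⟨1, one_pos, fun h => absurd h hd⟩
  choose c hc hb using h'
  have hsum : ∀ d ∈ D, c d ≤ ∑ d ∈ D, c d := fun d hd =>
    Finset.single_le_sum (fun d _ => (hc d).le) hd
  -- The sum dominates every constant of the finite family, and the summand 1 makes the bound at
  -- least 1.
  refine ⟨1 + ∑ d ∈ D, c d, le_add_of_nonneg_right (Finset.sum_nonneg fun d _ => (hc d).le), ?_⟩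
  rw [Filter.eventually_all_finset]
  intro d hd
  filter_upwards [hb d hd] with t ht
  refine ht.trans (mul_le_mul_of_nonneg_right ?_ (norm_nonneg _))
  linarith [hsum d hd]

theorem exists_cluster_equiv {n K N : ℕ} (h : K * N = n) : Nonempty (Fin n ≃ Fin K × Fin N) :=
  ⟨(finCongr h.symm).trans finProdFinEquiv.symm⟩

-- The logarithm-of-m term of the bound

section Asymptotics

variable {K W : ℕ} {γ θ ε : ℝ} {n m : ℕ → ℕ} {α β : ℕ → ℕ → ℝ} {p : ℕ → ℝ}

theorem eventually_le_worstErr_of_columns (hK : 2 ≤ K) (hγ_pos : 0 < γ)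
    (hγ_lt : γ * (K.choose 2 : ℝ) < ((K ^ 2 / 4 : ℕ) : ℝ)) (hθ0 : 0 ≤ θ) (hθ1 : θ < 1 / 2)
    (hn : Tendsto n atTop atTop) (hKn : ∀ t, K ∣ n t) (hm : Tendsto m atTop atTop)
    (hαβ : ∀ t, ∀ d ∈ Finset.Icc 2 W, 0 ≤ β t d ∧ β t d < α t d ∧ α t d ≤ 1)
    (hp : ∀ t, 0 ≤ p t ∧ p t ≤ 1) (hp_zero : Tendsto p atTop (𝓝 0))
    (hε0 : 0 < ε) (hε1 : ε ≤ 1 / 2) (ψ : ∀ t, Estimator (n t) (m t) W) :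
    ∀ᶠ t in atTop, p t ≤ (1 - ε) * K * Real.log (m t) / (quality (1 - θ) θ * n t) →
      1 / 24 ≤ worstErr K W γ (p t) θ (α t) (β t) (ψ t) := by
  obtain ⟨η, hη, hvec⟩ := exists_ratingVectors hK hγ_pos hγ_lt
  have hI := quality_pos_of_lt_half hθ0 hθ1
  set I := quality (1 - θ) θ with hIdef
  have hV := ratingVar_nonneg θ
  have hlogm : Tendsto (fun t => Real.log (m t)) atTop atTop :=
    Real.tendsto_log_atTop.comp (tendsto_natCast_atTop_atTop.comp hm)
  have hpI : Tendsto (fun t => p t * I) atTop (𝓝 0) := by simpa using hp_zero.mul_const I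
  have hsqrt := hlogm.eventually (eventually_sqrt_add_le (a := 2) (b := 8 * ratingVar θ / I)
    (c := ε / 2) (C := Real.log 4 - Real.log (η / 4)) (by positivity) (by positivity))
  have hmbig : ∀ᶠ t in atTop, 4 / η ≤ (m t : ℝ) :=
    (tendsto_natCast_atTop_atTop.comp hm).eventually_ge_atTop _
  filter_upwards [hm.eventually hvec, hsqrt, hmbig, hm.eventually_ge_atTop 1,
    hn.eventually_ge_atTop 1, hpI.eventually_le_const (show 0 < ε / 8 by positivity)]
    with t ⟨v, a, b, hab, hD, hfar, hη1, hη2⟩ hs hm4 hm1 hn1 hpt hbound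
  obtain ⟨N, hN⟩ := hKn t
  have hNpos : 0 < N := by
    rcases Nat.eq_zero_or_pos N with rfl | h
    · omega
    · exact h
  obtain ⟨φ⟩ := exists_cluster_equiv hN.symm
  have hm0 : (0 : ℝ) < m t := by exact_mod_cast hm1
  -- The twist needs a margin of `2 * M`, and the margin available is `η * m`.
  set M := ⌊η / 2 * m t⌋₊ with hM
  have hMle : (M : ℝ) ≤ η / 2 * m t := Nat.floor_le (by positivity)
  have hMge : η / 4 * m t ≤ M := by
    have := Nat.lt_floor_add_one (η / 2 * m t)
    rw [div_le_iff₀ hη] at hm4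
    rw [← hM] at this
    linarith
  have hηm : 0 ≤ η * m t := by positivity
  have hpt2 : p t * I ≤ 1 / 2 := by linarith
  have hmain := le_worstErr_of_columns (W := W) (γ := γ) (hp t).1 (hp t).2 hθ0 hθ1 hpt2 (hαβ t)
    (fun i => (φ i).1) hNpos hN.symm
    (fun k => by simpa using card_cluster_filter φ k (fun _ => True)) hab (M := M) hD
    (fun i j hij h1 h2 => by
      have h3 := hfar i j hij h1 h2
      have : ((⌈γ * m t⌉₊ + 2 * M : ℕ) : ℝ) ≤ hammingDist (v i) (v j) := by
        push_cast; linarith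
      exact_mod_cast this)
    (by
      have : (M : ℝ) ≤ ⌈γ * m t⌉₊ := by linarith
      exact_mod_cast this)
    (by
      have : ((⌈γ * m t⌉₊ + M : ℕ) : ℝ) ≤ m t := by push_cast; linarith
      exact_mod_cast this) (ψ t)
  refine le_trans ?_ hmain
  have hNp : N * (p t * I) ≤ (1 - ε) * Real.log (m t) := by
    have hN0 : (0 : ℝ) < N := by exact_mod_cast hNpos
    have hK0 : (0 : ℝ) < K := by exact_mod_cast (show 0 < K by omega)
    have hnt : (n t : ℝ) = K * N := by rw [hN]; push_cast; ring
    rw [hnt, le_div_iff₀ (by positivity)] at hbound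
    refine le_of_mul_le_mul_left (a := (K : ℝ)) ?_ hK0
    linarith
  have hL0 : 0 ≤ Real.log (m t) := Real.log_natCast_nonneg _
  have hB : N * p t ≤ Real.log (m t) / I := by
    rw [le_div_iff₀ hI]
    nlinarith
  have hq := exp_le_ratingTail (θ := θ) (hp t).1 hpt2 hB
  -- Since M ≥ (η/4)m, the exponent to beat is log m + log(η/4). The main term uses at most (1 -
  -- ε/2) log m, and the fluctuation term together with the constants at most (ε/2) log m.
  have hqM : 1 ≤ ratingTail (p t) θ N * M := by
    have hMexp : Real.exp (Real.log (η / 4) + Real.log (m t)) ≤ M := by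
      rw [Real.exp_add, Real.exp_log (by positivity), Real.exp_log hm0]
      exact hMge
    refine le_trans ?_ (mul_le_mul hq hMexp (Real.exp_pos _).le
      (ratingTail_nonneg hpt2 N))
    rw [← Real.exp_add, Real.one_le_exp_iff]
    have h1 : 2 * (1 + 4 * ratingVar θ * (Real.log (m t) / I))
        = 2 + 8 * ratingVar θ / I * Real.log (m t) := by ring
    rw [h1]
    have hpI0 : 0 ≤ p t * I := mul_nonneg (hp t).1 hI.le
    have h2 : N * (p t * I) * (1 + 2 * (p t * I)) ≤ (1 - ε) * Real.log (m t) * (1 + ε / 4) :=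
      mul_le_mul hNp (by linarith) (by linarith) (mul_nonneg (by linarith) hL0)
    have h3 : (1 - ε) * Real.log (m t) * (1 + ε / 4) ≤ (1 - ε / 2) * Real.log (m t) := by
      nlinarith [mul_nonneg hε0.le hL0, mul_nonneg (sq_nonneg ε) hL0]
    linarith
  have := quarter_le_one_sub_pow (ratingTail_le_one (hp t).1 hpt2 N) hqM
  linarith

end Asymptotics

/-- With L = log n this makes (log n) / n^δ small, the form in which hyperedge densities and shares
of critical users appear. -/
theorem eventually_mul_exp_neg_le {c δ : ℝ} (hc : 0 < c) (hδ : 0 < δ) :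
    ∀ᶠ L : ℝ in atTop, L * Real.exp (-(δ * L)) ≤ c := by
  have h := ((Real.tendsto_pow_mul_exp_neg_atTop_nhds_zero 1).comp
    (tendsto_id.const_mul_atTop hδ)).eventually_le_const (show 0 < δ * c by positivity)
  filter_upwards [h] with L hL
  simp only [Function.comp_apply, id, pow_one] at hL
  rw [mul_assoc] at hL
  exact le_of_mul_le_mul_left hL hδ

theorem choose_sub_two_mul {n d : ℕ} (hn : 2 ≤ n) (hd : 2 ≤ d) :
    (n - 1) * (n - 2).choose (d - 2) = (n - 1).choose (d - 1) * (d - 1) := by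
  have := Nat.add_one_mul_choose_eq (n - 2) (d - 2)
  rwa [show n - 2 + 1 = n - 1 by omega, show d - 2 + 1 = d - 1 by omega] at this

-- The logarithm-of-n term of the bound

section Asymptotics

variable {K W : ℕ} {γ θ ε : ℝ} {n m : ℕ → ℕ} {α β : ℕ → ℕ → ℝ} {p : ℕ → ℝ}

set_option maxHeartbeats 1600000 in
theorem eventually_le_worstErr_of_users (hK : 2 ≤ K) (hγ_pos : 0 < γ)
    (hγ_lt : γ * (K.choose 2 : ℝ) < ((K ^ 2 / 4 : ℕ) : ℝ)) (hθ0 : 0 ≤ θ) (hθ1 : θ < 1 / 2)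
    (hn : Tendsto n atTop atTop) (hKn : ∀ t, K ∣ n t) (hm : Tendsto m atTop atTop)
    (hαβ : ∀ t, ∀ d ∈ Finset.Icc 2 W, 0 ≤ β t d ∧ β t d < α t d ∧ α t d ≤ 1)
    (hα : ∀ d ∈ Finset.Icc 2 W, (fun t => α t d) =O[atTop]
      (fun t => Real.log (n t) / ((n t - 1).choose (d - 1) : ℝ)))
    (hαβ_O : ∀ d ∈ Finset.Icc 2 W, (fun t => α t d) =O[atTop] (fun t => β t d))
    (hp : ∀ t, 0 ≤ p t ∧ p t ≤ 1) (hp_zero : Tendsto p atTop (𝓝 0))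
    (hε0 : 0 < ε) (hε1 : ε ≤ 1 / 2) (ψ : ∀ t, Estimator (n t) (m t) W) :
    ∀ᶠ t in atTop, p t ≤ ((1 - ε) * Real.log (n t) -
        ∑ d ∈ Finset.Icc 2 W,
          ((n t - 1).choose (d - 1) : ℝ) / (K : ℝ) ^ (d - 1) * quality (α t d) (β t d)) /
      (quality (1 - θ) θ * γ * m t) →
      1 / 24 ≤ worstErr K W γ (p t) θ (α t) (β t) (ψ t) := by
  obtain ⟨η, hη, hvec⟩ := exists_ratingVectors hK hγ_pos hγ_lt
  obtain ⟨A, hA1, hA⟩ := exists_uniform_bound hα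
  obtain ⟨A', hA'1, hA'⟩ := exists_uniform_bound hαβ_O
  have hI := quality_pos_of_lt_half hθ0 hθ1
  set I := quality (1 - θ) θ with hIdef
  have hV := ratingVar_nonneg θ
  set ℓ := Real.log A' with hℓ
  have hlogn : Tendsto (fun t => Real.log (n t)) atTop atTop :=
    Real.tendsto_log_atTop.comp (tendsto_natCast_atTop_atTop.comp hn)
  have hpI : Tendsto (fun t => p t * I) atTop (𝓝 0) := by simpa using hp_zero.mul_const I
  have hK0 : (0 : ℝ) < K := by exact_mod_cast (show 0 < K by omega)
  have hK1 : (1 : ℝ) ≤ K := by exact_mod_cast (show 1 ≤ K by omega)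
  -- `w` bounds both the number of hyperedge sizes and each `d - 1`.
  set w : ℝ := W + 1 with hw
  have hw1 : 1 ≤ w := by simp [hw]
  have hs1 := hlogn.eventually (eventually_sqrt_add_le (a := 2 + 8 * ratingVar θ)
    (b := 8 * ratingVar θ / I) (c := ε / 4) (C := Real.log 4 + 1) (by positivity) (by positivity))
  have hs2 := hlogn.eventually (eventually_sqrt_add_le (a := 2)
    (b := 8 * (ℓ ^ 2 + 2) * (w * A)) (c := ε / 4) (C := Real.log 4) (by positivity) (by positivity))
  -- The constants are fitted to later needs: `he1` makes the second-order hyperedge terms at most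
  -- (ε/8) log n, `he2` gives `M ≤ N` and the sparsity of hyperedges with several critical users.
  have he1 := hlogn.eventually (eventually_mul_exp_neg_le (c := ε / (96 * w ^ 2 * A ^ 2)) (δ := 1)
    (by positivity) one_pos)
  have he2 := hlogn.eventually (eventually_mul_exp_neg_le (c := 1 / (32 * w ^ 2 * A * K))
    (δ := ε / 4) (by positivity) (by positivity))
  filter_upwards [hm.eventually hvec, hA, hA', hs1, hs2, he1, he2, hm.eventually_ge_atTop 1,
    hn.eventually_ge_atTop 2, hn.eventually_ge_atTop W, hlogn.eventually_ge_atTop 1,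
    hpI.eventually_le_const (show 0 < ε / 16 by positivity)]
    with t ⟨v, a, b, hab, hD, hfar, _, _⟩ hAt hA't hs1 hs2 he1 he2 hm1 hn2 hnW hL1 hpt hbound
  obtain ⟨N, hN⟩ := hKn t
  obtain ⟨φ⟩ := exists_cluster_equiv hN.symm
  set L := Real.log (n t) with hL
  have hn0 : (0 : ℝ) < n t := by exact_mod_cast (show 0 < n t by omega)
  have hm0 : (0 : ℝ) < m t := by exact_mod_cast hm1
  have hexpL : Real.exp L = n t := Real.exp_log hn0
  have hn2' : (2 : ℝ) ≤ n t := by exact_mod_cast hn2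
  have hcard : ((Finset.Icc 2 W).card : ℝ) ≤ w := by
    rw [Nat.card_Icc, hw]
    exact_mod_cast (show W + 1 - 2 ≤ W + 1 by omega)
  -- sizes of the hyperedge probabilities
  set C : ℕ → ℝ := fun d => ((n t - 1).choose (d - 1) : ℝ) with hC
  have hCpos : ∀ d ∈ Finset.Icc 2 W, 0 < C d := fun d hd => by
    have := Finset.mem_Icc.1 hd
    exact Nat.cast_pos.2 (Nat.choose_pos (show d - 1 ≤ n t - 1 by omega))
  have hα0 : ∀ d ∈ Finset.Icc 2 W, 0 < α t d := fun d hd =>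
    (hαβ t d hd).1.trans_lt (hαβ t d hd).2.1
  have hCα : ∀ d ∈ Finset.Icc 2 W, C d * α t d ≤ A * L := by
    intro d hd
    have h1 := hAt d hd
    rw [Real.norm_of_nonneg (hα0 d hd).le, Real.norm_of_nonneg
      (div_nonneg (by linarith) (hCpos d hd).le), ← mul_div_assoc, le_div_iff₀ (hCpos d hd)] at h1
    linarith
  -- A common bound of order log n / n for `α t d` and for the expected number of hyperedges through
  -- two given users.
  set r : ℝ := 2 * A * w * (L * Real.exp (-L)) with hr
  have hrn : r = 2 * A * w * L / n t := by
    rw [hr, Real.exp_neg, hexpL]; ring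
  have hC2α : ∀ d ∈ Finset.Icc 2 W, ((n t - 2).choose (d - 2) : ℝ) * α t d ≤ r := by
    intro d hd
    have hd' := Finset.mem_Icc.1 hd
    have h1 : ((n t : ℝ) - 1) * ((n t - 2).choose (d - 2) : ℝ) = C d * ((d - 1 : ℕ) : ℝ) := by
      have := choose_sub_two_mul hn2 hd'.1
      have h2 : ((n t - 1 : ℕ) : ℝ) = (n t : ℝ) - 1 := by
        rw [Nat.cast_sub (by omega), Nat.cast_one]
      rw [← h2]
      simp only [hC]
      exact_mod_cast this
    have h2 : ((d - 1 : ℕ) : ℝ) ≤ w := by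
      rw [hw]; exact_mod_cast (show d - 1 ≤ W + 1 by omega)
    have h3 : ((n t : ℝ) - 1) * (((n t - 2).choose (d - 2) : ℝ) * α t d) ≤ A * L * w := by
      calc _ = C d * α t d * ((d - 1 : ℕ) : ℝ) := by rw [← mul_assoc, h1]; ring
        _ ≤ A * L * w := mul_le_mul (hCα d hd) h2 (Nat.cast_nonneg _) (by positivity)
    have h4 : 0 ≤ ((n t - 2).choose (d - 2) : ℝ) * α t d :=
      mul_nonneg (Nat.cast_nonneg _) (hα0 d hd).le
    have h5 := mul_nonneg (sub_nonneg.2 hn2') h4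
    rw [hrn, le_div_iff₀ hn0]
    linarith
  have hαr : ∀ d ∈ Finset.Icc 2 W, α t d ≤ r := by
    intro d hd
    have hd' := Finset.mem_Icc.1 hd
    refine le_trans ?_ (hC2α d hd)
    refine le_mul_of_one_le_left (hα0 d hd).le ?_
    exact_mod_cast Nat.choose_pos (show d - 2 ≤ n t - 2 by omega)
  have hr1 : 6 * (w * (A * r)) ≤ ε / 8 := by
    rw [one_mul, le_div_iff₀ (by positivity)] at he1
    rw [hr]
    linarith
  have hr2 : r ≤ 1 / 2 := by
    have hr0 : 0 ≤ r := by rw [hr]; positivity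
    have h1 : r ≤ w * A * r :=
      le_mul_of_one_le_left hr0 (one_le_mul_of_one_le_of_one_le hw1 hA1)
    rw [mul_assoc] at h1
    linarith
  have hαβ' : ∀ d ∈ Finset.Icc 2 W, 0 < β t d ∧ β t d < α t d ∧ α t d ≤ 1 / 2 := by
    intro d hd
    -- Positivity of `β` comes from α = O(β) and α > 0.
    refine ⟨?_, (hαβ t d hd).2.1, (hαr d hd).trans hr2⟩
    have h1 := hA't d hd
    rw [Real.norm_of_nonneg (hα0 d hd).le, Real.norm_of_nonneg (hαβ t d hd).1] at h1
    exact pos_of_mul_pos_right ((hα0 d hd).trans_le h1) (by linarith)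
  have hlog : ∀ d ∈ Finset.Icc 2 W, Real.log (α t d / β t d) ≤ ℓ := by
    intro d hd
    have h1 := hA't d hd
    have hβ := (hαβ' d hd).1
    rw [Real.norm_of_nonneg (hα0 d hd).le, Real.norm_of_nonneg hβ.le] at h1
    exact Real.log_le_log (div_pos (hα0 d hd) hβ) ((div_le_iff₀ hβ).2 h1)
  -- the number of critical users
  set y : ℝ := Real.exp ((1 - ε / 4) * L) with hy
  have hyn : y = n t * Real.exp (-(ε / 4 * L)) := by
    rw [← hexpL, ← Real.exp_add, hy]; congr 1; ring
  have hy1 : 1 ≤ y := Real.one_le_exp (mul_nonneg (by linarith) (by linarith))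
  -- M is n^(1-ε/4) rounded up: it costs only (ε/4) log n in the exponent, while M log n / n still
  -- tends to 0.
  set M := ⌈y⌉₊ with hM
  have hMy : y ≤ M := Nat.le_ceil y
  have hM2 : (M : ℝ) ≤ 2 * y := by
    have := Nat.ceil_lt_add_one (show 0 ≤ y by linarith)
    linarith
  have hM1 : 1 ≤ M := Nat.one_le_iff_ne_zero.2 fun h => by
    rw [h, Nat.cast_zero] at hMy; linarith
  have hexp0 : 0 < Real.exp (-(ε / 4 * L)) := Real.exp_pos _
  rw [le_div_iff₀ (by positivity)] at he2
  have hwA : 1 ≤ w ^ 2 * A := one_le_mul_of_one_le_of_one_le (one_le_pow₀ hw1) hA1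
  have hMN : M ≤ N := by
    have h1 : (K : ℝ) * M ≤ K * N := by
      have h2 : (K : ℝ) * N = n t := by rw [hN]; push_cast; ring
      rw [h2]
      calc (K : ℝ) * M ≤ K * (2 * y) := by gcongr
        _ = n t * (2 * K * Real.exp (-(ε / 4 * L))) := by rw [hyn]; ring
        _ ≤ n t * 1 := by
            gcongr
            have h3 : 2 * (K * Real.exp (-(ε / 4 * L)))
                ≤ 32 * (w ^ 2 * A) * (L * (K * Real.exp (-(ε / 4 * L)))) := by
              have h4 : 0 ≤ K * Real.exp (-(ε / 4 * L)) := by positivity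
              have h5 : K * Real.exp (-(ε / 4 * L)) ≤ L * (K * Real.exp (-(ε / 4 * L))) :=
                le_mul_of_one_le_left h4 hL1
              have h6 := le_mul_of_one_le_left (h4.trans h5) hwA
              linarith
            linarith
        _ = n t := mul_one _
    exact_mod_cast le_of_mul_le_mul_left h1 hK0
  have hmulti : ∑ d ∈ Finset.Icc 2 W,
      2 * ((2 * M : ℕ) : ℝ) * ((n t - 2).choose (d - 2) : ℝ) * α t d ≤ 1 / 2 := by
    have hr0 : 0 ≤ r := by rw [hr]; positivity
    calc _ ≤ ∑ _d ∈ Finset.Icc 2 W, 8 * y * r := by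
          refine Finset.sum_le_sum fun d hd => ?_
          have h1 := hC2α d hd
          have h0 : 0 ≤ ((n t - 2).choose (d - 2) : ℝ) * α t d :=
            mul_nonneg (Nat.cast_nonneg _) (hα0 d hd).le
          push_cast
          rw [mul_assoc]
          refine mul_le_mul (by linarith) h1 h0 (by linarith)
      _ = (Finset.Icc 2 W).card * (8 * y * r) := by rw [Finset.sum_const, nsmul_eq_mul]
      _ ≤ w * (8 * y * r) := by gcongr
      _ = 16 * w ^ 2 * A * (L * Real.exp (-(ε / 4 * L))) := by
          rw [hrn, hyn]; field_simp; ring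
      _ ≤ 1 / 2 := by
          have h1 : 16 * w ^ 2 * A * (L * Real.exp (-(ε / 4 * L)))
              ≤ 16 * w ^ 2 * A * (L * Real.exp (-(ε / 4 * L))) * K :=
            le_mul_of_one_le_right (by positivity) hK1
          linarith
  have hDpos : 0 < ⌈γ * m t⌉₊ := Nat.ceil_pos.2 (by positivity)
  have hpt2 : p t * I ≤ 1 / 2 := by linarith
  have hmain := le_worstErr_of_users (W := W) (hp t).1 (hp t).2 hθ0 hθ1 hpt2 hαβ' hlog φ hab hMN
    hDpos hD (fun i j hij => by
      by_cases h1 : i = a ∧ j = b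
      · rw [h1.1, h1.2, hD]
      by_cases h2 : i = b ∧ j = a
      · rw [h2.1, h2.2, hammingDist_comm, hD]
      have h3 := hfar i j hij h1 h2
      have : ((⌈γ * m t⌉₊ : ℕ) : ℝ) ≤ hammingDist (v i) (v j) := by
        have : 0 ≤ η * m t := by positivity
        linarith
      exact_mod_cast this) hmulti (ψ t)
  refine le_trans ?_ hmain
  -- the exponents
  have hKN : K * (N - M) ≤ n t - 1 := by
    have h1 : K * 1 ≤ K * M := Nat.mul_le_mul_left K hM1
    rw [Nat.mul_sub, ← hN]
    omega
  have hchoose : ∀ d, ((N - M).choose (d - 1) : ℝ) ≤ C d / (K : ℝ) ^ (d - 1) := by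
    intro d
    rw [le_div_iff₀ (by positivity)]
    simp only [hC]
    exact_mod_cast choose_mul_pow_le hKN (d - 1)
  have hchoose' : ∀ d, ((N - M).choose (d - 1) : ℝ) ≤ C d := fun d =>
    (hchoose d).trans (div_le_self (Nat.cast_nonneg _) (one_le_pow₀ hK1))
  set Q := ∑ d ∈ Finset.Icc 2 W, C d / (K : ℝ) ^ (d - 1) * quality (α t d) (β t d) with hQ
  have hQ0 : 0 ≤ Q := Finset.sum_nonneg fun d _ =>
    mul_nonneg (div_nonneg (Nat.cast_nonneg _) (by positivity)) (sq_nonneg _)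
  have hB : ∑ d ∈ Finset.Icc 2 W, ((N - M).choose (d - 1) : ℝ) * α t d ≤ w * (A * L) := by
    calc _ ≤ ∑ _d ∈ Finset.Icc 2 W, A * L := Finset.sum_le_sum fun d hd =>
          (mul_le_mul_of_nonneg_right (hchoose' d) (hα0 d hd).le).trans (hCα d hd)
      _ = (Finset.Icc 2 W).card * (A * L) := by rw [Finset.sum_const, nsmul_eq_mul]
      _ ≤ _ := by gcongr
  have hE : ∑ d ∈ Finset.Icc 2 W, 2 * ((N - M).choose (d - 1) : ℝ) *
      (quality (α t d) (β t d) / 2 + 3 * α t d ^ 2) ≤ Q + ε / 8 * L := by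
    calc _ ≤ ∑ d ∈ Finset.Icc 2 W,
          (C d / (K : ℝ) ^ (d - 1) * quality (α t d) (β t d) + 6 * (A * L * r)) := by
          refine Finset.sum_le_sum fun d hd => ?_
          have h1 : ((N - M).choose (d - 1) : ℝ) * quality (α t d) (β t d)
              ≤ C d / (K : ℝ) ^ (d - 1) * quality (α t d) (β t d) :=
            mul_le_mul_of_nonneg_right (hchoose d) (sq_nonneg _)
          have h2 : ((N - M).choose (d - 1) : ℝ) * α t d * α t d ≤ A * L * r :=
            mul_le_mul ((mul_le_mul_of_nonneg_right (hchoose' d) (hα0 d hd).le).trans (hCα d hd))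
              (hαr d hd) (hα0 d hd).le (by positivity)
          linarith
      _ = Q + (Finset.Icc 2 W).card * (6 * (A * L * r)) := by
          rw [Finset.sum_add_distrib, Finset.sum_const, nsmul_eq_mul]
      _ ≤ Q + w * (6 * (A * L * r)) := by
          have hr0 : 0 ≤ r := by rw [hr]; positivity
          gcongr
      _ = Q + 6 * (w * (A * r)) * L := by ring
      _ ≤ _ := by gcongr
  have hg : γ * m t * (p t * I) ≤ (1 - ε) * L - Q := by
    rw [le_div_iff₀ (by positivity)] at hbound
    linarith
  have hDle : (⌈γ * m t⌉₊ : ℝ) ≤ γ * m t + 1 := (Nat.ceil_lt_add_one (by positivity)).le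
  have hpI0 : 0 ≤ p t * I := mul_nonneg (hp t).1 hI.le
  have hg0 : 0 ≤ γ * m t * (p t * I) := by positivity
  have hgL : γ * m t * (p t * I) ≤ L := by
    have : 0 ≤ ε * L := mul_nonneg hε0.le (by linarith)
    linarith
  have hDp : ⌈γ * m t⌉₊ * p t ≤ L / I + 1 := by
    have h1 : γ * m t * p t ≤ L / I := by rw [le_div_iff₀ hI]; linarith
    have h2 := mul_le_mul_of_nonneg_right hDle (hp t).1
    linarith [(hp t).2]
  have hq1 := exp_le_ratingTail (θ := θ) (hp t).1 hpt2 hDp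
  have hq2 := exp_le_edgeTail (ℓ := ℓ) hB hE
  have hx : ⌈γ * m t⌉₊ * (p t * I) * (1 + 2 * (p t * I))
      ≤ γ * m t * (p t * I) + ε / 8 * L + 1 := by
    have h1 : ⌈γ * m t⌉₊ * (p t * I) ≤ (γ * m t + 1) * (p t * I) :=
      mul_le_mul_of_nonneg_right hDle hpI0
    have h2 : ⌈γ * m t⌉₊ * (p t * I) * (1 + 2 * (p t * I))
        ≤ (γ * m t + 1) * (p t * I) * (1 + 2 * (p t * I)) :=
      mul_le_mul_of_nonneg_right h1 (by linarith)
    have h3 : 2 * (p t * I) * (γ * m t * (p t * I)) ≤ 2 * (ε / 16) * L :=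
      mul_le_mul (by linarith) hgL hg0 (by linarith)
    have h4 : p t * I * (1 + 2 * (p t * I)) ≤ 1 / 2 * 2 :=
      mul_le_mul hpt2 (by linarith) (by linarith) (by norm_num)
    linarith
  -- Exponent budget in units of log n: 1 - ε for ratings and hyperedges together, where `Q`
  -- cancels; ε/4 for each of the two fluctuation terms with their constants; ε/8 for each of the
  -- two second-order errors. The total 1 - ε/4 is what M supplies.
  have hqM : 1 ≤ ratingTail (p t) θ ⌈γ * m t⌉₊ * edgeTail W (α t) (β t) ℓ (N - M) * M := by
    refine le_trans ?_ (mul_le_mul (mul_le_mul hq1 hq2 (Real.exp_pos _).le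
      (ratingTail_nonneg hpt2 _)) hMy (Real.exp_pos _).le
      (mul_nonneg (ratingTail_nonneg hpt2 _) (edgeTail_nonneg _ _ _ _ _)))
    rw [hy, ← Real.exp_add, ← Real.exp_add, Real.one_le_exp_iff]
    have h1 : 2 * (1 + 4 * ratingVar θ * (L / I + 1))
        = 2 + 8 * ratingVar θ + 8 * ratingVar θ / I * L := by ring
    have h2 : 2 * (1 + 4 * (ℓ ^ 2 + 2) * (w * (A * L))) = 2 + 8 * (ℓ ^ 2 + 2) * (w * A) * L := by
      ring
    rw [h1, h2]
    linarith
  have hq_le : ratingTail (p t) θ ⌈γ * m t⌉₊ * edgeTail W (α t) (β t) ℓ (N - M) ≤ 1 :=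
    mul_le_one₀ (ratingTail_le_one (hp t).1 hpt2 _) (edgeTail_nonneg _ _ _ _ _) (edgeTail_le_one _)
  have := quarter_le_one_sub_pow hq_le hqM
  linarith

end Asymptotics

end MatrixCompletion

-- Conclusion

theorem theorem2
    -- constants: number of clusters, largest hyperedge size, distance and noise parameters
    (K W : ℕ) (hK : 2 ≤ K) (hW : 2 ≤ W)
    (γ θ : ℝ) (hγ_pos : 0 < γ) (hγ_lt : γ * (K.choose 2 : ℝ) < ((K ^ 2 / 4 : ℕ) : ℝ))
    (hθ_nonneg : 0 ≤ θ) (hθ_lt : θ < 1 / 2)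
    -- a sequence of problem sizes with `n → ∞`, `m = ω(log n)`, `m = o(exp n)`
    (n m : ℕ → ℕ) (hn : Tendsto n atTop atTop) (hKn : ∀ t, K ∣ n t)
    (hm_lower : (fun t => Real.log (n t)) =o[atTop] (fun t => (m t : ℝ)))
    (hm_upper : (fun t => (m t : ℝ)) =o[atTop] (fun t => Real.exp (n t)))
    -- hyperedge probabilities in the logarithmic average degree regime
    (α β : ℕ → ℕ → ℝ)
    (hαβ : ∀ t, ∀ d ∈ Finset.Icc 2 W, 0 ≤ β t d ∧ β t d < α t d ∧ α t d ≤ 1)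
    (hα : ∀ d ∈ Finset.Icc 2 W, (fun t => α t d) =Θ[atTop]
      (fun t => Real.log (n t) / ((n t - 1).choose (d - 1) : ℝ)))
    (hβ : ∀ d ∈ Finset.Icc 2 W, (fun t => β t d) =Θ[atTop]
      (fun t => Real.log (n t) / ((n t - 1).choose (d - 1) : ℝ)))
    -- the sample probability
    (p : ℕ → ℝ) (hp : ∀ t, 0 ≤ p t ∧ p t ≤ 1) (hp_zero : Tendsto p atTop (𝓝 0))
    (ε : ℝ) (hε : 0 < ε)
    (hp_le : ∀ᶠ t in atTop,
      p t ≤ MatrixCompletion.sampleBound (n t) (m t) K W γ θ ε (α t) (β t))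
    (ψ : ∀ t, MatrixCompletion.Estimator (n t) (m t) W) :
    ¬ Tendsto (fun t => MatrixCompletion.worstErr K W γ (p t) θ (α t) (β t) (ψ t))
        atTop (𝓝 0) := by
  have hm : Tendsto m atTop atTop := by
    rw [← tendsto_natCast_atTop_iff (R := ℝ)]
    refine tendsto_atTop_mono' _ ?_
      (Real.tendsto_log_atTop.comp (tendsto_natCast_atTop_atTop.comp hn))
    filter_upwards [hm_lower.bound one_pos] with t ht
    simp only [Real.norm_eq_abs, one_mul, Nat.abs_cast] at ht
    exact (le_abs_self _).trans ht
  -- The bound decreases in ε, so ε may be lowered to at most 1/2, as both asymptotic estimates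
  -- require.
  have hε' : 0 < min ε (1 / 2) := lt_min hε (by norm_num)
  have h1 := MatrixCompletion.eventually_le_worstErr_of_columns hK hγ_pos hγ_lt hθ_nonneg hθ_lt
    hn hKn hm hαβ hp hp_zero hε' (min_le_right _ _) ψ
  have h2 := MatrixCompletion.eventually_le_worstErr_of_users hK hγ_pos hγ_lt hθ_nonneg hθ_lt
    hn hKn hm hαβ (fun d hd => (hα d hd).1) (fun d hd => (hα d hd).1.trans (hβ d hd).2)
    hp hp_zero hε' (min_le_right _ _) ψ
  intro hlim
  -- Which term attains the maximum may vary along the sequence, so the contradiction is reached at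
  -- a single index where both implications are available.
  obtain ⟨t, ht1, ht2, ht3, ht4⟩ := (h1.and (h2.and (hp_le.and
    (hlim.eventually_lt_const (show (0 : ℝ) < 1 / 24 by norm_num))))).exists
  have h5 := ht3.trans (MatrixCompletion.sampleBound_anti hγ_pos.le (min_le_left ε (1 / 2)))
  rcases le_max_iff.1 h5 with h | h
  · exact absurd (ht2 h) (not_le.2 ht4)
  · exact absurd (ht1 h) (not_le.2 ht4)
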